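/- Let $(M,d)$ be a locally compact separable metric space, $m$ a positive Radon measure on $M$ with full support, and $(\mathcal E,\mathcal F)$ a regular Dirichlet form on $L^2(M;m)$ of pure jump type: for some symmetric positive Radon measure $J$ on $M\times M\setminus\mathrm{diag}$, $$\mathcal E(u,v)=\iint_{M\times M\setminus \mathrm{diag}}(u(x)-u(y))(v(x)-v(y))\,J(dx\,dy),\qquad u,v\in\mathcal F\cap C_0(M),$$ where $C_0(M)$ denotes the continuous functions with compact support. Let $(\{X_t\}_{t\ge0},\{P_x\})$ be an $m$-symmetric Hunt process on $M$, with cemetery $\Delta$ the point at infinity of the one-point compactification, whose Dirichlet form is $(\mathcal E,\mathcal F)$. Put $V(x,r)=m(\{y: d(x,y)<r\})$. Assume: 1. (Volume growth) $V(x,r)<\infty$ for all $x\in M$, $r>0$, and there are $c_1\in(0,1]$, $c_2\ge1$, $d_2\ge d_1>0$ with $$c_1(R/r)^{d_1}\le \frac{V(x,R)}{V(x,r)}\le c_2(R/r)^{d_2}\qquad (x\in M,\ 0<r<R).$$ 2. (Heat kernel) There are a properly exceptional Borel set $N$ (that is, $m(N)=0$ and for $x\in M\setminus N$, $P_x$-a.s.,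 neither $X_t$ nor $X_{t-}$ lies in $N$ for any $t>0$) and a nonnegative kernel $p(t,x,y)=p(t,y,x)$ on $(0,\infty)\times (M\setminus N)\times(M\setminus N)$ such that $P_x(X_t\in A)=\int_{A}p(t,x,y)\,m(dy)$ and $p(t+s,x,y)=\int_M p(t,x,z)p(s,z,y)\,m(dz)$ for all $t,s>0$, $x,y\in M\setminus N$ and Borel $A\subset M$. 3. (Heat kernel estimates) There are an increasing function $\phi$ on $[0,\infty)$, positive on $(0,\infty)$, with $\phi(0)=0$, and constants $c_3\in(0,1]$, $c_4\ge1$, $d_4\ge d_3>0$ with $c_3(R/r)^{d_3}\le\phi(R)/\phi(r)\le c_4(R/r)^{d_4}$ for $0<r<R$, and constants $L_1,L_2>0$ such that for all $t>0$ and $x,y\in M\setminus N$ $$L_1\, h(t,x,y)\le p(t,x,y)\le L_2\, h(t,x,y),\qquad h(t,x,y)=\min\Big\{\frac1{V(x,\phi^{-1}(t))},\ \frac{t}{V(x,d(x,y))\,\phi(d(x,y))}\Big\},$$ where the second term is read as $\infty$ if $x=y$, and $\phi^{-1}(t)=\inf\{r\ge0:\phi(r)>t\}$ (the usual inverse if $\phi$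 is an increasing bijection of $[0,\infty)$). Suppose $d_1>d_4$. Let $g$ be a positive decreasing (not necessarily strictly) function on $(0,\infty)$ with $g(t)\to0$ as $t\to\infty$, and put $\tilde\varphi(t)=\phi^{-1}(t)g(t)$ and $$R_{c,t}=\inf\Big\{\frac{g(u)}{g(v)}: 1\le \frac uv\le c,\ v\ge t\Big\}\qquad(c>1,\ t>0),$$ $$q_{\tilde\varphi}(t,x)=P_x\big(d(X_u,x)\le\tilde\varphi(u)\text{ for some }u>t\big),\qquad I(t,x)=\int_t^\infty\frac{V(x,\tilde\varphi(s))}{\phi(\tilde\varphi(s))}\,\frac{ds}{V(x,\phi^{-1}(s))}.$$ Then for all $x\in M$ outside a set of zero capacity the following holds: if $I(1,x)<\infty$ and $\lim_{c\to1+}\lim_{t\to\infty}R_{c,t}=1$, then there are constants $T,C_1,C_2>0$ such that $$C_1\,I(t,x)\le q_{\tilde\varphi}(t,x)\le C_2\,I(t,x)\qquad\text{for all } t\ge T.$$ Here the capacity is $\mathrm{Cap}(A)=\inf_{B\supset A,\ B\text{ open}}\inf\{\mathcal E(u,u)+\|u\|_{L^2}^2: u\in\mathcal F,\ u\ge1\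 m\text{-a.e. on }B\}$, with $\inf\emptyset=\infty$. -/

import Mathlib

open MeasureTheory Set Filter Topology
open scoped ENNReal NNReal

noncomputable section

/-- The one-point compactification carries its Borel σ-algebra. -/
instance onePointMeasurableSpace (M : Type*) [TopologicalSpace M] :
    MeasurableSpace (OnePoint M) := borel (OnePoint M)

instance onePointBorelSpace (M : Type*) [TopologicalSpace M] : BorelSpace (OnePoint M) := ⟨rfl⟩

/-! ### Dirichlet forms -/

/-- A Dirichlet form on `L²(M; m)`: a densely defined, closed, Markovian, symmetric, nonnegative
bilinear form. -/
structure DirichletForm {M : Type*} [MeasurableSpace M] (m : Measure M) where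
  /-- the domain `ℱ` -/
  dom : Submodule ℝ (Lp ℝ 2 m)
  /-- the form `ℰ` -/
  form : dom →ₗ[ℝ] dom →ₗ[ℝ] ℝ
  dense_dom : Dense (dom : Set (Lp ℝ 2 m))
  symm : ∀ u v : dom, form u v = form v u
  nonneg : ∀ u : dom, 0 ≤ form u u
  /-- `ℱ` is complete for `ℰ₁(u,u) = ℰ(u,u) + ‖u‖²`. -/
  closed : ∀ u : ℕ → dom,
    (∀ ε > 0, ∃ n₀, ∀ i ≥ n₀, ∀ j ≥ n₀,
      form (u i - u j) (u i - u j) + ‖(u i : Lp ℝ 2 m) - u j‖ ^ 2 < ε) →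
    ∃ v : dom, Tendsto
      (fun i => form (u i - v) (u i - v) + ‖(u i : Lp ℝ 2 m) - v‖ ^ 2) atTop (𝓝 0)
  /-- The unit contraction operates on `ℰ`. -/
  markov : ∀ u : dom, ∀ v : Lp ℝ 2 m,
    (∀ᵐ x ∂m, v x = max 0 (min ((u : Lp ℝ 2 m) x) 1)) →
    ∃ hv : v ∈ dom, form ⟨v, hv⟩ ⟨v, hv⟩ ≤ form u u

namespace DirichletForm

variable {M : Type*} [MeasurableSpace M] {m : Measure M}

/-- `ℰ₁(u,u) = ℰ(u,u) + ‖u‖²`. -/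
def energyOne (E : DirichletForm m) (u : E.dom) : ℝ :=
  E.form u u + ‖(u : Lp ℝ 2 m)‖ ^ 2

/-- The function `f` is a continuous compactly supported representative of `u ∈ ℱ`. -/
def IsCoreRep [TopologicalSpace M] (E : DirichletForm m) (u : E.dom) (f : M → ℝ) : Prop :=
  Continuous f ∧ HasCompactSupport f ∧ ∀ᵐ x ∂m, (u : Lp ℝ 2 m) x = f x

/-- Regularity: `ℱ ∩ C₀(M)` is `ℰ₁`-dense in `ℱ` and uniformly dense in `C₀(M)`, where `C₀(M)` is
the space of continuous functions with compact support. -/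
def IsRegular [TopologicalSpace M] (E : DirichletForm m) : Prop :=
  (∀ u : E.dom, ∀ ε > 0, ∃ (w : E.dom) (f : M → ℝ), E.IsCoreRep w f ∧ E.energyOne (u - w) < ε) ∧
  (∀ h : M → ℝ, Continuous h → HasCompactSupport h → ∀ ε > 0,
    ∃ (w : E.dom) (f : M → ℝ), E.IsCoreRep w f ∧ ∀ x, |h x - f x| < ε)

/-- The Beurling–Deny expression of the form consists of a jump part only:
`ℰ(u,v) = ∬_{x ≠ y} (u(x)-u(y)) (v(x)-v(y)) J(dx dy)` on `ℱ ∩ C₀(M)`, with a symmetric positive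
Radon measure `J` on `M × M` off the diagonal. -/
def IsPureJump [TopologicalSpace M] (E : DirichletForm m) : Prop :=
  ∃ J : Measure {z : M × M // z.1 ≠ z.2},
    IsFiniteMeasureOnCompacts J ∧
    J.map (fun z => ⟨z.1.swap, z.2.symm⟩) = J ∧
    ∀ (u v : E.dom) (f g : M → ℝ), E.IsCoreRep u f → E.IsCoreRep v g →
      Integrable (fun z => (f z.1.1 - f z.1.2) * (g z.1.1 - g z.1.2)) J ∧
      E.form u v = ∫ z, (f z.1.1 - f z.1.2) * (g z.1.1 - g z.1.2) ∂J

/-- The capacity `inf {ℰ₁(u,u) : u ∈ ℱ, u ≥ 1 m-a.e. on A}` (used for open `A`);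
it is `∞` if there is no such `u`. -/
def capOpen (E : DirichletForm m) (A : Set M) : ℝ≥0∞ :=
  ⨅ (u : E.dom) (_ : ∀ᵐ x ∂m, x ∈ A → 1 ≤ (u : Lp ℝ 2 m) x), ENNReal.ofReal (E.energyOne u)

/-- The (1-)capacity of an arbitrary set. -/
def cap [TopologicalSpace M] (E : DirichletForm m) (A : Set M) : ℝ≥0∞ :=
  ⨅ (B : Set M) (_ : IsOpen B) (_ : A ⊆ B), E.capOpen B

/-- `p x` holds for quasi every `x ∈ M`: outside a set of zero capacity. -/
def QuasiEverywhere [TopologicalSpace M] (E : DirichletForm m) (p : M → Prop) : Prop :=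
  ∃ N : Set M, E.cap N = 0 ∧ ∀ x, x ∉ N → p x

end DirichletForm

/-! ### Hunt processes -/

/-- A Hunt process on `M` with cemetery `Δ = ∞ ∈ OnePoint M`. Strong Markov property and
quasi-left-continuity refer to a right-continuous filtration to which the process is adapted. -/
structure HuntProcess (M Ω : Type*) [TopologicalSpace M] [mΩ : MeasurableSpace Ω] where
  X : ℝ≥0 → Ω → OnePoint M
  P : OnePoint M → Measure Ω
  ℱ : Filtration ℝ≥0 mΩ
  isProb : ∀ x, IsProbabilityMeasure (P x)
  rightCont_filtration : ℱ.IsRightContinuous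
  adapted : ∀ t, Measurable[ℱ t] (X t)
  measurable_transition : ∀ t (B : Set (OnePoint M)), MeasurableSet B →
    Measurable fun x => P x {ω | X t ω ∈ B}
  /-- normality -/
  start : ∀ x, ∀ᵐ ω ∂(P x), X 0 ω = x
  /-- `Δ` is a trap. -/
  trap : ∀ ω s t, s ≤ t → X s ω = OnePoint.infty → X t ω = OnePoint.infty
  right_continuous : ∀ ω t, Tendsto (fun s => X s ω) (𝓝[>] t) (𝓝 (X t ω))
  left_limits : ∀ ω t, 0 < t → ∃ l, Tendsto (fun s => X s ω) (𝓝[<] t) (𝓝 l)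
  /-- `P_x(X_{τ+s} ∈ B | ℱ_τ) = P_{X_τ}(X_s ∈ B)` on `{τ < ∞}`. -/
  strong_markov : ∀ (τ : Ω → WithTop ℝ≥0) (hτ : IsStoppingTime ℱ τ) (x : OnePoint M)
    (s : ℝ≥0) (B : Set (OnePoint M)) (A : Set Ω), MeasurableSet B →
    MeasurableSet[hτ.measurableSpace] A →
    P x {ω | ω ∈ A ∧ τ ω ≠ ⊤ ∧ X ((τ ω).untopD 0 + s) ω ∈ B} =
      ∫⁻ ω in {ω | ω ∈ A ∧ τ ω ≠ ⊤}, P (X ((τ ω).untopD 0) ω) {ω' | X s ω' ∈ B} ∂(P x)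
  /-- If `τ_n ↑ τ`, then `X_{τ_n} → X_τ` almost surely on `{τ < ∞}`. -/
  quasi_left_continuous : ∀ τ : ℕ → Ω → WithTop ℝ≥0, (∀ n, IsStoppingTime ℱ (τ n)) →
    Monotone τ → ∀ x, ∀ᵐ ω ∂(P x), ∀ T : ℝ≥0,
      IsLUB (range fun n => τ n ω) (T : WithTop ℝ≥0) →
      Tendsto (fun n => X ((τ n ω).untopD 0) ω) atTop (𝓝 (X T ω))

namespace HuntProcess

variable {M Ω : Type*} [TopologicalSpace M] [MeasurableSpace Ω]

/-- `p_t f(x) = E_x[f(X_t)]` for real functions, with `f(Δ) = 0`. -/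
def transition (Z : HuntProcess M Ω) (t : ℝ≥0) (f : M → ℝ) (x : M) : ℝ :=
  ∫ ω, (Z.X t ω).elim 0 f ∂(Z.P x)

/-- `p_t f(x) = E_x[f(X_t)]` for `[0,∞]`-valued functions, with `f(Δ) = 0`. -/
def ltransition (Z : HuntProcess M Ω) (t : ℝ≥0) (f : M → ℝ≥0∞) (x : M) : ℝ≥0∞ :=
  ∫⁻ ω, (Z.X t ω).elim 0 f ∂(Z.P x)

/-- `m`-symmetry of the transition function. -/
def IsSymmetric [MeasurableSpace M] (Z : HuntProcess M Ω) (m : Measure M) : Prop :=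
  ∀ t (f g : M → ℝ≥0∞), Measurable f → Measurable g →
    ∫⁻ x, f x * Z.ltransition t g x ∂m = ∫⁻ x, Z.ltransition t f x * g x ∂m

/-- The process is `m`-symmetric and its Dirichlet form is `E`: `u ∈ L²` belongs to `ℱ` iff
`t⁻¹ (u - p_t u, u)` has a finite limit as `t ↓ 0`, and then the limit is `ℰ(u,u)`. -/
def IsGeneratedBy [MeasurableSpace M] {m : Measure M} (Z : HuntProcess M Ω)
    (E : DirichletForm m) : Prop :=
  Z.IsSymmetric m ∧
  (∀ u : E.dom, Tendsto
    (fun t : ℝ≥0 => (t : ℝ)⁻¹ *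
      ∫ x, ((u : Lp ℝ 2 m) x - Z.transition t (u : Lp ℝ 2 m) x) * (u : Lp ℝ 2 m) x ∂m)
    (𝓝[>] 0) (𝓝 (E.form u u))) ∧
  (∀ u : Lp ℝ 2 m, (∃ l : ℝ, Tendsto
    (fun t : ℝ≥0 => (t : ℝ)⁻¹ * ∫ x, (u x - Z.transition t u x) * u x ∂m)
    (𝓝[>] 0) (𝓝 l)) → u ∈ E.dom)

/-- A properly exceptional Borel set `N`: `m(N) = 0`, and started outside `N` neither the path nor
its left limits ever meet `N`. -/
def IsProperlyExceptional [MeasurableSpace M] (Z : HuntProcess M Ω) (m : Measure M)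
    (N : Set M) : Prop :=
  MeasurableSet N ∧ m N = 0 ∧
  ∀ x : M, x ∉ N → ∀ᵐ ω ∂(Z.P x), ∀ t : ℝ≥0, 0 < t →
    Z.X t ω ∉ ((↑) : M → OnePoint M) '' N ∧
    ∀ l, Tendsto (fun s => Z.X s ω) (𝓝[<] t) (𝓝 l) → l ∉ ((↑) : M → OnePoint M) '' N

/-- `p` is a heat kernel of the process off `N`: a nonnegative symmetric transition density on
`(0,∞) × (M ∖ N) × (M ∖ N)` satisfying the Chapman–Kolmogorov equation. The values of `p` elsewhere
play no role. -/
def IsHeatKernel [MeasurableSpace M] (Z : HuntProcess M Ω) (m : Measure M) (N : Set M)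
    (p : ℝ≥0 → M → M → ℝ≥0) : Prop :=
  (∀ t : ℝ≥0, 0 < t → ∀ x ∉ N, Measurable fun y : ↥(Nᶜ) => p t x y) ∧
  (∀ t : ℝ≥0, 0 < t → ∀ x ∉ N, ∀ y ∉ N, p t x y = p t y x) ∧
  (∀ t : ℝ≥0, 0 < t → ∀ x ∉ N, ∀ A : Set M, MeasurableSet A →
    Z.P x {ω | Z.X t ω ∈ ((↑) : M → OnePoint M) '' A} = ∫⁻ y in A \ N, (p t x y : ℝ≥0∞) ∂m) ∧
  (∀ t s : ℝ≥0, 0 < t → 0 < s → ∀ x ∉ N, ∀ y ∉ N,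
    (p (t + s) x y : ℝ≥0∞) = ∫⁻ z in Nᶜ, (p t x z : ℝ≥0∞) * p s z y ∂m)

/-- `q_r(t,x) = P_x(d(X_u,x) ≤ r(u) for some u > t)`; the cemetery is at infinite distance. -/
def bottomCrossing {M : Type*} [MetricSpace M] (Z : HuntProcess M Ω) (r : ℝ → ℝ) (t : ℝ)
    (x : M) : ℝ≥0∞ :=
  Z.P x {ω | ∃ u : ℝ≥0, t < u ∧ ∃ y : M, Z.X u ω = (y : OnePoint M) ∧ dist y x ≤ r u}

end HuntProcess

/-! ### Volume, scale function and rate function -/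

/-- `V(x,r) = m(B(x,r))`. -/
def ballVol {M : Type*} [MetricSpace M] [MeasurableSpace M] (m : Measure M) (x : M) (r : ℝ) :
    ℝ≥0∞ := m (Metric.ball x r)

/-- Finite volume of balls and volume growth with exponents `d₁ ≤ d₂`. -/
def VolumeGrowth {M : Type*} [MetricSpace M] [MeasurableSpace M] (m : Measure M)
    (d₁ d₂ : ℝ) : Prop :=
  0 < d₁ ∧ d₁ ≤ d₂ ∧
  (∀ x r, 0 < r → ballVol m x r < ⊤) ∧
  ∃ c₁ c₂ : ℝ, 0 < c₁ ∧ c₁ ≤ 1 ∧ 1 ≤ c₂ ∧ ∀ (x : M) (r R : ℝ), 0 < r → r < R →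
    ENNReal.ofReal (c₁ * (R / r) ^ d₁) ≤ ballVol m x R / ballVol m x r ∧
    ballVol m x R / ballVol m x r ≤ ENNReal.ofReal (c₂ * (R / r) ^ d₂)

/-- An increasing scale function on `[0,∞)` with growth exponents `d₃ ≤ d₄`. -/
def IsScaleFunction (φ : ℝ → ℝ) (d₃ d₄ : ℝ) : Prop :=
  0 < d₃ ∧ d₃ ≤ d₄ ∧ MonotoneOn φ (Ici 0) ∧ φ 0 = 0 ∧ (∀ r, 0 < r → 0 < φ r) ∧
  ∃ c₃ c₄ : ℝ, 0 < c₃ ∧ c₃ ≤ 1 ∧ 1 ≤ c₄ ∧ ∀ r R : ℝ, 0 < r → r < R →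
    c₃ * (R / r) ^ d₃ ≤ φ R / φ r ∧ φ R / φ r ≤ c₄ * (R / r) ^ d₄

/-- The (right-continuous) inverse `φ⁻¹(t) = inf {r ≥ 0 : φ(r) > t}` of an increasing function on
`[0,∞)`. It is the ordinary inverse where that exists, see `scaleInv_apply`. -/
def scaleInv (φ : ℝ → ℝ) (t : ℝ) : ℝ := sInf {r | 0 ≤ r ∧ t < φ r}

theorem scaleInv_apply {φ : ℝ → ℝ} (hφ : StrictMonoOn φ (Ici 0)) {r : ℝ} (hr : 0 ≤ r) :
    scaleInv φ (φ r) = r := by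
  have h : {s | 0 ≤ s ∧ φ r < φ s} = Ioi r := by
    ext s
    constructor
    · rintro ⟨hs, h⟩
      exact (hφ.lt_iff_lt hr hs).1 h
    · intro h
      have hs : 0 ≤ s := hr.trans (le_of_lt h)
      exact ⟨hs, hφ hr hs h⟩
  rw [scaleInv, h, csInf_Ioi]

/-- Two-sided stable-like heat kernel estimates off `N`. On the diagonal the second term of the
minimum is `t / 0 = ∞`. -/
def HeatKernelEstimate {M : Type*} [MetricSpace M] [MeasurableSpace M] (m : Measure M)
    (N : Set M) (p : ℝ≥0 → M → M → ℝ≥0) (φ : ℝ → ℝ) : Prop :=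
  ∃ L₁ L₂ : ℝ≥0, 0 < L₁ ∧ 0 < L₂ ∧ ∀ t : ℝ≥0, 0 < t → ∀ x ∉ N, ∀ y ∉ N,
    L₁ * min (1 / ballVol m x (scaleInv φ t))
        ((t : ℝ≥0∞) / (ballVol m x (dist x y) * ENNReal.ofReal (φ (dist x y)))) ≤ p t x y ∧
    p t x y ≤ L₂ * min (1 / ballVol m x (scaleInv φ t))
        ((t : ℝ≥0∞) / (ballVol m x (dist x y) * ENNReal.ofReal (φ (dist x y))))

/-- `φ̃(t) = φ⁻¹(t) g(t)`. -/
def rateFun (φ g : ℝ → ℝ) (t : ℝ) : ℝ := scaleInv φ t * g t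

/-- `R_{c,t} = inf {g(u)/g(v) : 1 ≤ u/v ≤ c, v ≥ t}`. -/
def ratioInf (g : ℝ → ℝ) (c t : ℝ) : ℝ :=
  sInf {z | ∃ u v : ℝ, 1 ≤ u / v ∧ u / v ≤ c ∧ t ≤ v ∧ z = g u / g v}

/-- `lim_{c → 1+} lim_{t → ∞} R_{c,t} = 1`, including the existence of the limits. -/
def RegularRatio (g : ℝ → ℝ) : Prop :=
  ∃ ρ : ℝ → ℝ, (∀ c > 1, Tendsto (fun t => ratioInf g c t) atTop (𝓝 (ρ c))) ∧
    Tendsto ρ (𝓝[>] 1) (𝓝 1)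

/-- The integral over `(t,∞)` of `V(x,φ̃(s)) / (φ(φ̃(s)) V(x,φ⁻¹(s)))`. -/
def tailIntegral {M : Type*} [MetricSpace M] [MeasurableSpace M] (m : Measure M)
    (φ g : ℝ → ℝ) (x : M) (t : ℝ) : ℝ≥0∞ :=
  ∫⁻ s in Ioi t, ballVol m x (rateFun φ g s) /
    (ENNReal.ofReal (φ (rateFun φ g s)) * ballVol m x (scaleInv φ s))

/-- `f(t) ≍ h(t)` as `t → ∞`. -/
def AsympComparable (f h : ℝ → ℝ≥0∞) : Prop :=
  ∃ (T : ℝ) (c₁ c₂ : ℝ≥0), 0 < T ∧ 0 < c₁ ∧ 0 < c₂ ∧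
    ∀ t ≥ T, c₁ * h t ≤ f t ∧ f t ≤ c₂ * h t

end

/-! Write r(s) = `rateFun φ g s`, ψ = `scaleInv φ` and A_s = {X_s ∈ B(x, r(s))}. Off `N` the heat
kernel bounds give P_x(A_s) ≍ V(x,r(s)) / V(x,ψ(s)) for large s, so I(t) is comparable to the mean
of the weighted occupation time Λ = ∫_t^∞ 1_{A_s} ds / φ(r(s)). A visit to a ball of radius R lasts
a time of order φ(R), so one visit contributes order one to Λ, and the mean of Λ should measure the
probability that a visit occurs.

Upper bound (`exists_bottomCrossing_le`): after a visit at time s, with R = r(s), the process stays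
within R of its position at each time of (s + φ(R)/2, s + φ(R)) with probability bounded below. On
the window [s, cs] the rate r is almost constant, by the ratio condition on g, so every visit adds a
fixed amount to the mean occupation of the balls B(x, 4r(u)). That mean is at most a constant times
I(t).

Lower bound (`exists_le_bottomCrossing`): a second moment argument. The mean of Λ² is twice the
integral over s < u of the weighted probabilities of A_s ∩ A_u. For u ≤ cs, the Green-type bound
`exists_lintegral_supTransProb_le` gives a constant times P(A_s); this is where d₄ < d₁ (transience)
enters. For u > cs the times u - s and u are comparable, A_s and A_u decouple, and the contribution
is at most a constant times I(s) P(A_s). Hence E Λ² ≤ C (1 + I(t)) E Λ, so that P(Λ > 0) is at least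
a constant times I(t) / (1 + I(t)), and 1 + I(t) ≤ 1 + I(1) is bounded.

Both bounds hold at every x outside `N`, so it remains to see that a properly exceptional set has
zero capacity (`IsHeatKernel.cap_eq_zero`). The set function U ↦ ∫ E_x[e^{-σ_U}] ν(dx) on open sets
is a Choquet capacity. It tends to 0 along shrinking neighbourhoods of a compact K ⊆ N, because
paths and their left limits avoid K, and by capacitability `N` has outer capacity 0. To return to
energies, the hitting potential of an open G ⊇ N is truncated by a resolvent Uf that is at least 1
near a given point. The minimum is 1-excessive and dominated by Uf, so its energy is at most 3 ∫
E_x[e^{-σ_G}] f dm, which is small. Countably many local functions are then summed. -/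

set_option linter.unusedSectionVars false

noncomputable section

/-! ### Scale functions and their inverses -/

namespace IsScaleFunction

variable {φ : ℝ → ℝ} {d₃ d₄ : ℝ}

theorem pos (h : IsScaleFunction φ d₃ d₄) {r : ℝ} (hr : 0 < r) : 0 < φ r := h.2.2.2.2.1 r hr

theorem mono (h : IsScaleFunction φ d₃ d₄) {r s : ℝ} (hr : 0 ≤ r) (hs : r ≤ s) : φ r ≤ φ s :=
  h.2.2.1 hr (hr.trans hs : (0 : ℝ) ≤ s) hs

theorem exists_lower (h : IsScaleFunction φ d₃ d₄) :
    ∃ c > 0, ∀ r R, 0 < r → r ≤ R → c * (R / r) ^ d₃ * φ r ≤ φ R := by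
  obtain ⟨c₃, c₄, h1, h2, h3, h4⟩ := h.2.2.2.2.2
  refine ⟨c₃, h1, fun r R hr hR => ?_⟩
  -- The endpoint R = r is included at the price of c₃ ≤ 1.
  rcases hR.eq_or_lt with rfl | hR
  · rw [div_self hr.ne', Real.one_rpow]
    nlinarith [h.pos hr]
  · exact (le_div_iff₀ (h.pos hr)).1 (h4 r R hr hR).1

theorem exists_upper (h : IsScaleFunction φ d₃ d₄) :
    ∃ C ≥ 1, ∀ r R, 0 < r → r ≤ R → φ R ≤ C * (R / r) ^ d₄ * φ r := by
  obtain ⟨c₃, c₄, h1, h2, h3, h4⟩ := h.2.2.2.2.2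
  refine ⟨c₄, h3, fun r R hr hR => ?_⟩
  rcases hR.eq_or_lt with rfl | hR
  · rw [div_self hr.ne', Real.one_rpow]
    nlinarith [h.pos hr]
  · exact (div_le_iff₀ (h.pos hr)).1 (h4 r R hr hR).2

theorem exists_dilate_le (h : IsScaleFunction φ d₃ d₄) {K : ℝ} (hK : 0 ≤ K) :
    ∃ C > 0, ∀ r > 0, φ (K * r) ≤ C * φ r := by
  obtain ⟨C, hC, hu⟩ := h.exists_upper
  refine ⟨C * (max K 1) ^ d₄, by positivity, fun r hr => ?_⟩
  have := hu r (max K 1 * r) hr (by nlinarith [le_max_right K 1])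
  rw [mul_div_cancel_right₀ _ hr.ne'] at this
  exact (h.mono (by positivity) (by gcongr; exact le_max_left _ _)).trans this

theorem exists_gt (h : IsScaleFunction φ d₃ d₄) (t : ℝ) : ∃ r ≥ 0, t < φ r := by
  obtain ⟨c, hc, hl⟩ := h.exists_lower
  have h1 := ((tendsto_rpow_atTop h.1).const_mul_atTop
    (mul_pos hc (h.pos one_pos))).eventually_gt_atTop t
  obtain ⟨r, hr, hr1⟩ := (h1.and (eventually_ge_atTop 1)).exists
  refine ⟨r, by linarith, hr.trans_le ?_⟩
  have := hl 1 r one_pos hr1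
  rw [div_one] at this
  linarith

theorem exists_le (h : IsScaleFunction φ d₃ d₄) {t : ℝ} (ht : 0 < t) : ∃ r > 0, φ r ≤ t := by
  obtain ⟨c, hc, hl⟩ := h.exists_lower
  have h1 := (tendsto_rpow_atTop h.1).eventually_ge_atTop (φ 1 / (c * t))
  obtain ⟨R, hR, hR1⟩ := (h1.and (eventually_ge_atTop 1)).exists
  refine ⟨1 / R, by positivity, ?_⟩
  have := hl (1 / R) 1 (by positivity) (by rw [div_le_one (by linarith)]; exact hR1)
  rw [one_div_one_div] at this
  have h2 : 0 < φ (1 / R) := h.pos (by positivity)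
  rw [div_le_iff₀ (by positivity)] at hR
  have h3 : 0 < R ^ d₃ := by positivity
  have h4 : (c * R ^ d₃) * φ (1 / R) ≤ (c * R ^ d₃) * t := by linarith
  exact le_of_mul_le_mul_left h4 (by positivity)

theorem scaleInv_le {r t : ℝ} (hr : 0 ≤ r) (ht : t < φ r) : scaleInv φ t ≤ r :=
  csInf_le ⟨0, fun _ hr => hr.1⟩ ⟨hr, ht⟩

theorem le_scaleInv (h : IsScaleFunction φ d₃ d₄) {r t : ℝ} (ht : φ r ≤ t) :
    r ≤ scaleInv φ t := by
  obtain ⟨R, hR⟩ := h.exists_gt t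
  refine le_csInf ⟨R, hR⟩ fun s hs => ?_
  by_contra! hlt
  exact absurd (h.mono hs.1 hlt.le) (by linarith [hs.2])

theorem lt_of_scaleInv_lt (h : IsScaleFunction φ d₃ d₄) {r t : ℝ} (ht : scaleInv φ t < r) :
    t < φ r := by
  by_contra! hlt
  exact absurd (h.le_scaleInv hlt) (by linarith)

theorem le_of_lt_scaleInv {r t : ℝ} (hr : 0 ≤ r) (ht : r < scaleInv φ t) :
    φ r ≤ t := by
  by_contra! hlt
  exact absurd (scaleInv_le hr hlt) (by linarith)

theorem scaleInv_pos (h : IsScaleFunction φ d₃ d₄) {t : ℝ} (ht : 0 < t) : 0 < scaleInv φ t := by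
  obtain ⟨r, hr, hrt⟩ := h.exists_le ht
  exact hr.trans_le (h.le_scaleInv hrt)

theorem scaleInv_mono (h : IsScaleFunction φ d₃ d₄) : Monotone (scaleInv φ) := by
  intro s t hst
  obtain ⟨R, hR⟩ := h.exists_gt t
  exact le_csInf ⟨R, hR⟩ fun r hr => scaleInv_le hr.1 (hst.trans_lt hr.2)

/-- Since φ may jump or be flat, φ(φ⁻¹(t)) need not equal t. Strictly below φ⁻¹(t) the values of φ
are at most t, so φ is evaluated at half that point and then doubled. -/
theorem exists_apply_scaleInv_le (h : IsScaleFunction φ d₃ d₄) :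
    ∃ C > 0, ∀ t > 0, φ (scaleInv φ t) ≤ C * t := by
  obtain ⟨C, hC, hd⟩ := h.exists_dilate_le (K := 2) (by norm_num)
  refine ⟨C, hC, fun t ht => ?_⟩
  have hp := h.scaleInv_pos ht
  have := hd (scaleInv φ t / 2) (by positivity)
  rw [mul_div_cancel₀ _ (two_ne_zero)] at this
  exact this.trans (by gcongr; exact le_of_lt_scaleInv (by positivity) (by linarith))

/-- Strictly above φ⁻¹(t), for instance at twice that point, φ exceeds t; doubling brings this back
to φ⁻¹(t). -/
theorem exists_le_apply_scaleInv (h : IsScaleFunction φ d₃ d₄) :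
    ∃ C > 0, ∀ t > 0, t ≤ C * φ (scaleInv φ t) := by
  obtain ⟨C, hC, hd⟩ := h.exists_dilate_le (K := 2) (by norm_num)
  refine ⟨C, hC, fun t ht => ?_⟩
  have hp := h.scaleInv_pos ht
  exact (h.lt_of_scaleInv_lt (by linarith)).le.trans (hd _ hp)

theorem exists_scaleInv_dilate_le (h : IsScaleFunction φ d₃ d₄) {K : ℝ} (hK : 0 < K) :
    ∃ C > 0, ∀ t > 0, scaleInv φ (K * t) ≤ C * scaleInv φ t := by
  obtain ⟨C, hC, hd⟩ := h.exists_le_apply_scaleInv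
  obtain ⟨c, hc, hl⟩ := h.exists_lower
  -- R is chosen so that the growth of φ from φ⁻¹(t) to R φ⁻¹(t) beats the factor K C.
  have h1 := (tendsto_rpow_atTop h.1).eventually_gt_atTop (K * C / c)
  obtain ⟨R, hR, hR1⟩ := (h1.and (eventually_ge_atTop 1)).exists
  refine ⟨R, by linarith, fun t ht => ?_⟩
  have hp := h.scaleInv_pos ht
  refine scaleInv_le (by positivity) ?_
  have h2 := hl (scaleInv φ t) (R * scaleInv φ t) hp (by nlinarith)
  rw [mul_div_cancel_right₀ _ hp.ne'] at h2
  refine lt_of_lt_of_le ?_ h2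
  rw [div_lt_iff₀ hc] at hR
  have h3 := h.pos hp
  calc K * t ≤ K * (C * φ (scaleInv φ t)) := by gcongr; exact hd t ht
    _ = K * C * φ (scaleInv φ t) := by ring
    _ < c * R ^ d₃ * φ (scaleInv φ t) := mul_lt_mul_of_pos_right (by linarith) h3

/-- `φ` evaluated at a small multiple of `φ⁻¹(t)` is a small multiple of `t`. -/
theorem exists_apply_mul_scaleInv_le (h : IsScaleFunction φ d₃ d₄) {ε : ℝ} (hε : 0 < ε) :
    ∃ δ > 0, ∀ t > 0, ∀ a > 0, a ≤ δ → φ (scaleInv φ t * a) ≤ ε * t := by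
  obtain ⟨C, hC, hd⟩ := h.exists_apply_scaleInv_le
  obtain ⟨c, hc, hl⟩ := h.exists_lower
  have h1 := (tendsto_rpow_atTop h.1).eventually_gt_atTop (C / (c * ε))
  obtain ⟨R, hR, hR1⟩ := (h1.and (eventually_ge_atTop 1)).exists
  refine ⟨1 / R, by positivity, fun t ht a ha hle => ?_⟩
  have hp := h.scaleInv_pos ht
  have h2 := hl (scaleInv φ t * (1 / R)) (scaleInv φ t) (by positivity)
    (by rw [mul_one_div]; exact div_le_self hp.le hR1)
  rw [show scaleInv φ t / (scaleInv φ t * (1 / R)) = R by field_simp] at h2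
  refine (h.mono (s := scaleInv φ t * (1 / R)) (by positivity) (by gcongr)).trans ?_
  rw [div_lt_iff₀ (by positivity)] at hR
  have h3 : 0 < φ (scaleInv φ t * (1 / R)) := h.pos (by positivity)
  have h4 : C * φ (scaleInv φ t * (1 / R)) ≤ C * (ε * t) := by
    calc C * φ (scaleInv φ t * (1 / R)) ≤ R ^ d₃ * (c * ε) * φ (scaleInv φ t * (1 / R)) := by gcongr
      _ = ε * (c * R ^ d₃ * φ (scaleInv φ t * (1 / R))) := by ring
      _ ≤ ε * (C * t) := mul_le_mul_of_nonneg_left (h2.trans (hd t ht)) hε.le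
      _ = _ := by ring
  exact le_of_mul_le_mul_left h4 hC

end IsScaleFunction

/-! ### Volumes of balls -/

/-- The volume of a ball as a real number. -/
def realVol {M : Type*} [MetricSpace M] [MeasurableSpace M] (m : Measure M) (x : M) (r : ℝ) : ℝ :=
  (ballVol m x r).toReal

namespace VolumeGrowth

variable {M : Type*} [MetricSpace M] [MeasurableSpace M] {m : Measure M} {d₁ d₂ : ℝ}

theorem ballVol_lt_top (h : VolumeGrowth m d₁ d₂) (x : M) (r : ℝ) : ballVol m x r < ⊤ :=
  (measure_mono (Metric.ball_subset_ball (le_max_left r 1))).trans_lt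
    (h.2.2.1 x (max r 1) (by positivity))

theorem ofReal_realVol (h : VolumeGrowth m d₁ d₂) (x : M) (r : ℝ) :
    ENNReal.ofReal (realVol m x r) = ballVol m x r :=
  ENNReal.ofReal_toReal (h.ballVol_lt_top x r).ne

theorem realVol_pos [m.IsOpenPosMeasure] (h : VolumeGrowth m d₁ d₂) (x : M) {r : ℝ}
    (hr : 0 < r) : 0 < realVol m x r :=
  ENNReal.toReal_pos (Metric.measure_ball_pos m x hr).ne' (h.ballVol_lt_top x r).ne

theorem realVol_mono (h : VolumeGrowth m d₁ d₂) (x : M) {r s : ℝ} (hs : r ≤ s) :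
    realVol m x r ≤ realVol m x s :=
  ENNReal.toReal_mono (h.ballVol_lt_top x s).ne (measure_mono (Metric.ball_subset_ball hs))

theorem realVol_le_of_add_dist_le (h : VolumeGrowth m d₁ d₂) {x z : M} {r s : ℝ}
    (hs : r + dist z x ≤ s) : realVol m z r ≤ realVol m x s :=
  ENNReal.toReal_mono (h.ballVol_lt_top x s).ne
    (measure_mono (Metric.ball_subset_ball' hs))

theorem ofReal_realVol_div [m.IsOpenPosMeasure] (h : VolumeGrowth m d₁ d₂) (x : M) {r R : ℝ}
    (hr : 0 < r) :
    ballVol m x R / ballVol m x r = ENNReal.ofReal (realVol m x R / realVol m x r) := by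
  rw [ENNReal.ofReal_div_of_pos (h.realVol_pos x hr), h.ofReal_realVol, h.ofReal_realVol]

theorem exists_lower [m.IsOpenPosMeasure] (h : VolumeGrowth m d₁ d₂) :
    ∃ c > 0, ∀ x r R, 0 < r → r ≤ R →
      c * (R / r) ^ d₁ * realVol m x r ≤ realVol m x R := by
  obtain ⟨c₁, c₂, h1, h2, h3, h4⟩ := h.2.2.2
  refine ⟨c₁, h1, fun x r R hr hR => ?_⟩
  rcases hR.eq_or_lt with rfl | hR
  · rw [div_self hr.ne', Real.one_rpow]
    nlinarith [h.realVol_pos x hr]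
  · have := (h4 x r R hr hR).1
    rw [h.ofReal_realVol_div x hr, ENNReal.ofReal_le_ofReal_iff (by unfold realVol; positivity)]
      at this
    exact (le_div_iff₀ (h.realVol_pos x hr)).1 this

theorem exists_dilate_le [m.IsOpenPosMeasure] (h : VolumeGrowth m d₁ d₂) {K : ℝ} (hK : 0 ≤ K) :
    ∃ C > 0, ∀ x, ∀ r > 0, realVol m x (K * r) ≤ C * realVol m x r := by
  obtain ⟨c₁, c₂, h1, h2, h3, h4⟩ := h.2.2.2
  -- Volume growth compares radii r < R strictly, so K is enlarged to exceed 1.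
  have hK2 : 1 < K + 2 := by linarith
  refine ⟨c₂ * (K + 2) ^ d₂, by positivity, fun x r hr => ?_⟩
  have := (h4 x r ((K + 2) * r) hr (by nlinarith)).2
  rw [h.ofReal_realVol_div x hr, ENNReal.ofReal_le_ofReal_iff (by positivity),
    mul_div_cancel_right₀ _ hr.ne', div_le_iff₀ (h.realVol_pos x hr)] at this
  exact (h.realVol_mono x (by nlinarith)).trans this

/-- Volumes of balls of comparable radius with nearby centres are comparable. -/
theorem exists_realVol_le_of_dist [m.IsOpenPosMeasure] (h : VolumeGrowth m d₁ d₂) {K : ℝ}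
    (hK : 0 ≤ K) :
    ∃ C > 0, ∀ x z, ∀ r > 0, dist x z ≤ K * r → realVol m x r ≤ C * realVol m z r := by
  obtain ⟨C, hC, hd⟩ := h.exists_dilate_le (K := K + 1) (by linarith)
  exact ⟨C, hC, fun x z r hr hxz =>
    (h.realVol_le_of_add_dist_le (by nlinarith)).trans (hd z r hr)⟩

end VolumeGrowth

/-! ### Transition semigroup and Markov property of a Hunt process -/

theorem OnePoint.continuous_elim_zero {M : Type*} [TopologicalSpace M] [R1Space M]
    {f : M → ℝ} (hf : Continuous f) (hc : HasCompactSupport f) :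
    Continuous fun y : OnePoint M => y.elim 0 f := by
  rw [OnePoint.continuous_iff]
  refine ⟨?_, hf⟩
  refine tendsto_const_nhds.congr' ?_
  rw [coclosedCompact_eq_cocompact]
  have := hc.isCompact.compl_mem_cocompact
  filter_upwards [this] with x hx
  exact (image_eq_zero_of_notMem_tsupport hx).symm

theorem OnePoint.measurableEmbedding_coe {M : Type*} [TopologicalSpace M] [MeasurableSpace M]
    [BorelSpace M] : MeasurableEmbedding ((↑) : M → OnePoint M) :=
  OnePoint.isOpenEmbedding_coe.measurableEmbedding

/-- The dyadic point `(⌊2ⁿ s⌋ + 1) / 2ⁿ` to the right of `s`. -/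
def dyadicAbove (n : ℕ) (s : ℝ≥0) : ℝ≥0 := (⌊2 ^ n * s⌋₊ + 1) / 2 ^ n

theorem lt_dyadicAbove (n : ℕ) (s : ℝ≥0) : s < dyadicAbove n s := by
  unfold dyadicAbove
  rw [lt_div_iff₀ (by positivity), mul_comm]
  exact Nat.lt_floor_add_one _

theorem dyadicAbove_le (n : ℕ) (s : ℝ≥0) : dyadicAbove n s ≤ s + (1 / 2) ^ n := by
  unfold dyadicAbove
  rw [div_le_iff₀ (by positivity), add_mul, ← mul_pow]
  have := Nat.floor_le (show 0 ≤ 2 ^ n * s by positivity)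
  norm_num
  rwa [mul_comm s]

theorem tendsto_dyadicAbove (s : ℝ≥0) : Tendsto (fun n => dyadicAbove n s) atTop (𝓝[>] s) := by
  refine tendsto_nhdsWithin_iff.2 ⟨?_, .of_forall fun n => lt_dyadicAbove n s⟩
  refine tendsto_of_tendsto_of_tendsto_of_le_of_le tendsto_const_nhds ?_
    (fun n => (lt_dyadicAbove n s).le) (fun n => dyadicAbove_le n s)
  have : Tendsto (fun n : ℕ => (1 / 2 : ℝ≥0) ^ n) atTop (𝓝 0) :=
    NNReal.tendsto_pow_atTop_nhds_zero_of_lt_one (by norm_num)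
  simpa using this.const_add s

namespace HuntProcess

variable {M Ω : Type*} [TopologicalSpace M] [MeasurableSpace Ω] (Z : HuntProcess M Ω)

instance (x : OnePoint M) : IsProbabilityMeasure (Z.P x) := Z.isProb x

theorem measurable_X (t : ℝ≥0) : Measurable (Z.X t) := (Z.adapted t).mono (Z.ℱ.le t) le_rfl

theorem tendsto_dyadicAbove (s : ℝ≥0) (ω : Ω) :
    Tendsto (fun n => Z.X (dyadicAbove n s) ω) atTop (𝓝 (Z.X s ω)) :=
  (Z.right_continuous ω s).comp (_root_.tendsto_dyadicAbove s)

/-- The transition kernels. -/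
def kern (t : ℝ≥0) : ProbabilityTheory.Kernel (OnePoint M) (OnePoint M) where
  toFun x := (Z.P x).map (Z.X t)
  measurable' := Measure.measurable_of_measurable_coe _ fun B hB => by
    simp only [Measure.map_apply (Z.measurable_X t) hB]
    exact Z.measurable_transition t B hB

/-- `E_y[f(X_t)]` for functions on the one-point compactification. -/
def sg (t : ℝ≥0) (f : OnePoint M → ℝ≥0∞) (y : OnePoint M) : ℝ≥0∞ := ∫⁻ ω, f (Z.X t ω) ∂Z.P y

theorem sg_eq_lintegral_kern {t : ℝ≥0} {f : OnePoint M → ℝ≥0∞} (hf : Measurable f)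
    (y : OnePoint M) : Z.sg t f y = ∫⁻ z, f z ∂Z.kern t y :=
  (lintegral_map hf (Z.measurable_X t)).symm

theorem measurable_sg (t : ℝ≥0) {f : OnePoint M → ℝ≥0∞} (hf : Measurable f) :
    Measurable (Z.sg t f) := by
  rw [funext (Z.sg_eq_lintegral_kern hf)]
  exact hf.lintegral_kernel

theorem sg_mono {t : ℝ≥0} {f g : OnePoint M → ℝ≥0∞} (h : f ≤ g) : Z.sg t f ≤ Z.sg t g :=
  fun _ => lintegral_mono fun _ => h _

theorem sg_zero (f : OnePoint M → ℝ≥0∞) (y : OnePoint M) : Z.sg 0 f y = f y := by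
  rw [sg, lintegral_congr_ae ((Z.start y).mono fun ω h => by rw [h])]
  simp

/-- The strong Markov property at a constant time. First visits are later handled along discrete
sets of times, so deterministic times suffice throughout. -/
theorem measure_markov (s v : ℝ≥0) {A : Set Ω} (hA : MeasurableSet[Z.ℱ s] A)
    {B : Set (OnePoint M)} (hB : MeasurableSet B) (x : OnePoint M) :
    Z.P x (A ∩ {ω | Z.X (s + v) ω ∈ B}) =
      ∫⁻ ω in A, Z.P (Z.X s ω) {ω' | Z.X v ω' ∈ B} ∂Z.P x := by
  have := Z.strong_markov (fun _ => WithTop.some s) (isStoppingTime_const Z.ℱ s) x v B A hB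
    (by rwa [IsStoppingTime.measurableSpace_const])
  simpa only [Set.inter_def, mem_ofPred_eq, ne_eq, WithTop.coe_ne_top, not_false_eq_true,
    and_true, true_and, WithTop.untopD_coe, ofPred_mem_eq] using this

theorem markov (s v : ℝ≥0) {A : Set Ω} (hA : MeasurableSet[Z.ℱ s] A)
    {f : OnePoint M → ℝ≥0∞} (hf : Measurable f) (x : OnePoint M) :
    ∫⁻ ω in A, f (Z.X (s + v) ω) ∂Z.P x = ∫⁻ ω in A, Z.sg v f (Z.X s ω) ∂Z.P x := by
  have key : ((Z.P x).restrict A).map (Z.X (s + v)) =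
      (((Z.P x).restrict A).map (Z.X s)).bind (Z.kern v) := by
    ext B hB
    rw [Measure.map_apply (Z.measurable_X _) hB, Measure.bind_apply hB (Z.kern v).aemeasurable,
      lintegral_map ((Z.kern v).measurable_coe hB) (Z.measurable_X s),
      Measure.restrict_apply (Z.measurable_X _ hB), inter_comm]
    refine (Z.measure_markov s v hA hB x).trans (lintegral_congr fun ω => ?_)
    exact (Measure.map_apply (Z.measurable_X v) hB).symm
  rw [← lintegral_map hf (Z.measurable_X _), key,
    Measure.lintegral_bind (Z.kern v).aemeasurable hf.aemeasurable,
    lintegral_map hf.lintegral_kernel (Z.measurable_X s)]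
  exact lintegral_congr fun ω => (Z.sg_eq_lintegral_kern hf _).symm

theorem sg_add (s v : ℝ≥0) {f : OnePoint M → ℝ≥0∞} (hf : Measurable f) (x : OnePoint M) :
    Z.sg (s + v) f x = Z.sg s (Z.sg v f) x := by
  simpa [sg] using Z.markov s v MeasurableSet.univ hf x

/-- A right-continuous process is jointly measurable when tested against continuous functions. -/
theorem measurable_uncurry_comp {F : Type*} [TopologicalSpace F] [TopologicalSpace.PseudoMetrizableSpace F]
    [MeasurableSpace F] [BorelSpace F] {f : OnePoint M → F} (hf : Continuous f) :
    Measurable fun z : ℝ≥0 × Ω => f (Z.X z.1 z.2) := by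
  refine measurable_of_tendsto_metrizable (f := fun n z => f (Z.X (dyadicAbove n z.1) z.2))
    (fun n => ?_) ?_
  swap
  · rw [tendsto_pi_nhds]
    intro z
    have h1 := hf.tendsto (Z.X z.1 z.2)
    exact h1.comp (Z.tendsto_dyadicAbove z.1 z.2)
  have h1 : Measurable fun q : ℕ × Ω => f (Z.X ((q.1 + 1) / 2 ^ n) q.2) :=
    measurable_from_prod_countable_right fun k => 
      hf.measurable.comp (Z.measurable_X (((k : ℕ) + 1) / 2 ^ n))
  have h2 : Measurable fun z : ℝ≥0 × Ω => (⌊2 ^ n * z.1⌋₊, z.2) :=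
    (Nat.measurable_floor.comp (measurable_fst.const_mul _)).prodMk measurable_snd
  have h3 := h1.comp h2
  simpa only [dyadicAbove, Function.comp_def] using h3

end HuntProcess

namespace HuntProcess

variable {M Ω : Type*} [MetricSpace M] [LocallyCompactSpace M] [SecondCountableTopology M]
  [MeasurableSpace Ω] (Z : HuntProcess M Ω)

/-- An open U is a countable union of compacts K_n. With cutoffs f_n equal to 1 on K_n and 0 off U,
the set U is the union of the sets {f_n = 1}, and right-continuous paths tested against continuous
functions are jointly measurable. -/
theorem measurableSet_uncurry {U : Set M} (hU : IsOpen U) :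
    MeasurableSet {z : ℝ≥0 × Ω | Z.X z.1 z.2 ∈ ((↑) : M → OnePoint M) '' U} := by
  have : LocallyCompactSpace U := hU.locallyCompactSpace
  let K := CompactExhaustion.choice U
  have hK : ∀ n, IsCompact ((↑) '' K n : Set M) := fun n =>
    (K.isCompact n).image continuous_subtype_val
  have hKU : ∀ n, ((↑) '' K n : Set M) ⊆ U := fun n => by
    rintro _ ⟨y, -, rfl⟩
    exact y.2
  choose f hf1 hf0 hfc hf01 using fun n =>
    exists_continuous_one_zero_of_isCompact (hK n) hU.isClosed_compl
      (disjoint_compl_right_iff_subset.2 (hKU n))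
  have hset : {z : ℝ≥0 × Ω | Z.X z.1 z.2 ∈ ((↑) : M → OnePoint M) '' U} =
      ⋃ n, {z : ℝ≥0 × Ω | (Z.X z.1 z.2).elim 0 (f n) = 1} := by
    ext z
    simp only [mem_ofPred_eq, mem_iUnion]
    constructor
    · rintro ⟨y, hy, hyz⟩
      obtain ⟨n, hn⟩ := K.exists_mem ⟨y, hy⟩
      refine ⟨n, ?_⟩
      rw [← hyz, OnePoint.elim_some]
      exact hf1 n ⟨_, hn, rfl⟩
    · rintro ⟨n, hn⟩
      induction hz : Z.X z.1 z.2 using OnePoint.rec with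
      | infty => rw [hz, OnePoint.elim_infty] at hn; exact absurd hn zero_ne_one
      | coe y =>
        rw [hz, OnePoint.elim_some] at hn
        refine ⟨y, ?_, rfl⟩
        by_contra hy
        exact zero_ne_one ((hf0 n hy).symm.trans hn)
  rw [hset]
  exact MeasurableSet.iUnion fun n => Z.measurable_uncurry_comp
    (OnePoint.continuous_elim_zero (f n).continuous (hfc n)) (measurableSet_singleton 1)

end HuntProcess

/-! ### Consequences of the heat kernel estimates -/

namespace HuntProcess

/-- `P_x(X_t ∈ A)`. -/
def transProb {M Ω : Type*} [TopologicalSpace M] [MeasurableSpace Ω] (Z : HuntProcess M Ω)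
    (t : ℝ≥0) (x : OnePoint M) (A : Set M) : ℝ≥0∞ :=
  Z.P x {ω | Z.X t ω ∈ ((↑) : M → OnePoint M) '' A}

section Basic

theorem transProb_mono {M Ω : Type*} [TopologicalSpace M] [MeasurableSpace Ω]
    (Z : HuntProcess M Ω) (t : ℝ≥0) (x : OnePoint M) {A B : Set M} (h : A ⊆ B) :
    Z.transProb t x A ≤ Z.transProb t x B :=
  measure_mono fun _ hω => image_mono h hω

theorem transProb_le_one {M Ω : Type*} [TopologicalSpace M] [MeasurableSpace Ω]
    (Z : HuntProcess M Ω) (t : ℝ≥0) (x : OnePoint M) (A : Set M) : Z.transProb t x A ≤ 1 :=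
  prob_le_one

variable {M Ω : Type*} [TopologicalSpace M] [MeasurableSpace M] [BorelSpace M] [MeasurableSpace Ω]
  (Z : HuntProcess M Ω)

theorem measurableSet_mem (t : ℝ≥0) {A : Set M} (hA : MeasurableSet A) :
    MeasurableSet[Z.ℱ t] {ω | Z.X t ω ∈ ((↑) : M → OnePoint M) '' A} :=
  Z.adapted t (OnePoint.measurableEmbedding_coe.measurableSet_image.2 hA)

theorem measure_inter_mem (s v : ℝ≥0) {A : Set Ω} (hA : MeasurableSet[Z.ℱ s] A)
    {B : Set M} (hB : MeasurableSet B) (x : OnePoint M) :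
    Z.P x (A ∩ {ω | Z.X (s + v) ω ∈ ((↑) : M → OnePoint M) '' B}) =
      ∫⁻ ω in A, Z.transProb v (Z.X s ω) B ∂Z.P x :=
  Z.measure_markov s v hA (OnePoint.measurableEmbedding_coe.measurableSet_image.2 hB) x

end Basic

section Estimates

variable {M Ω : Type*} [MetricSpace M] [MeasurableSpace M] [BorelSpace M] [MeasurableSpace Ω]
  {m : Measure M} [m.IsOpenPosMeasure] {Z : HuntProcess M Ω} {N : Set M}
  {p : ℝ≥0 → M → M → ℝ≥0} {φ : ℝ → ℝ} {d₁ d₂ d₃ d₄ : ℝ}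

theorem IsHeatKernel.transProb_self_eq_zero (hp : Z.IsHeatKernel m N p) (hN : MeasurableSet N)
    {t : ℝ≥0} (ht : 0 < t) {x : M} (hx : x ∉ N) : Z.transProb t x N = 0 := by
  simpa [transProb] using hp.2.2.1 t ht x hx N hN

theorem IsHeatKernel.ae_notMem (hp : Z.IsHeatKernel m N p) (hN : MeasurableSet N)
    {t : ℝ≥0} (ht : 0 < t) {x : M} (hx : x ∉ N) :
    ∀ᵐ ω ∂Z.P x, Z.X t ω ∉ ((↑) : M → OnePoint M) '' N := by
  simpa [ae_iff, transProb] using hp.transProb_self_eq_zero hN ht hx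

/-- Only the on-diagonal term 1 / V(x, φ⁻¹(t)) of the upper estimate is needed, here and in
everything that follows. -/
theorem IsHeatKernel.exists_transProb_le (hp : Z.IsHeatKernel m N p) (hN : MeasurableSet N)
    (hV : VolumeGrowth m d₁ d₂) (hφ : IsScaleFunction φ d₃ d₄)
    (hest : HeatKernelEstimate m N p φ) :
    ∃ C > 0, ∀ t : ℝ≥0, 0 < t → ∀ x ∉ N, ∀ A, MeasurableSet A →
      Z.transProb t x A ≤ ENNReal.ofReal (C / realVol m x (scaleInv φ t)) * m A := by
  obtain ⟨L₁, L₂, h1, h2, h⟩ := hest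
  refine ⟨L₂, h2, fun t ht x hx A hA => ?_⟩
  have hψ := hV.realVol_pos x (hφ.scaleInv_pos (t := t) ht)
  rw [transProb, hp.2.2.1 t ht x hx A hA]
  calc ∫⁻ y in A \ N, (p t x y : ℝ≥0∞) ∂m
      ≤ ∫⁻ y in A \ N, ENNReal.ofReal (L₂ / realVol m x (scaleInv φ t)) ∂m := by
        refine setLIntegral_mono' (hA.diff hN) fun y hy => ?_
        refine (h t ht x hx y hy.2).2.trans ?_
        refine le_of_le_of_eq (b := L₂ * (1 / ballVol m x (scaleInv φ t)))
          (by gcongr; exact min_le_left _ _) ?_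
        rw [ENNReal.ofReal_div_of_pos hψ, hV.ofReal_realVol, ENNReal.ofReal_coe_nnreal,
          mul_one_div]
    _ ≤ _ := by
        rw [setLIntegral_const]
        gcongr
        exact sdiff_subset

/-- V(x,·) and φ are monotone, so on B(x,r) the lower estimate is at least its value at distance r.
Integrating this constant over the ball minus the null set `N` gives the bound. -/
theorem IsHeatKernel.exists_le_transProb (hp : Z.IsHeatKernel m N p) (hN : MeasurableSet N)
    (hN0 : m N = 0) (hV : VolumeGrowth m d₁ d₂) (hφ : IsScaleFunction φ d₃ d₄)
    (hest : HeatKernelEstimate m N p φ) :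
    ∃ c > 0, ∀ t : ℝ≥0, 0 < t → ∀ x ∉ N, ∀ r > 0,
      ENNReal.ofReal (c * min (1 / realVol m x (scaleInv φ t)) (t / (realVol m x r * φ r)) *
        realVol m x r) ≤ Z.transProb t x (Metric.ball x r) := by
  obtain ⟨L₁, L₂, h1, h2, h⟩ := hest
  refine ⟨L₁, h1, fun t ht x hx r hr => ?_⟩
  have hψ := hV.realVol_pos x (hφ.scaleInv_pos (t := t) ht)
  have hr' := hV.realVol_pos x hr
  have hφr := hφ.pos hr
  have hB : MeasurableSet (Metric.ball x r) := measurableSet_ball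
  rw [transProb, hp.2.2.1 t ht x hx _ hB, ENNReal.ofReal_mul (by positivity), hV.ofReal_realVol,
    ballVol, ← measure_sdiff_null hN0, ← setLIntegral_const]
  refine setLIntegral_mono' (hB.diff hN) fun y hy => ?_
  refine le_trans ?_ (h t ht x hx y hy.2).1
  rw [ENNReal.ofReal_mul (by positivity), ENNReal.ofReal_coe_nnreal, ENNReal.ofReal_min]
  have hd : dist x y < r := by simpa [dist_comm] using hy.1
  gcongr
  · rw [ENNReal.ofReal_div_of_pos hψ, hV.ofReal_realVol, ENNReal.ofReal_one]
  · rw [ENNReal.ofReal_div_of_pos (by positivity), ENNReal.ofReal_mul hr'.le, hV.ofReal_realVol,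
      ENNReal.ofReal_coe_nnreal]
    refine ENNReal.div_le_div_left (mul_le_mul' (measure_mono ?_) ?_) _
    · exact Metric.ball_subset_ball hd.le
    · exact ENNReal.ofReal_le_ofReal (hφ.mono dist_nonneg hd.le)

theorem IsHeatKernel.exists_transProb_ball_le (hp : Z.IsHeatKernel m N p) (hN : MeasurableSet N)
    (hV : VolumeGrowth m d₁ d₂) (hφ : IsScaleFunction φ d₃ d₄)
    (hest : HeatKernelEstimate m N p φ) :
    ∃ C > 0, ∀ t : ℝ≥0, 0 < t → ∀ z ∉ N, ∀ x R,
      Z.transProb t z (Metric.ball x R) ≤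
        ENNReal.ofReal (C * realVol m x R / realVol m z (scaleInv φ t)) := by
  obtain ⟨C, hC, h⟩ := hp.exists_transProb_le hN hV hφ hest
  refine ⟨C, hC, fun t ht z hz x R => (h t ht z hz _ measurableSet_ball).trans_eq ?_⟩
  have hψ := hV.realVol_pos z (hφ.scaleInv_pos (t := t) ht)
  rw [← ballVol, ← hV.ofReal_realVol, ← ENNReal.ofReal_mul (by positivity)]
  congr 1
  ring

/-- Within time of order `φ(ρ)` the process stays within distance `ρ` with a probability bounded
below. -/
theorem IsHeatKernel.exists_le_transProb_ball_of_lt (hp : Z.IsHeatKernel m N p)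
    (hN : MeasurableSet N) (hN0 : m N = 0) (hV : VolumeGrowth m d₁ d₂)
    (hφ : IsScaleFunction φ d₃ d₄) (hest : HeatKernelEstimate m N p φ) :
    ∃ c > 0, ∀ t : ℝ≥0, ∀ z ∉ N, ∀ r > 0, φ r / 2 < t → t < φ r →
      ENNReal.ofReal c ≤ Z.transProb t z (Metric.ball z r) := by
  obtain ⟨c, hc, h⟩ := hp.exists_le_transProb hN hN0 hV hφ hest
  refine ⟨c / 2, by positivity, fun t z hz r hr h1 h2 => ?_⟩
  have hφr := hφ.pos hr
  have ht : (0 : ℝ) < t := by linarith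
  refine le_trans (ENNReal.ofReal_le_ofReal ?_) (h t ht z hz r hr)
  have hψ := hV.realVol_pos z (hφ.scaleInv_pos ht)
  have hr' := hV.realVol_pos z hr
  -- As t < φ(r), φ⁻¹(t) ≤ r, so the first term of the minimum times V(z,r) is at least 1; as t >
  -- φ(r)/2, the second one is at least 1/2.
  have hle : realVol m z (scaleInv φ t) ≤ realVol m z r :=
    hV.realVol_mono z (IsScaleFunction.scaleInv_le hr.le h2)
  rw [mul_assoc, div_eq_mul_inv]
  gcongr
  rw [← div_le_iff₀ hr']
  refine le_min ?_ ?_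
  · rw [div_le_div_iff₀ hr' hψ]
    nlinarith
  · rw [div_le_div_iff₀ hr' (by positivity)]
    nlinarith

/-- For r ≤ φ⁻¹(t) the minimum is comparable to its on-diagonal term, because V(x,r) φ(r) ≤
V(x,φ⁻¹(t)) · C t. With `exists_transProb_ball_le` this identifies P_x(A_s) up to constants. -/
theorem IsHeatKernel.exists_le_transProb_ball (hp : Z.IsHeatKernel m N p)
    (hN : MeasurableSet N) (hN0 : m N = 0) (hV : VolumeGrowth m d₁ d₂)
    (hφ : IsScaleFunction φ d₃ d₄) (hest : HeatKernelEstimate m N p φ) :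
    ∃ c > 0, ∀ t : ℝ≥0, 0 < t → ∀ x ∉ N, ∀ r > 0, r ≤ scaleInv φ t →
      ENNReal.ofReal (c * (realVol m x r / realVol m x (scaleInv φ t))) ≤
        Z.transProb t x (Metric.ball x r) := by
  obtain ⟨c, hc, h⟩ := hp.exists_le_transProb hN hN0 hV hφ hest
  obtain ⟨C, hC, h'⟩ := hφ.exists_apply_scaleInv_le
  refine ⟨c * min 1 (1 / C), by positivity, fun t ht x hx r hr hle => ?_⟩
  refine le_trans (ENNReal.ofReal_le_ofReal ?_) (h t ht x hx r hr)
  have ht' : (0 : ℝ) < t := ht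
  have hψ0 := hφ.scaleInv_pos ht'
  have hψ := hV.realVol_pos x hψ0
  have hr' := hV.realVol_pos x hr
  have hφr := hφ.pos hr
  rw [mul_assoc, mul_assoc, ← mul_div_assoc]
  gcongr
  rw [div_le_iff₀ hψ, mul_right_comm]
  gcongr
  rw [min_mul_of_nonneg _ _ hψ.le]
  refine min_le_min (by rw [one_div_mul_cancel hψ.ne']) ?_
  rw [div_mul_eq_mul_div, div_le_div_iff₀ hC (by positivity), one_mul]
  calc realVol m x r * φ r ≤ realVol m x (scaleInv φ t) * (C * t) := by
        gcongr
        · exact hV.realVol_mono x hle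
        · exact (hφ.mono hr.le hle).trans (h' t ht')
    _ = _ := by ring

/-- The largest probability, over starting points off `N`, of being within distance `R` of the
starting point at time `t`. -/
def supTransProb {M Ω : Type*} [MetricSpace M] [MeasurableSpace Ω] (Z : HuntProcess M Ω)
    (N : Set M) (R : ℝ) (t : ℝ≥0) : ℝ≥0∞ := ⨆ z ∈ Nᶜ, Z.transProb t z (Metric.ball z R)

theorem transProb_le_supTransProb {M Ω : Type*} [MetricSpace M] [MeasurableSpace Ω]
    (Z : HuntProcess M Ω) {N : Set M} {z : M} (hz : z ∉ N) (R : ℝ) (t : ℝ≥0) :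
    Z.transProb t z (Metric.ball z R) ≤ Z.supTransProb N R t :=
  le_iSup₂_of_le z hz le_rfl

/-- The expected time spent in a ball of radius `R` is at most of order `φ(R)`. -/
theorem IsHeatKernel.exists_lintegral_supTransProb_le (hp : Z.IsHeatKernel m N p)
    (hN : MeasurableSet N) (hV : VolumeGrowth m d₁ d₂)
    (hφ : IsScaleFunction φ d₃ d₄) (hest : HeatKernelEstimate m N p φ) (hd : d₄ < d₁) :
    ∃ C > 0, ∀ R > 0, ∫⁻ t in Ioi (0 : ℝ), Z.supTransProb N R t.toNNReal ≤
        ENNReal.ofReal (C * φ R) := by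
  obtain ⟨C, hC, h⟩ := hp.exists_transProb_ball_le hN hV hφ hest
  obtain ⟨c, hc, hl⟩ := hV.exists_lower
  obtain ⟨C', hC', hu⟩ := hφ.exists_upper
  obtain ⟨A, hA, hA'⟩ := hφ.exists_le_apply_scaleInv
  have hd4 : 0 < d₄ := hφ.1.trans_le hφ.2.1
  -- The hypothesis d₄ < d₁ is used for a > 1: it makes t^(-a) integrable at infinity.
  set a := d₁ / d₄ with ha
  have ha1 : 1 < a := (one_lt_div hd4).2 hd
  set B := C / c * (A * C') ^ a with hB
  have hB0 : 0 < B := by positivity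
  refine ⟨1 + B / (a - 1), by have : 0 < a - 1 := by linarith
                              positivity, fun R hR => ?_⟩
  have hφR := hφ.pos hR
  rw [← Ioc_union_Ioi_eq_Ioi hφR.le]
  refine (lintegral_union_le _ _ _).trans ?_
  rw [add_mul, one_mul, ENNReal.ofReal_add hφR.le (by have : 0 < a - 1 := by linarith
                                                      positivity)]
  refine add_le_add ?_ ?_
  -- Up to time φ(R) probabilities are bounded by 1, which costs φ(R).
  · calc _ ≤ ∫⁻ t in Ioc 0 (φ R), 1 := lintegral_mono fun t =>
          iSup₂_le fun z _ => Z.transProb_le_one _ _ _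
      _ = _ := by simp
  · have hint : ∫ t in Ioi (φ R), B * φ R ^ a * t ^ (-a) = B / (a - 1) * φ R := by
      rw [integral_const_mul, integral_Ioi_rpow_of_lt (by linarith) hφR, Real.rpow_add hφR,
        Real.rpow_neg hφR.le, Real.rpow_one]
      have h1 : 0 < φ R ^ a := by positivity
      have h2 : -a + 1 ≠ 0 := by linarith
      have h3 : a - 1 ≠ 0 := by linarith
      field_simp
      ring
    rw [← hint, ofReal_integral_eq_lintegral_ofReal
      ((integrableOn_Ioi_rpow_of_lt (by linarith) hφR).const_mul _)
      ((ae_restrict_mem measurableSet_Ioi).mono fun t ht => by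
        have : 0 < t := hφR.trans ht
        simp only [Pi.zero_apply]
        positivity)]
    refine setLIntegral_mono' measurableSet_Ioi fun t ht => iSup₂_le fun z hz => ?_
    have hVR := hV.realVol_pos z hR
    have ht0 : 0 < t := hφR.trans ht
    have ht' : ((t.toNNReal : ℝ≥0) : ℝ) = t := Real.coe_toNNReal _ ht0.le
    refine (h t.toNNReal (by simpa using ht0) z hz z R).trans (ENNReal.ofReal_le_ofReal ?_)
    rw [ht']
    have hψR : R ≤ scaleInv φ t := hφ.le_scaleInv (le_of_lt ht)
    have hψ0 := hφ.scaleInv_pos ht0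
    have hψ := hV.realVol_pos z hψ0
    have h1 := hl z R _ hR hψR
    -- The upper growth of φ bounds φ⁻¹(t)/R from below by a multiple of (t/φ(R))^(1/d₄). Raised to
    -- the power d₁ in the lower volume growth, it makes the probability at most a multiple of
    -- (φ(R)/t)^a.
    have h2 : t / (A * C' * φ R) ≤ (scaleInv φ t / R) ^ d₄ := by
      rw [div_le_iff₀ (by positivity)]
      calc t ≤ A * φ (scaleInv φ t) := hA' t ht0
        _ ≤ A * (C' * (scaleInv φ t / R) ^ d₄ * φ R) := by gcongr; exact hu R _ hR hψR
        _ = _ := by ring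
    have h3 : (t / (A * C' * φ R)) ^ a ≤ (scaleInv φ t / R) ^ d₁ := by
      have : d₁ = d₄ * a := by rw [ha]; field_simp
      rw [this, Real.rpow_mul (by positivity)]
      exact Real.rpow_le_rpow (by positivity) h2 (by linarith)
    have h4 : c * (t / (A * C' * φ R)) ^ a * realVol m z R ≤ realVol m z (scaleInv φ t) :=
      le_trans (by gcongr) h1
    rw [div_le_iff₀ hψ]
    refine le_trans (le_of_eq ?_) (mul_le_mul_of_nonneg_left h4 (by positivity))
    rw [Real.div_rpow (by positivity) (by positivity), Real.mul_rpow (by positivity) (by positivity),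
      Real.rpow_neg ht0.le, hB]
    have h5 : 0 < φ R ^ a := by positivity
    have h6 : 0 < t ^ a := by positivity
    have h7 : 0 < (A * C') ^ a := by positivity
    field_simp

end Estimates

end HuntProcess

/-! ### Regular rate functions -/

/-- All that is used of the ratio condition: one window factor c > 1 on which g loses at most a
quarter. The value 3/4 is tuned to the radii below, where 3/2 · 4/3 = 2 and 3 · 4/3 = 4. -/
theorem RegularRatio.exists_le {g : ℝ → ℝ} (hg : RegularRatio g) (hg_pos : ∀ t, 0 < t → 0 < g t) :
    ∃ c > 1, ∃ T > 0, ∀ v ≥ T, ∀ u, v ≤ u → u ≤ c * v → 3 / 4 * g v ≤ g u := by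
  obtain ⟨ρ, h1, h2⟩ := hg
  obtain ⟨c, hc, hc1⟩ := ((h2.eventually (lt_mem_nhds (show (3 / 4 : ℝ) < 1 by norm_num))).and
    self_mem_nhdsWithin).exists
  obtain ⟨T, hT⟩ := (((h1 c hc1).eventually (lt_mem_nhds hc)).and
    (eventually_gt_atTop 0)).exists
  refine ⟨c, hc1, T, hT.2, fun v hv u hvu huc => ?_⟩
  have hv0 : 0 < v := hT.2.trans_le hv
  rw [← le_div_iff₀ (hg_pos v hv0)]
  refine hT.1.le.trans (csInf_le ⟨0, ?_⟩ ⟨u, v, ?_, ?_, hv, rfl⟩)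
  · rintro _ ⟨u, v, h1, -, hv, rfl⟩
    have hv0 : 0 < v := hT.2.trans_le hv
    have hu0 : 0 < u := hv0.trans_le (by rwa [le_div_iff₀ hv0, one_mul] at h1)
    exact (div_pos (hg_pos u hu0) (hg_pos v hv0)).le
  · rwa [le_div_iff₀ hv0, one_mul]
  · rwa [div_le_iff₀ hv0]

/-- On multiplicative windows `[v, c v]` the rate `φ⁻¹ g` is almost constant, and it is small
compared with `φ⁻¹`. -/
structure IsRegularRate (φ g : ℝ → ℝ) (c T K : ℝ) : Prop where
  one_lt : 1 < c
  T_pos : 0 < T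
  K_pos : 0 < K
  rate_pos : ∀ v, 0 < v → 0 < rateFun φ g v
  rate_le_mul : ∀ v ≥ T, ∀ u, v ≤ u → u ≤ c * v → rateFun φ g u ≤ K * rateFun φ g v
  le_rate_mul : ∀ v ≥ T, ∀ u, v ≤ u → u ≤ c * v → rateFun φ g v ≤ 4 / 3 * rateFun φ g u
  apply_rate_le : ∀ v ≥ T, φ (rateFun φ g v) ≤ (c - 1) * v
  rate_le : ∀ v ≥ T, rateFun φ g v ≤ scaleInv φ v

/-- The factor K comes from the doubling of φ⁻¹ with g decreasing, the factor 4/3 from φ⁻¹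
increasing with the bound on g. The last two fields use g → 0. The bound φ(r(v)) ≤ (c - 1) v keeps
the sojourn window [v, v + φ(r(v))] inside [v, cv]. -/
theorem IsScaleFunction.exists_isRegularRate {φ g : ℝ → ℝ} {d₃ d₄ : ℝ}
    (hφ : IsScaleFunction φ d₃ d₄) (hg_pos : ∀ t, 0 < t → 0 < g t)
    (hg_anti : AntitoneOn g (Ioi 0)) (hg_lim : Tendsto g atTop (𝓝 0)) (hg : RegularRatio g) :
    ∃ c T K, IsRegularRate φ g c T K := by
  obtain ⟨c, hc, T, hT, h⟩ := hg.exists_le hg_pos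
  obtain ⟨K, hK, hK'⟩ := hφ.exists_scaleInv_dilate_le (K := c) (by linarith)
  obtain ⟨δ, hδ, hδ'⟩ := hφ.exists_apply_mul_scaleInv_le (ε := c - 1) (by linarith)
  obtain ⟨T', hT'⟩ := eventually_atTop.1 (hg_lim.eventually
    (Iic_mem_nhds (show 0 < min δ 1 by positivity)))
  have hψ := fun v (hv : 0 < v) => hφ.scaleInv_pos hv
  refine ⟨c, max T T', K, hc, by positivity, hK, fun v hv => mul_pos (hψ v hv) (hg_pos v hv),
    fun v hv u hvu huc => ?_, fun v hv u hvu huc => ?_, fun v hv => ?_, fun v hv => ?_⟩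
  all_goals
    have hvT : T ≤ v := (le_max_left _ _).trans hv
    have hv0 : 0 < v := hT.trans_le hvT
    have hgv := hg_pos v hv0
    have hψv := hψ v hv0
  · unfold rateFun
    have hu0 : 0 < u := hv0.trans_le hvu
    rw [← mul_assoc]
    have := hg_pos u hu0
    exact mul_le_mul ((hφ.scaleInv_mono huc).trans (hK' v hv0)) (hg_anti hv0 hu0 hvu) this.le
      (by positivity)
  · unfold rateFun
    have := h v hvT u hvu huc
    have h2 := hφ.scaleInv_mono hvu
    nlinarith [mul_le_mul h2 this (by positivity) (hψv.le.trans h2)]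
  · exact hδ' v hv0 _ hgv ((hT' v ((le_max_right _ _).trans hv)).trans (min_le_left _ _))
  · exact mul_le_of_le_one_right hψv.le
      ((hT' v ((le_max_right _ _).trans hv)).trans (min_le_right _ _))

/-- The integrand of `tailIntegral` as a real number. -/
def realIntegrand {M : Type*} [MetricSpace M] [MeasurableSpace M] (m : Measure M)
    (φ g : ℝ → ℝ) (x : M) (s : ℝ) : ℝ :=
  realVol m x (rateFun φ g s) / (φ (rateFun φ g s) * realVol m x (scaleInv φ s))

theorem tailIntegral_eq {M : Type*} [MetricSpace M] [MeasurableSpace M] {m : Measure M}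
    [m.IsOpenPosMeasure] {φ g : ℝ → ℝ} {d₁ d₂ d₃ d₄ : ℝ} (hV : VolumeGrowth m d₁ d₂)
    (hφ : IsScaleFunction φ d₃ d₄) (hg_pos : ∀ t, 0 < t → 0 < g t) (x : M) {t : ℝ}
    (ht : 0 ≤ t) :
    tailIntegral m φ g x t = ∫⁻ s in Ioi t, ENNReal.ofReal (realIntegrand m φ g x s) := by
  refine setLIntegral_congr_fun measurableSet_Ioi fun s hs => ?_
  have hs0 : 0 < s := ht.trans_lt hs
  have hψ := hφ.scaleInv_pos hs0
  have h1 := hV.realVol_pos x hψ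
  have h2 := hφ.pos (mul_pos hψ (hg_pos s hs0))
  simp only [realIntegrand]
  rw [ENNReal.ofReal_div_of_pos (by unfold rateFun; positivity),
    ENNReal.ofReal_mul (by unfold rateFun; positivity), hV.ofReal_realVol, hV.ofReal_realVol]

theorem tailIntegral_anti {M : Type*} [MetricSpace M] [MeasurableSpace M] (m : Measure M)
    (φ g : ℝ → ℝ) (x : M) : Antitone (tailIntegral m φ g x) :=
  fun _ _ h => lintegral_mono_set (Ioi_subset_Ioi h)

/-! ### The upper bound -/

/-- Superadditivity of the lower integral. It spares any proof that u ↦ P_x(A ∩ {X_u ∈ D u}) is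
measurable. -/
theorem finsetSum_lintegral_le {α ι : Type*} [MeasurableSpace α] (μ : Measure α) (S : Finset ι)
    (f : ι → α → ℝ≥0∞) : ∑ i ∈ S, ∫⁻ a, f i a ∂μ ≤ ∫⁻ a, ∑ i ∈ S, f i a ∂μ := by
  classical
  induction S using Finset.induction_on with
  | empty => simp
  | insert i S hi ih =>
    simp only [Finset.sum_insert hi]
    exact (add_le_add le_rfl ih).trans (le_lintegral_add _ _)

namespace HuntProcess

section

variable {M Ω : Type*} [TopologicalSpace M] [MeasurableSpace M] [BorelSpace M] [MeasurableSpace Ω]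
  (Z : HuntProcess M Ω)

/-- If after visiting `B s` at a time `s ∈ S` the process is likely to spend time in the sets `D u`,
then the probability of such a visit is controlled by the expected time spent in the sets `D u`. -/
theorem mul_measure_biUnion_le (S : Finset ℝ≥0) {B : ℝ≥0 → Set M} (hB : ∀ s, MeasurableSet (B s))
    (D : ℝ → Set M) (I : Set ℝ) (w : ℝ → ℝ≥0∞) (κ : ℝ≥0∞) (x : OnePoint M)
    (hstep : ∀ s ∈ S, ∀ A, MeasurableSet[Z.ℱ s] A →
      A ⊆ {ω | Z.X s ω ∈ ((↑) : M → OnePoint M) '' B s} →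
      κ * Z.P x A ≤ ∫⁻ u in I, w u *
        Z.P x (A ∩ {ω | Z.X u.toNNReal ω ∈ ((↑) : M → OnePoint M) '' D u})) :
    κ * Z.P x (⋃ s ∈ S, {ω | Z.X s ω ∈ ((↑) : M → OnePoint M) '' B s}) ≤
      ∫⁻ u in I, w u * Z.transProb u.toNNReal x (D u) := by
  classical
  let H : ℝ≥0 → Set Ω := fun s => {ω | Z.X s ω ∈ ((↑) : M → OnePoint M) '' B s}
  -- A s: the first visit along S happens at s. These events are disjoint, adapted, and exhaust the
  -- event of a visit.
  let A : ℝ≥0 → Set Ω := fun s => H s \ ⋃ s' ∈ S.filter (· < s), H s'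
  have hH : ∀ s, MeasurableSet[Z.ℱ s] (H s) := fun s => Z.measurableSet_mem s (hB s)
  have hA : ∀ s, MeasurableSet[Z.ℱ s] (A s) := fun s =>
    (hH s).diff (Finset.measurableSet_biUnion _ fun s' hs' =>
      Z.ℱ.mono (Finset.mem_filter.1 hs').2.le _ (hH s'))
  have hdisj : (S : Set ℝ≥0).PairwiseDisjoint A := by
    have key : ∀ s ∈ S, ∀ s', s < s' → Disjoint (A s) (A s') := fun s hs s' hlt =>
      Set.disjoint_left.2 fun ω h1 h2 =>
        h2.2 (mem_biUnion (Finset.mem_filter.2 ⟨hs, hlt⟩) h1.1)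
    intro s hs s' hs' hne
    rcases lt_or_gt_of_ne hne with h | h
    · exact key s hs s' h
    · exact (key s' hs' s h).symm
  have hcover : ⋃ s ∈ S, H s ⊆ ⋃ s ∈ S, A s := by
    intro ω hω
    have hne : (S.filter fun s => ω ∈ H s).Nonempty := by
      obtain ⟨s, hs, h⟩ := mem_iUnion₂.1 hω
      exact ⟨s, Finset.mem_filter.2 ⟨hs, h⟩⟩
    have hmin := Finset.min'_mem _ hne
    set s := (S.filter fun s => ω ∈ H s).min' hne with hs
    rw [Finset.mem_filter] at hmin
    refine mem_biUnion hmin.1 ⟨hmin.2, fun h => ?_⟩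
    obtain ⟨s', hs', h'⟩ := mem_iUnion₂.1 h
    rw [Finset.mem_filter] at hs'
    exact absurd (Finset.min'_le _ s' (Finset.mem_filter.2 ⟨hs'.1, h'⟩)) (not_le.2 hs'.2)
  calc κ * Z.P x (⋃ s ∈ S, H s) ≤ κ * ∑ s ∈ S, Z.P x (A s) := by
        gcongr
        exact (measure_mono hcover).trans (measure_biUnion_finset_le _ _)
    _ = ∑ s ∈ S, κ * Z.P x (A s) := Finset.mul_sum _ _ _
    _ ≤ ∑ s ∈ S, ∫⁻ u in I, w u *
          Z.P x (A s ∩ {ω | Z.X u.toNNReal ω ∈ ((↑) : M → OnePoint M) '' D u}) :=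
        Finset.sum_le_sum fun s hs => hstep s hs _ (hA s) sdiff_subset
    _ ≤ _ := finsetSum_lintegral_le _ _ _
    _ ≤ _ := by
        refine lintegral_mono fun u => ?_
        rw [← Finset.mul_sum]
        gcongr
        -- The events A s are disjoint, so their traces on {X_u ∈ D u} sum to at most P_x(X_u ∈ D
        -- u). Measurability of A s suffices; D u is arbitrary.
        have h1 : ∀ s ∈ S, Z.P x (A s ∩ {ω | Z.X u.toNNReal ω ∈ ((↑) : M → OnePoint M) '' D u}) =
            (Z.P x).restrict {ω | Z.X u.toNNReal ω ∈ ((↑) : M → OnePoint M) '' D u} (A s) :=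
          fun s _ => (Measure.restrict_apply (Z.ℱ.le s _ (hA s))).symm
        rw [Finset.sum_congr rfl h1,
          ← measure_biUnion_finset hdisj fun s _ => Z.ℱ.le s _ (hA s)]
        refine (measure_mono (subset_univ _)).trans_eq ?_
        rw [Measure.restrict_apply_univ, transProb]

end

section

variable {M Ω : Type*} [MetricSpace M] [MeasurableSpace M] [BorelSpace M] [MeasurableSpace Ω]
  {m : Measure M} [m.IsOpenPosMeasure] {Z : HuntProcess M Ω} {N : Set M}
  {p : ℝ≥0 → M → M → ℝ≥0} {φ g : ℝ → ℝ} {d₁ d₂ d₃ d₄ c T K : ℝ}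

/-- A visit at a real time u persists, by right-continuity, at some slightly later dyadic time s ≤
cu. The radius 3/2 r(u) leaves room for the motion of the path, and 3/2 r(u) ≤ 3/2 · 4/3 r(s) = 2
r(s). -/
theorem bottomCrossing_subset (Z : HuntProcess M Ω) (hr : IsRegularRate φ g c T K) (x : M) {t : ℝ}
    (ht : T ≤ t) :
    {ω | ∃ u : ℝ≥0, t < u ∧ ∃ y : M, Z.X u ω = (y : OnePoint M) ∧ dist y x ≤ rateFun φ g u} ⊆
      ⋃ i : {q : ℕ × ℕ // t < (((q.1 + 1) / 2 ^ q.2 : ℝ≥0) : ℝ)},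
        {ω | Z.X ((i.1.1 + 1) / 2 ^ i.1.2) ω ∈ ((↑) : M → OnePoint M) ''
          Metric.ball x (2 * rateFun φ g ((i.1.1 + 1) / 2 ^ i.1.2 : ℝ≥0))} := by
  rintro ω ⟨u, htu, y, hy, hyx⟩
  have hu0 : (0 : ℝ) < u := hr.T_pos.trans_le (ht.trans htu.le)
  have hru := hr.rate_pos u hu0
  have h1 : ((↑) : M → OnePoint M) '' Metric.ball x (3 / 2 * rateFun φ g u) ∈ 𝓝 (Z.X u ω) := by
    rw [hy]
    refine (OnePoint.isOpenMap_coe _ Metric.isOpen_ball).mem_nhds ⟨y, ?_, rfl⟩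
    rw [Metric.mem_ball]
    linarith
  have h2 : Iio (u * c.toNNReal) ∈ 𝓝[>] u := by
    refine mem_nhdsWithin_of_mem_nhds (Iio_mem_nhds ?_)
    rw [← NNReal.coe_lt_coe, NNReal.coe_mul, Real.coe_toNNReal _ (by linarith [hr.one_lt])]
    nlinarith [hr.one_lt]
  obtain ⟨n, hn, hnc⟩ := ((Z.tendsto_dyadicAbove u ω).eventually h1 |>.and
    ((_root_.tendsto_dyadicAbove u).eventually h2)).exists
  have hlt := lt_dyadicAbove n u
  have hlt' : (u : ℝ) < dyadicAbove n u := hlt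
  refine mem_iUnion.2 ⟨⟨(⌊2 ^ n * u⌋₊, n), htu.trans hlt'⟩, ?_⟩
  change Z.X (dyadicAbove n u) ω ∈ ((↑) : M → OnePoint M) '' Metric.ball x
    (2 * rateFun φ g (dyadicAbove n u))
  refine image_mono (Metric.ball_subset_ball ?_) hn
  have h3 : (dyadicAbove n u : ℝ) ≤ c * u := by
    have h4 : (dyadicAbove n u : ℝ) < (u * c.toNNReal : ℝ≥0) := hnc
    rw [NNReal.coe_mul, Real.coe_toNNReal _ (by linarith [hr.one_lt])] at h4
    linarith
  linarith [hr.le_rate_mul u (ht.trans htu.le) _ hlt'.le h3]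

theorem IsHeatKernel.exists_bottomCrossing_le_lintegral (hp : Z.IsHeatKernel m N p)
    (hN : MeasurableSet N) (hN0 : m N = 0) (hV : VolumeGrowth m d₁ d₂)
    (hφ : IsScaleFunction φ d₃ d₄) (hest : HeatKernelEstimate m N p φ)
    (hr : IsRegularRate φ g c T K) :
    ∃ κ : ℝ, 0 < κ ∧ ∀ x ∉ N, ∀ t ≥ T,
      ENNReal.ofReal κ * Z.bottomCrossing (rateFun φ g) t x ≤
        ∫⁻ u in Ioi t, ENNReal.ofReal (1 / φ (rateFun φ g u)) *
          Z.transProb u.toNNReal x (Metric.ball x (4 * rateFun φ g u)) := by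
  obtain ⟨c₀, hc₀, hnear⟩ := hp.exists_le_transProb_ball_of_lt hN hN0 hV hφ hest
  obtain ⟨C, hC, hdil⟩ := hφ.exists_dilate_le hr.K_pos.le
  -- Probability c₀ of staying near, weight at least 1 / (C φ(R)), window of length φ(R) / 2.
  refine ⟨c₀ / (2 * C), by positivity, fun x hx t ht => ?_⟩
  have ht0 : 0 < t := hr.T_pos.trans_le ht
  have hbig := measure_mono (μ := Z.P x) (Z.bottomCrossing_subset hr x ht)
  refine (mul_le_mul_right hbig _).trans ?_
  -- Countably many dyadic times are exhausted by finite sets, along which a first visit exists.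
  rw [iUnion_eq_iUnion_finset, Directed.measure_iUnion, ENNReal.mul_iSup]
  swap
  · exact directed_of_isDirected_le fun S S' h => biUnion_subset_biUnion_left h
  refine iSup_le fun S => ?_
  classical
  let q : {q : ℕ × ℕ // t < (((q.1 + 1) / 2 ^ q.2 : ℝ≥0) : ℝ)} → ℝ≥0 :=
    fun i => (i.1.1 + 1) / 2 ^ i.1.2
  have himg : (⋃ i ∈ S, {ω | Z.X ((i.1.1 + 1) / 2 ^ i.1.2) ω ∈ ((↑) : M → OnePoint M) ''
          Metric.ball x (2 * rateFun φ g ((i.1.1 + 1) / 2 ^ i.1.2 : ℝ≥0))}) =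
      ⋃ s ∈ S.image q, {ω | Z.X s ω ∈ ((↑) : M → OnePoint M) ''
        Metric.ball x (2 * rateFun φ g s)} := by
    rw [Finset.set_biUnion_finset_image]
  rw [himg]
  refine Z.mul_measure_biUnion_le (S.image q) (fun s => measurableSet_ball)
    (fun u => Metric.ball x (4 * rateFun φ g u)) (Ioi t) _ _ x fun s hs A hA hAs => ?_
  obtain ⟨i, -, rfl⟩ := Finset.mem_image.1 hs
  have hst : t < q i := i.2
  generalize q i = s at hst hA hAs
  have hs0 : (0 : ℝ) < s := ht0.trans hst
  have hsT : T ≤ s := ht.trans hst.le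
  have hrs := hr.rate_pos s hs0
  have hφs := hφ.pos hrs
  set R := rateFun φ g s with hR
  have hlow : ∀ u ∈ Ioo ((s : ℝ) + φ R / 2) (s + φ R),
      ENNReal.ofReal (1 / (C * φ R)) * (ENNReal.ofReal c₀ * Z.P x A) ≤
        ENNReal.ofReal (1 / φ (rateFun φ g u)) *
        Z.P x (A ∩ {ω | Z.X u.toNNReal ω ∈ ((↑) : M → OnePoint M) ''
          Metric.ball x (4 * rateFun φ g u)}) := by
    intro u hu
    have hsu : (s : ℝ) ≤ u := by linarith [hu.1]
    have huc : u ≤ c * s := by linarith [hu.2, hr.apply_rate_le s hsT]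
    have hru := hr.rate_pos u (hs0.trans_le hsu)
    gcongr
    · exact hφ.pos hru
    · exact (hφ.mono hru.le (hr.rate_le_mul s hsT u hsu huc)).trans (hdil _ hrs)
    · obtain ⟨v, rfl⟩ : ∃ v : ℝ≥0, u = s + v := 
        ⟨(u - s).toNNReal, by rw [Real.coe_toNNReal _ (by linarith)]; ring⟩
      have huv : ((s : ℝ) + v).toNNReal = s + v := by
        rw [← NNReal.coe_add, Real.toNNReal_coe]
      rw [huv, Z.measure_inter_mem s v hA measurableSet_ball, ← setLIntegral_const]
      have hNae := hp.ae_notMem hN (t := s) hs0 hx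
      refine lintegral_mono_ae ?_
      filter_upwards [ae_restrict_of_ae hNae, ae_restrict_mem (Z.ℱ.le s _ hA)] with ω hω1 hω2
      obtain ⟨z, hz, hzω⟩ := hAs hω2
      rw [← hzω] at hω1 ⊢
      have hzN : z ∉ N := fun h => hω1 ⟨z, h, rfl⟩
      -- From z ∈ B(x, 2R), staying within R of z means being within 3R ≤ 3 · 4/3 r(u) = 4 r(u) of
      -- x.
      refine (hnear v z hzN R hrs (by linarith [hu.1]) (by linarith [hu.2])).trans
        (Z.transProb_mono _ _ (Metric.ball_subset_ball' ?_))
      have := hr.le_rate_mul s hsT _ hsu huc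
      have hz' : dist z x < 2 * R := hz
      linarith
  calc ENNReal.ofReal (c₀ / (2 * C)) * Z.P x A
      = ∫⁻ u in Ioo ((s : ℝ) + φ R / 2) (s + φ R),
          ENNReal.ofReal (1 / (C * φ R)) * (ENNReal.ofReal c₀ * Z.P x A) := by
        rw [setLIntegral_const, Real.volume_Ioo,
          show (s : ℝ) + φ R - (s + φ R / 2) = φ R / 2 by ring, mul_right_comm, ← mul_assoc,
          ← ENNReal.ofReal_mul (by positivity), ← ENNReal.ofReal_mul (by positivity)]
        congr 2
        field_simp
    _ ≤ ∫⁻ u in Ioo ((s : ℝ) + φ R / 2) (s + φ R), ENNReal.ofReal (1 / φ (rateFun φ g u)) *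
        Z.P x (A ∩ {ω | Z.X u.toNNReal ω ∈ ((↑) : M → OnePoint M) ''
          Metric.ball x (4 * rateFun φ g u)}) := setLIntegral_mono' measurableSet_Ioo hlow
    _ ≤ _ := lintegral_mono_set fun u hu => by
        have := hu.1
        simp only [mem_Ioi]
        linarith

theorem IsHeatKernel.exists_bottomCrossing_le (hp : Z.IsHeatKernel m N p)
    (hN : MeasurableSet N) (hN0 : m N = 0) (hV : VolumeGrowth m d₁ d₂)
    (hφ : IsScaleFunction φ d₃ d₄) (hest : HeatKernelEstimate m N p φ)
    (hr : IsRegularRate φ g c T K) (hg_pos : ∀ t, 0 < t → 0 < g t) :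
    ∃ C : ℝ≥0, 0 < C ∧ ∀ x ∉ N, ∀ t ≥ T,
      Z.bottomCrossing (rateFun φ g) t x ≤ C * tailIntegral m φ g x t := by
  obtain ⟨κ, hκ, h⟩ := hp.exists_bottomCrossing_le_lintegral hN hN0 hV hφ hest hr
  obtain ⟨C, hC, hup⟩ := hp.exists_transProb_ball_le hN hV hφ hest
  obtain ⟨C', hC', hdil⟩ := hV.exists_dilate_le (K := 4) (by norm_num)
  refine ⟨(C * C' / κ).toNNReal, by simp only [Real.toNNReal_pos]; positivity, fun x hx t ht => ?_⟩
  have ht0 : 0 < t := hr.T_pos.trans_le ht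
  rw [← ENNReal.ofReal, ENNReal.ofReal_div_of_pos hκ, ENNReal.mul_comm_div, ← mul_div_assoc,
    ENNReal.le_div_iff_mul_le (Or.inl (by simpa using hκ)) (Or.inl ENNReal.ofReal_ne_top), mul_comm,
    tailIntegral_eq hV hφ hg_pos x ht0.le, ← lintegral_const_mul' _ _ ENNReal.ofReal_ne_top]
  refine (h x hx t ht).trans (setLIntegral_mono' measurableSet_Ioi fun u hu => ?_)
  have hu0 : 0 < u := ht0.trans hu
  have hru := hr.rate_pos u hu0
  have hφr := hφ.pos hru
  have hψ := hV.realVol_pos x (hφ.scaleInv_pos hu0)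
  have hu' : ((u.toNNReal : ℝ≥0) : ℝ) = u := Real.coe_toNNReal _ hu0.le
  have h1 := hup u.toNNReal (by simpa using hu0) x hx x (4 * rateFun φ g u)
  rw [hu'] at h1
  refine (mul_le_mul_right h1 _).trans ?_
  rw [← ENNReal.ofReal_mul (by positivity), ← ENNReal.ofReal_mul (by positivity)]
  refine ENNReal.ofReal_le_ofReal ?_
  rw [realIntegrand]
  calc _ ≤ 1 / φ (rateFun φ g u) * (C * (C' * realVol m x (rateFun φ g u)) /
        realVol m x (scaleInv φ u)) := by gcongr; exact hdil x _ hru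
    _ = _ := by field_simp

end

end HuntProcess

/-! ### The lower bound -/

theorem setLIntegral_Ioi_comp_sub (f : ℝ → ℝ≥0∞) (s : ℝ) :
    ∫⁻ u in Ioi s, f (u - s) = ∫⁻ v in Ioi (0 : ℝ), f v := by
  rw [← lintegral_indicator measurableSet_Ioi, ← lintegral_indicator measurableSet_Ioi,
    ← lintegral_sub_right_eq_self ((Ioi 0).indicator f) s]
  refine lintegral_congr fun u => ?_
  simp only [indicator, mem_Ioi, sub_pos]

namespace HuntProcess

variable {M Ω : Type*} [MetricSpace M] [MeasurableSpace M] [BorelSpace M] [MeasurableSpace Ω]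
  {m : Measure M} [m.IsOpenPosMeasure] {Z : HuntProcess M Ω} {N : Set M}
  {p : ℝ≥0 → M → M → ℝ≥0} {φ g : ℝ → ℝ} {d₁ d₂ d₃ d₄ c T K : ℝ}

/-- The Markov property at time s. Since X_s avoids `N` almost surely, a bound from starting points
off `N` is enough. -/
theorem IsHeatKernel.measure_inter_mem_le (hp : Z.IsHeatKernel m N p) (hN : MeasurableSet N)
    {s v : ℝ≥0} (hs : 0 < s) {x : M} (hx : x ∉ N) {A : Set Ω} (hA : MeasurableSet[Z.ℱ s] A)
    {B D : Set M} (hAB : A ⊆ {ω | Z.X s ω ∈ ((↑) : M → OnePoint M) '' B})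
    (hD : MeasurableSet D) {b : ℝ≥0∞} (hb : ∀ z ∈ B, z ∉ N → Z.transProb v z D ≤ b) :
    Z.P x (A ∩ {ω | Z.X (s + v) ω ∈ ((↑) : M → OnePoint M) '' D}) ≤ b * Z.P x A := by
  rw [Z.measure_inter_mem s v hA hD, ← setLIntegral_const]
  refine lintegral_mono_ae ?_
  filter_upwards [ae_restrict_of_ae (hp.ae_notMem hN hs hx), ae_restrict_mem (Z.ℱ.le s _ hA)]
    with ω hω1 hω2
  obtain ⟨z, hz, hzω⟩ := hAB hω2
  rw [← hzω] at hω1 ⊢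
  exact hb z hz fun h => hω1 ⟨z, h, rfl⟩

/-- The event that the process is in the ball of radius `φ̃(s)` about `x` at time `s`. -/
def nearEvent (Z : HuntProcess M Ω) (r : ℝ → ℝ) (x : M) (s : ℝ) : Set Ω :=
  {ω | Z.X s.toNNReal ω ∈ ((↑) : M → OnePoint M) '' Metric.ball x (r s)}

theorem measurableSet_nearEvent (Z : HuntProcess M Ω) (r : ℝ → ℝ) (x : M) (s : ℝ) :
    MeasurableSet[Z.ℱ s.toNNReal] (Z.nearEvent r x s) :=
  Z.measurableSet_mem _ measurableSet_ball

/-- Short range. With R = r(s), being near x at both times forces X_u to lie within (K + 1) R of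
X_s. The expected time spent there is of order φ(R), which cancels the weight. -/
theorem IsHeatKernel.exists_lintegral_Ioc_le (hp : Z.IsHeatKernel m N p)
    (hN : MeasurableSet N) (hV : VolumeGrowth m d₁ d₂)
    (hφ : IsScaleFunction φ d₃ d₄) (hest : HeatKernelEstimate m N p φ) (hd : d₄ < d₁)
    (hr : IsRegularRate φ g c T K) :
    ∃ C : ℝ, 0 < C ∧ ∀ x ∉ N, ∀ s ≥ T,
      ∫⁻ u in Ioc s (c * s), ENNReal.ofReal (1 / φ (rateFun φ g u)) *
        Z.P x (Z.nearEvent (rateFun φ g) x s ∩ Z.nearEvent (rateFun φ g) x u) ≤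
        ENNReal.ofReal C * Z.P x (Z.nearEvent (rateFun φ g) x s) := by
  have hK := hr.K_pos
  obtain ⟨C₁, hC₁, hG⟩ := hp.exists_lintegral_supTransProb_le hN hV hφ hest hd
  obtain ⟨C₂, hC₂, h2⟩ := hφ.exists_dilate_le (K := 4 / 3) (by norm_num)
  obtain ⟨C₃, hC₃, h3⟩ := hφ.exists_dilate_le (K := K + 1) (by positivity)
  refine ⟨C₂ * C₁ * C₃, by positivity, fun x hx s hs => ?_⟩
  have hs0 : 0 < s := hr.T_pos.trans_le hs
  have hrs := hr.rate_pos s hs0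
  have hφs := hφ.pos hrs
  set R := rateFun φ g s with hR
  set a := Z.P x (Z.nearEvent (rateFun φ g) x s) with ha
  have hle : ∀ u ∈ Ioc s (c * s), ENNReal.ofReal (1 / φ (rateFun φ g u)) *
      Z.P x (Z.nearEvent (rateFun φ g) x s ∩ Z.nearEvent (rateFun φ g) x u) ≤
      ENNReal.ofReal (C₂ / φ R) * a * Z.supTransProb N ((K + 1) * R) (u - s).toNNReal := by
    intro u hu
    have hru := hr.rate_pos u (hs0.trans hu.1)
    rw [mul_assoc, mul_comm a]
    gcongr ?_ * ?_
    · refine ENNReal.ofReal_le_ofReal ?_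
      rw [div_le_div_iff₀ (hφ.pos hru) hφs, one_mul]
      exact (hφ.mono hrs.le (hr.le_rate_mul s hs u hu.1.le hu.2)).trans (h2 _ hru)
    · have huv : u.toNNReal = s.toNNReal + (u - s).toNNReal := by
        rw [← Real.toNNReal_add hs0.le (by linarith [hu.1]), add_sub_cancel]
      rw [nearEvent, nearEvent, huv]
      refine hp.measure_inter_mem_le hN (by simpa using hs0) hx
        (Z.measurableSet_nearEvent (rateFun φ g) x s) le_rfl measurableSet_ball fun z hz hzN => ?_
      refine (Z.transProb_mono _ _ (Metric.ball_subset_ball' ?_)).trans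
        (Z.transProb_le_supTransProb hzN _ _)
      have h4 := hr.rate_le_mul s hs u hu.1.le hu.2
      have hz' : dist z x < R := hz
      rw [dist_comm]
      linarith
  calc _ ≤ ∫⁻ u in Ioc s (c * s), ENNReal.ofReal (C₂ / φ R) * a *
          Z.supTransProb N ((K + 1) * R) (u - s).toNNReal := setLIntegral_mono' measurableSet_Ioc hle
    _ ≤ ∫⁻ u in Ioi s, ENNReal.ofReal (C₂ / φ R) * a *
          Z.supTransProb N ((K + 1) * R) (u - s).toNNReal := lintegral_mono_set Ioc_subset_Ioi_self
    _ = ENNReal.ofReal (C₂ / φ R) * a *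
          ∫⁻ v in Ioi (0 : ℝ), Z.supTransProb N ((K + 1) * R) v.toNNReal := by
        rw [lintegral_const_mul' _ _ (ENNReal.mul_ne_top ENNReal.ofReal_ne_top (measure_ne_top _ _)),
          setLIntegral_Ioi_comp_sub fun v => Z.supTransProb N ((K + 1) * R) v.toNNReal]
    _ ≤ ENNReal.ofReal (C₂ / φ R) * a * ENNReal.ofReal (C₁ * (C₃ * φ R)) := by
        gcongr
        exact (hG _ (by positivity)).trans (ENNReal.ofReal_le_ofReal (by gcongr; exact h3 R hrs))
    _ = _ := by
        rw [mul_right_comm, ← ENNReal.ofReal_mul (by positivity)]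
        congr 2
        field_simp

/-- Long range. The elapsed time u - s is comparable to u, and X_s is within r(s) ≤ φ⁻¹(u) of x.
Hence the transition bound from X_s is comparable to the one from x started at time 0, and
integrating in u gives I(s). -/
theorem IsHeatKernel.exists_lintegral_Ioi_mul_le (hp : Z.IsHeatKernel m N p)
    (hN : MeasurableSet N) (hV : VolumeGrowth m d₁ d₂)
    (hφ : IsScaleFunction φ d₃ d₄) (hest : HeatKernelEstimate m N p φ)
    (hr : IsRegularRate φ g c T K) (hg_pos : ∀ t, 0 < t → 0 < g t) :
    ∃ C : ℝ, 0 < C ∧ ∀ x ∉ N, ∀ s ≥ T,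
      ∫⁻ u in Ioi (c * s), ENNReal.ofReal (1 / φ (rateFun φ g u)) *
        Z.P x (Z.nearEvent (rateFun φ g) x s ∩ Z.nearEvent (rateFun φ g) x u) ≤
        ENNReal.ofReal C * tailIntegral m φ g x s * Z.P x (Z.nearEvent (rateFun φ g) x s) := by
  have hc1 := hr.one_lt
  have hc0 : 0 < c - 1 := by linarith
  obtain ⟨C₁, hC₁, h1⟩ := hp.exists_transProb_ball_le hN hV hφ hest
  -- If u = s + v > cs then s < v / (c - 1), so u ≤ c / (c - 1) · v.
  obtain ⟨C₂, hC₂, h2⟩ := hφ.exists_scaleInv_dilate_le (K := c / (c - 1)) (by positivity)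
  obtain ⟨C₃, hC₃, h3⟩ := hV.exists_dilate_le hC₂.le
  obtain ⟨C₄, hC₄, h4⟩ := hV.exists_realVol_le_of_dist hC₂.le
  refine ⟨C₁ * (C₃ * C₄), by positivity, fun x hx s hs => ?_⟩
  have hs0 : 0 < s := hr.T_pos.trans_le hs
  set a := Z.P x (Z.nearEvent (rateFun φ g) x s) with ha
  have hle : ∀ u ∈ Ioi (c * s), ENNReal.ofReal (1 / φ (rateFun φ g u)) *
      Z.P x (Z.nearEvent (rateFun φ g) x s ∩ Z.nearEvent (rateFun φ g) x u) ≤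
      ENNReal.ofReal (C₁ * (C₃ * C₄)) * a * ENNReal.ofReal (realIntegrand m φ g x u) := by
    intro u hu
    have hu : c * s < u := hu
    have hsu : s < u := by nlinarith
    have hu0 := hs0.trans hsu
    have hru := hr.rate_pos u hu0
    have hφu := hφ.pos hru
    obtain ⟨v, rfl⟩ : ∃ v, u = s + v := ⟨u - s, by ring⟩
    have hv0 : 0 < v := by linarith
    have hψv := hφ.scaleInv_pos hv0
    have hψu := hφ.scaleInv_pos hu0
    have hVu := hV.realVol_pos x hψu
    have huv : s + v ≤ c / (c - 1) * v := by
      rw [div_mul_eq_mul_div, le_div_iff₀ hc0]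
      nlinarith
    have hψuv : scaleInv φ (s + v) ≤ C₂ * scaleInv φ v := (hφ.scaleInv_mono huv).trans (h2 v hv0)
    calc _ ≤ ENNReal.ofReal (1 / φ (rateFun φ g (s + v))) *
          (ENNReal.ofReal (C₁ * realVol m x (rateFun φ g (s + v)) * (C₃ * C₄ /
            realVol m x (scaleInv φ (s + v)))) * a) := by
          gcongr
          rw [nearEvent, nearEvent, Real.toNNReal_add hs0.le hv0.le]
          refine hp.measure_inter_mem_le hN (by simpa using hs0) hx
            (Z.measurableSet_nearEvent (rateFun φ g) x s) le_rfl measurableSet_ball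
            fun z hz hzN => ?_
          have h5 := h1 v.toNNReal (by simpa using hv0) z hzN x (rateFun φ g (s + v))
          rw [Real.coe_toNNReal _ hv0.le] at h5
          refine h5.trans (ENNReal.ofReal_le_ofReal ?_)
          have hVz := hV.realVol_pos z hψv
          rw [mul_div_assoc, mul_assoc]
          have hVr := hV.realVol_pos x hru
          rw [div_eq_mul_inv]
          gcongr
          rw [inv_eq_one_div, div_le_div_iff₀ hVz hVu, one_mul]
          have hz' : dist z x < rateFun φ g s := hz
          have hd : dist x z ≤ C₂ * scaleInv φ v := by
            rw [dist_comm]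
            have h6 := hr.rate_le s hs
            have h7 := hφ.scaleInv_mono (show s ≤ s + v by linarith)
            linarith
          calc realVol m x (scaleInv φ (s + v)) ≤ realVol m x (C₂ * scaleInv φ v) :=
                hV.realVol_mono x hψuv
            _ ≤ C₃ * realVol m x (scaleInv φ v) := h3 x _ hψv
            _ ≤ C₃ * (C₄ * realVol m z (scaleInv φ v)) := by
                gcongr
                exact h4 x z _ hψv hd
            _ = _ := by ring
      _ = _ := by
          rw [← mul_assoc, ← ENNReal.ofReal_mul (by positivity), 
            mul_right_comm (ENNReal.ofReal (C₁ * (C₃ * C₄))),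
            ← ENNReal.ofReal_mul (by positivity), realIntegrand]
          congr 2
          field_simp
  calc _ ≤ ∫⁻ u in Ioi (c * s), ENNReal.ofReal (C₁ * (C₃ * C₄)) * a *
          ENNReal.ofReal (realIntegrand m φ g x u) := setLIntegral_mono' measurableSet_Ioi hle
    _ ≤ ∫⁻ u in Ioi s, ENNReal.ofReal (C₁ * (C₃ * C₄)) * a *
          ENNReal.ofReal (realIntegrand m φ g x u) :=
        lintegral_mono_set (Ioi_subset_Ioi (by nlinarith))
    _ = _ := by
        rw [lintegral_const_mul' _ _ (ENNReal.mul_ne_top ENNReal.ofReal_ne_top (measure_ne_top _ _)),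
          tailIntegral_eq hV hφ hg_pos x hs0.le, mul_right_comm]

theorem IsHeatKernel.exists_lintegral_inter_le (hp : Z.IsHeatKernel m N p)
    (hN : MeasurableSet N) (hV : VolumeGrowth m d₁ d₂)
    (hφ : IsScaleFunction φ d₃ d₄) (hest : HeatKernelEstimate m N p φ) (hd : d₄ < d₁)
    (hr : IsRegularRate φ g c T K) (hg_pos : ∀ t, 0 < t → 0 < g t) :
    ∃ C : ℝ, 0 < C ∧ ∀ x ∉ N, ∀ s ≥ T,
      ∫⁻ u in Ioi s, ENNReal.ofReal (1 / φ (rateFun φ g u)) *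
        Z.P x (Z.nearEvent (rateFun φ g) x s ∩ Z.nearEvent (rateFun φ g) x u) ≤
        ENNReal.ofReal C * (1 + tailIntegral m φ g x s) *
          Z.P x (Z.nearEvent (rateFun φ g) x s) := by
  obtain ⟨C₁, hC₁, h1⟩ := hp.exists_lintegral_Ioc_le hN hV hφ hest hd hr
  obtain ⟨C₂, hC₂, h2⟩ := hp.exists_lintegral_Ioi_mul_le hN hV hφ hest hr hg_pos
  refine ⟨C₁ + C₂, by positivity, fun x hx s hs => ?_⟩
  have hs0 : 0 < s := hr.T_pos.trans_le hs
  rw [← Ioc_union_Ioi_eq_Ioi (show s ≤ c * s by nlinarith [hr.one_lt])]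
  refine (lintegral_union_le _ _ _).trans
    ((add_le_add (h1 x hx s hs) (h2 x hx s hs)).trans ?_)
  rw [← add_mul]
  gcongr
  rw [mul_add, mul_one]
  gcongr <;> linarith

end HuntProcess

/-! ### The second moment method -/

theorem lintegral_sq_eq (ν : Measure ℝ) [SFinite ν] [NullSingletonClass ν] {f : ℝ → ℝ≥0∞}
    (hf : Measurable f) :
    (∫⁻ s, f s ∂ν) ^ 2 = 2 * ∫⁻ s, ∫⁻ u, (Ioi s).indicator (fun u => f s * f u) u ∂ν ∂ν := by
  have hm : Measurable fun z : ℝ × ℝ => (Ioi z.1).indicator (fun u => f z.1 * f u) z.2 := by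
    have : (fun z : ℝ × ℝ => (Ioi z.1).indicator (fun u => f z.1 * f u) z.2) =
        {z : ℝ × ℝ | z.1 < z.2}.indicator fun z => f z.1 * f z.2 := by
      ext z
      simp only [indicator, mem_Ioi, mem_ofPred_eq]
    rw [this]
    exact ((hf.comp measurable_fst).mul (hf.comp measurable_snd)).indicator
      (measurableSet_lt measurable_fst measurable_snd)
  have hsplit : ∀ s, f s * ∫⁻ u, f u ∂ν =
      ∫⁻ u, (Ioi s).indicator (fun u => f s * f u) u ∂ν +
      ∫⁻ u, (Ioi u).indicator (fun s => f u * f s) s ∂ν := by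
    intro s
    have hms : Measurable fun u => (Ioi s).indicator (fun u => f s * f u) u :=
      hm.comp measurable_prodMk_left
    rw [← lintegral_const_mul _ hf, ← lintegral_add_left hms]
    refine lintegral_congr_ae ?_
    -- The diagonal u = s is null, so the square splits into u > s and u < s, which have equal
    -- integrals.
    filter_upwards [show ∀ᵐ u ∂ν, u ≠ s from ae_iff.2 (by simp)] with u hu
    rcases lt_or_gt_of_ne hu with h | h
    · simp [indicator, h, h.not_gt, mul_comm]
    · simp [indicator, h, h.not_gt]
  rw [sq, ← lintegral_mul_const _ hf, lintegral_congr hsplit,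
    lintegral_add_left hm.lintegral_prod_right', two_mul]
  congr 1
  exact lintegral_lintegral_swap (hm.comp measurable_swap).aemeasurable

/-- Second moment bound: the weighted occupation time of the events `A s` controls the probability
that one of them happens. -/
theorem lintegral_mul_measure_le_measure_exists {Ω : Type*} [MeasurableSpace Ω] (μ : Measure Ω)
    [IsProbabilityMeasure μ] {A : ℝ → Set Ω} (hA : MeasurableSet {q : ℝ × Ω | q.2 ∈ A q.1})
    {w : ℝ → ℝ≥0∞} (hw : Measurable w) (hw_top : ∀ s, w s ≠ ⊤) {t : ℝ} {κ : ℝ≥0} (hκ : 0 < κ)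
    (hfin : ∫⁻ s in Ioi t, w s * μ (A s) ≠ ⊤)
    (h : ∀ s > t, ∫⁻ u in Ioi s, w u * μ (A s ∩ A u) ≤ κ * μ (A s)) :
    ∫⁻ s in Ioi t, w s * μ (A s) ≤ 2 * κ * μ {ω | ∃ s > t, ω ∈ A s} := by
  set ν := (volume : Measure ℝ).restrict (Ioi t) with hν
  have hAs : ∀ s, MeasurableSet (A s) := fun s => measurable_prodMk_left hA
  let F : ℝ → Ω → ℝ≥0∞ := fun s ω => w s * (A s).indicator 1 ω
  have hF : Measurable fun q : ℝ × Ω => F q.1 q.2 :=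
    (hw.comp measurable_fst).mul (measurable_one.indicator hA)
  let Λ : Ω → ℝ≥0∞ := fun ω => ∫⁻ s, F s ω ∂ν
  have hΛ : Measurable Λ := hF.lintegral_prod_left'
  set a := ∫⁻ s, w s * μ (A s) ∂ν with ha
  have hmean : ∫⁻ ω, Λ ω ∂μ = a := by
    have h1 : AEMeasurable (Function.uncurry fun ω s => F s ω) (μ.prod ν) :=
      (hF.comp measurable_swap).aemeasurable
    rw [lintegral_lintegral_swap h1]
    refine lintegral_congr fun s => ?_
    rw [lintegral_const_mul _ (measurable_one.indicator (hAs s)), lintegral_indicator_one (hAs s)]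
  let H : ℝ → ℝ → Ω → ℝ≥0∞ := fun s u ω => (Ioi s).indicator (fun u => F s ω * F u ω) u
  have hH : Measurable fun q : ℝ × ℝ × Ω => H q.1 q.2.1 q.2.2 := by
    have : (fun q : ℝ × ℝ × Ω => H q.1 q.2.1 q.2.2) =
        {q : ℝ × ℝ × Ω | q.1 < q.2.1}.indicator fun q => F q.1 q.2.2 * F q.2.1 q.2.2 := by
      ext q
      simp only [H, indicator, mem_Ioi, mem_ofPred_eq]
    rw [this]
    refine Measurable.indicator ?_ (measurableSet_lt measurable_fst
      (measurable_fst.comp measurable_snd))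
    exact (hF.comp (measurable_fst.prodMk (measurable_snd.comp measurable_snd))).mul
      (hF.comp measurable_snd)
  have hsq : ∫⁻ ω, Λ ω ^ 2 ∂μ ≤ 2 * (κ * a) := by
    calc ∫⁻ ω, Λ ω ^ 2 ∂μ = ∫⁻ ω, 2 * ∫⁻ s, ∫⁻ u, H s u ω ∂ν ∂ν ∂μ :=
          lintegral_congr fun ω => lintegral_sq_eq ν (hF.comp measurable_prodMk_right)
      _ = 2 * ∫⁻ ω, ∫⁻ s, ∫⁻ u, H s u ω ∂ν ∂ν ∂μ := lintegral_const_mul' _ _ (by simp)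
      _ = 2 * ∫⁻ s, ∫⁻ ω, ∫⁻ u, H s u ω ∂ν ∂μ ∂ν := by
          rw [lintegral_lintegral_swap]
          have h1 : Measurable fun q : (Ω × ℝ) × ℝ => H q.1.2 q.2 q.1.1 :=
            hH.comp ((measurable_snd.comp measurable_fst).prodMk
              (measurable_snd.prodMk (measurable_fst.comp measurable_fst)))
          exact h1.lintegral_prod_right'.aemeasurable
      _ = 2 * ∫⁻ s, ∫⁻ u, ∫⁻ ω, H s u ω ∂μ ∂ν ∂ν := by
          congr 1
          refine lintegral_congr fun s => lintegral_lintegral_swap ?_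
          exact (hH.comp (measurable_const.prodMk measurable_swap)).aemeasurable
      _ ≤ 2 * ∫⁻ s, κ * (w s * μ (A s)) ∂ν := by
          refine mul_le_mul_right (setLIntegral_mono' measurableSet_Ioi fun s hs => ?_) _
          calc ∫⁻ u, ∫⁻ ω, H s u ω ∂μ ∂ν
              = ∫⁻ u, (Ioi s).indicator (fun u => w s * (w u * μ (A s ∩ A u))) u ∂ν := by
                refine lintegral_congr fun u => ?_
                by_cases hu : s < u
                · simp only [H, indicator_of_mem (show u ∈ Ioi s from hu)]
                  have h1 : ∀ ω, F s ω * F u ω = w s * w u * (A s ∩ A u).indicator 1 ω := by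
                    intro ω
                    by_cases h1 : ω ∈ A s <;> by_cases h2 : ω ∈ A u <;> simp [F, h1, h2]
                  rw [lintegral_congr h1, lintegral_const_mul _
                    (measurable_one.indicator ((hAs s).inter (hAs u))),
                    lintegral_indicator_one ((hAs s).inter (hAs u)), mul_assoc]
                · simp [H, indicator, hu]
            -- The indicator already confines u to (s, ∞), which lies in (t, ∞), so dropping the
            -- restriction loses nothing.
            _ ≤ ∫⁻ u, (Ioi s).indicator (fun u => w s * (w u * μ (A s ∩ A u))) u :=
                lintegral_mono' Measure.restrict_le_self le_rfl
            _ = w s * ∫⁻ u in Ioi s, w u * μ (A s ∩ A u) := by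
                rw [lintegral_indicator measurableSet_Ioi, lintegral_const_mul' _ _ (hw_top s)]
            _ ≤ w s * (κ * μ (A s)) := by gcongr; exact h s hs
            _ = _ := by ring
      _ = 2 * (κ * a) := by rw [lintegral_const_mul' _ _ ENNReal.coe_ne_top]
  set E := {ω | ∃ s > t, ω ∈ A s} with hE
  have hΛE : ∀ ω, ω ∉ E → Λ ω = 0 := by
    intro ω hω
    refine (setLIntegral_congr_fun measurableSet_Ioi fun s hs => ?_).trans lintegral_zero
    have : ω ∉ A s := fun h => hω ⟨s, hs, h⟩
    simp [F, this]
  -- Replaces Cauchy–Schwarz: where Λ ≠ 0 this is (Λ - 2κ)² ≥ 0. The measurable set {Λ ≠ 0} is used,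
  -- since its superset E need not be measurable.
  have hpt : ∀ ω, 4 * κ * Λ ω ≤ Λ ω ^ 2 + 4 * κ ^ 2 * (Λ ⁻¹' {0}ᶜ).indicator 1 ω := by
    intro ω
    by_cases h0 : Λ ω = 0
    · simp [h0]
    · have hmem : ω ∈ Λ ⁻¹' {0}ᶜ := h0
      rw [indicator_of_mem hmem, Pi.one_apply, mul_one]
      rcases eq_or_ne (Λ ω) ⊤ with htop | htop
      · simp [htop]
      · lift Λ ω to ℝ≥0 using htop with l
        norm_cast
        rw [← NNReal.coe_le_coe]
        push_cast
        nlinarith [sq_nonneg ((l : ℝ) - 2 * κ)]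
  have hmeas : MeasurableSet (Λ ⁻¹' {0}ᶜ) := hΛ (measurableSet_singleton 0).compl
  have hfinal : 4 * κ * a ≤ 2 * (κ * a) + 4 * κ ^ 2 * μ E := by
    calc 4 * κ * a = ∫⁻ ω, 4 * κ * Λ ω ∂μ := by rw [lintegral_const_mul _ hΛ, hmean]
      _ ≤ ∫⁻ ω, (Λ ω ^ 2 + 4 * κ ^ 2 * (Λ ⁻¹' {0}ᶜ).indicator 1 ω) ∂μ := lintegral_mono hpt
      _ = ∫⁻ ω, Λ ω ^ 2 ∂μ + 4 * κ ^ 2 * μ (Λ ⁻¹' {0}ᶜ) := by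
          rw [lintegral_add_left (hΛ.pow_const 2),
            lintegral_const_mul _ (measurable_one.indicator hmeas), lintegral_indicator_one hmeas]
      _ ≤ _ := by
          gcongr
          intro ω hω
          by_contra hE
          exact hω (hΛE ω hE)
  have hb : μ E ≠ ⊤ := measure_ne_top _ _
  lift a to ℝ≥0 using hfin with a'
  lift μ E to ℝ≥0 using hb with b
  norm_cast at hfinal ⊢
  rw [← NNReal.coe_le_coe] at hfinal ⊢
  push_cast at hfinal ⊢
  have hκ' : (0 : ℝ) < κ := hκ
  have : (2 * κ : ℝ) * a' ≤ 2 * κ * (2 * κ * b) := by nlinarith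
  exact le_of_mul_le_mul_left this (by positivity)

namespace HuntProcess

variable {M Ω : Type*} [MetricSpace M] [LocallyCompactSpace M] [SecondCountableTopology M]
  [MeasurableSpace M] [BorelSpace M] [MeasurableSpace Ω]
  {m : Measure M} [m.IsOpenPosMeasure] {Z : HuntProcess M Ω} {N : Set M}
  {p : ℝ≥0 → M → M → ℝ≥0} {φ g : ℝ → ℝ} {d₁ d₂ d₃ d₄ c T K : ℝ}

/-- A ball of varying radius r(s) is the union, over rational k < r(s), of fixed balls, for which
joint measurability is known. -/
theorem measurableSet_uncurry_nearEvent (Z : HuntProcess M Ω) {r : ℝ → ℝ} (hr : Measurable r)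
    (x : M) : MeasurableSet {q : ℝ × Ω | q.2 ∈ Z.nearEvent r x q.1} := by
  have : {q : ℝ × Ω | q.2 ∈ Z.nearEvent r x q.1} = ⋃ k : ℚ, {q : ℝ × Ω | (k : ℝ) < r q.1} ∩
      (fun q : ℝ × Ω => (q.1.toNNReal, q.2)) ⁻¹'
        {z : ℝ≥0 × Ω | Z.X z.1 z.2 ∈ ((↑) : M → OnePoint M) '' Metric.ball x k} := by
    ext q
    simp only [nearEvent, mem_ofPred_eq, mem_iUnion, mem_inter_iff, mem_preimage]
    constructor
    · rintro ⟨y, hy, h⟩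
      obtain ⟨k, hk1, hk2⟩ := exists_rat_btwn (Metric.mem_ball.1 hy)
      exact ⟨k, hk2, y, hk1, h⟩
    · rintro ⟨k, hk, h⟩
      exact image_mono (Metric.ball_subset_ball hk.le) h
  rw [this]
  refine MeasurableSet.iUnion fun k => MeasurableSet.inter ?_ ?_
  · exact measurableSet_lt measurable_const (hr.comp measurable_fst)
  · exact (Z.measurableSet_uncurry Metric.isOpen_ball).preimage
      ((measurable_real_toNNReal.comp measurable_fst).prodMk measurable_snd)

/-- The second moment bound with weight 1/φ(r(s)) and κ = C (1 + I(t)). Finiteness of I(t) makes κ a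
real number and the first moment finite. -/
theorem IsHeatKernel.exists_le_bottomCrossing (hp : Z.IsHeatKernel m N p)
    (hN : MeasurableSet N) (hN0 : m N = 0) (hV : VolumeGrowth m d₁ d₂)
    (hφ : IsScaleFunction φ d₃ d₄) (hest : HeatKernelEstimate m N p φ) (hd : d₄ < d₁)
    (hr : IsRegularRate φ g c T K) (hg_pos : ∀ t, 0 < t → 0 < g t)
    (hg_anti : AntitoneOn g (Ioi 0)) :
    ∃ C : ℝ, 0 < C ∧ ∀ x ∉ N, ∀ t ≥ T, tailIntegral m φ g x t ≠ ⊤ →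
      tailIntegral m φ g x t ≤ ENNReal.ofReal C * (1 + tailIntegral m φ g x t) *
        Z.bottomCrossing (rateFun φ g) t x := by
  obtain ⟨C, hC, h2⟩ := hp.exists_lintegral_inter_le hN hV hφ hest hd hr hg_pos
  obtain ⟨c₁, hc₁, hlow⟩ := hp.exists_le_transProb_ball hN hN0 hV hφ hest
  obtain ⟨C₂, hC₂, hup⟩ := hp.exists_transProb_ball_le hN hV hφ hest
  refine ⟨2 * C / c₁, by positivity, fun x hx t ht hfin => ?_⟩
  have ht0 : 0 < t := hr.T_pos.trans_le ht
  -- g is controlled only on (0, ∞). Freezing the rate before time t gives a positive measurable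
  -- function on ℝ without changing it on (t, ∞).
  let r : ℝ → ℝ := fun s => rateFun φ g (max s t)
  have hrpos : ∀ s, 0 < r s := fun s => hr.rate_pos _ (ht0.trans_le (le_max_right _ _))
  have hrm : Measurable r := by
    have h1 : Antitone fun s => g (max s t) := fun a b hab =>
      hg_anti (ht0.trans_le (le_max_right _ _)) (ht0.trans_le (le_max_right _ _))
        (max_le_max_right t hab)
    exact (hφ.scaleInv_mono.measurable.comp (measurable_id.max measurable_const)).mul h1.measurable
  have hφm : Measurable fun s => φ (r s) := by
    have h1 : Monotone fun y => φ (max y 0) := fun a b hab =>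
      hφ.mono (le_max_right _ _) (max_le_max_right 0 hab)
    have h2 : (fun s => φ (r s)) = (fun y => φ (max y 0)) ∘ r := by
      ext s
      simp only [Function.comp_apply, max_eq_left (hrpos s).le]
    rw [h2]
    exact h1.measurable.comp hrm
  let w : ℝ → ℝ≥0∞ := fun s => ENNReal.ofReal (1 / φ (r s))
  have hr_eq : ∀ s, t < s → r s = rateFun φ g s := fun s hs => by simp only [r, max_eq_left hs.le]
  have hA_eq : ∀ s, t < s → Z.nearEvent r x s = Z.nearEvent (rateFun φ g) x s := fun s hs => by
    rw [nearEvent, nearEvent, hr_eq s hs]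
  set I := tailIntegral m φ g x t with hI
  have hI_eq : I = ∫⁻ s in Ioi t, ENNReal.ofReal (realIntegrand m φ g x s) :=
    tailIntegral_eq hV hφ hg_pos x ht0.le
  have hlower : ENNReal.ofReal c₁ * I ≤ ∫⁻ s in Ioi t, w s * Z.P x (Z.nearEvent r x s) := by
    rw [hI_eq, ← lintegral_const_mul' _ _ ENNReal.ofReal_ne_top]
    refine setLIntegral_mono' measurableSet_Ioi fun s hs => ?_
    have hs0 : 0 < s := ht0.trans hs
    have hφs := hφ.pos (hr.rate_pos s hs0)
    have hψ := hV.realVol_pos x (hφ.scaleInv_pos hs0)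
    have h3 := hlow s.toNNReal (by simpa using hs0) x hx (rateFun φ g s) (hr.rate_pos s hs0)
    rw [Real.coe_toNNReal _ hs0.le] at h3
    rw [hA_eq s hs]
    refine le_trans (le_of_eq ?_) (mul_le_mul_right (h3 (hr.rate_le s (ht.trans (le_of_lt hs)))) _)
    simp only [w, hr_eq s hs, realIntegrand]
    rw [← ENNReal.ofReal_mul (by positivity), ← ENNReal.ofReal_mul (by positivity)]
    congr 1
    field_simp
  have hupper : ∫⁻ s in Ioi t, w s * Z.P x (Z.nearEvent r x s) ≤ ENNReal.ofReal C₂ * I := by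
    rw [hI_eq, ← lintegral_const_mul' _ _ ENNReal.ofReal_ne_top]
    refine setLIntegral_mono' measurableSet_Ioi fun s hs => ?_
    have hs0 : 0 < s := ht0.trans hs
    have hφs := hφ.pos (hr.rate_pos s hs0)
    have hψ := hV.realVol_pos x (hφ.scaleInv_pos hs0)
    have h3 := hup s.toNNReal (by simpa using hs0) x hx x (rateFun φ g s)
    rw [Real.coe_toNNReal _ hs0.le] at h3
    rw [hA_eq s hs]
    refine le_trans (mul_le_mul_right h3 _) (le_of_eq ?_)
    simp only [w, hr_eq s hs, realIntegrand]
    rw [← ENNReal.ofReal_mul (by positivity), ← ENNReal.ofReal_mul (by positivity)]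
    congr 1
    field_simp
  have hκ : ENNReal.ofReal C * (1 + I) = (C.toNNReal * (1 + I.toNNReal) : ℝ≥0) := by
    rw [ENNReal.coe_mul, ENNReal.coe_add, ENNReal.coe_toNNReal hfin]
    rfl
  have key := lintegral_mul_measure_le_measure_exists (Z.P x)
    (Z.measurableSet_uncurry_nearEvent hrm x) (w := w) (measurable_const.div hφm).ennreal_ofReal
    (fun s => ENNReal.ofReal_ne_top) (t := t) (κ := C.toNNReal * (1 + I.toNNReal))
    (by have := Real.toNNReal_pos.2 hC; positivity)
    (ne_top_of_le_ne_top (ENNReal.mul_ne_top ENNReal.ofReal_ne_top hfin) hupper)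
    (fun s hs => by
      rw [← hκ]
      have h3 := h2 x hx s (ht.trans (le_of_lt hs))
      rw [hA_eq s hs]
      refine le_trans (le_of_eq ?_) (h3.trans ?_)
      · refine setLIntegral_congr_fun measurableSet_Ioi fun u hu => ?_
        have hu' : t < u := lt_trans hs hu
        simp only [w, hr_eq u hu', hA_eq u hu']
      · gcongr
        exact tailIntegral_anti m φ g x (le_of_lt hs))
  rw [← hκ] at key
  have hsub : {ω | ∃ s > t, ω ∈ Z.nearEvent r x s} ⊆
      {ω | ∃ u : ℝ≥0, t < u ∧ ∃ y : M, Z.X u ω = (y : OnePoint M) ∧ dist y x ≤ rateFun φ g u} := by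
    rintro ω ⟨s, hs, h⟩
    rw [hA_eq s hs] at h
    obtain ⟨y, hy, hyω⟩ := h
    have hs0 : 0 < s := ht0.trans hs
    refine ⟨s.toNNReal, by rwa [Real.coe_toNNReal _ hs0.le], y, hyω.symm, ?_⟩
    rw [Real.coe_toNNReal _ hs0.le]
    exact (Metric.mem_ball.1 hy).le
  have hall := hlower.trans (key.trans (mul_le_mul_right (measure_mono hsub) _))
  have hc₁' : ENNReal.ofReal c₁ ≠ 0 := by simpa using hc₁
  rw [mul_comm, ← ENNReal.le_div_iff_mul_le (Or.inl hc₁') (Or.inl ENNReal.ofReal_ne_top)] at hall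
  refine hall.trans_eq ?_
  rw [ENNReal.ofReal_div_of_pos hc₁, ENNReal.ofReal_mul (by norm_num), bottomCrossing,
    ENNReal.ofReal_ofNat]
  simp only [div_eq_mul_inv]
  ring

end HuntProcess

/-! ### Discounted hitting potentials -/

/-- The discount factor `e^{-t}`. -/
def disc (t : ℝ≥0) : ℝ≥0∞ := ENNReal.ofReal (Real.exp (-t))

theorem disc_zero : disc 0 = 1 := by simp [disc]

theorem disc_add (s t : ℝ≥0) : disc (s + t) = disc s * disc t := by
  rw [disc, disc, disc, ← ENNReal.ofReal_mul (Real.exp_nonneg _), ← Real.exp_add]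
  congr 2
  push_cast
  ring

theorem disc_le_one (t : ℝ≥0) : disc t ≤ 1 := by
  rw [disc, ENNReal.ofReal_le_one]
  exact Real.exp_le_one_iff.2 (by simp)

theorem disc_ne_top (t : ℝ≥0) : disc t ≠ ⊤ := ENNReal.ofReal_ne_top

theorem continuous_disc : Continuous disc :=
  ENNReal.continuous_ofReal.comp (Real.continuous_exp.comp NNReal.continuous_coe.neg)

namespace HuntProcess

variable {M Ω : Type*} [TopologicalSpace M] [MeasurableSpace Ω] (Z : HuntProcess M Ω)

/-- The discounted time of the first visit to `G` along the times `s + jδ`, `j ≤ k`. -/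
def stepHit (G : Set (OnePoint M)) (δ : ℝ≥0) (k : ℕ) (s : ℝ≥0) (ω : Ω) : ℝ≥0∞ :=
  ⨆ j ≤ k, disc (j * δ) * G.indicator 1 (Z.X (s + j * δ) ω)

theorem stepHit_zero (G : Set (OnePoint M)) (δ s : ℝ≥0) (ω : Ω) :
    Z.stepHit G δ 0 s ω = G.indicator 1 (Z.X s ω) := by
  simp [stepHit, disc_zero]

theorem disc_mul_indicator_le (G : Set (OnePoint M)) (t : ℝ≥0) (y : OnePoint M) :
    disc t * G.indicator 1 y ≤ 1 := by
  by_cases hy : y ∈ G <;> simp [hy, disc_le_one]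

/-- One-step recursion: either G is visited now, with value 1, or everything is delayed by δ. It
mirrors the definition of `stepPot`. -/
theorem stepHit_succ (G : Set (OnePoint M)) (δ : ℝ≥0) (k : ℕ) (s : ℝ≥0) (ω : Ω) :
    Z.stepHit G δ (k + 1) s ω =
      max (G.indicator 1 (Z.X s ω)) (disc δ * Z.stepHit G δ k (s + δ) ω) := by
  have hstep : ∀ j : ℕ, disc ((j + 1 : ℕ) * δ) * G.indicator 1 (Z.X (s + (j + 1 : ℕ) * δ) ω) =
      disc δ * (disc (j * δ) * G.indicator 1 (Z.X (s + δ + j * δ) ω)) := by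
    intro j
    rw [← mul_assoc, ← disc_add]
    push_cast
    congr 3
    · ring
    · rw [add_mul, one_mul, add_assoc, add_comm δ]
  refine le_antisymm (iSup₂_le fun j hj => ?_) (max_le ?_ ?_)
  · rcases j with - | j
    · refine le_max_of_le_left ?_
      simp [disc_zero]
    · refine le_max_of_le_right ?_
      rw [hstep]
      gcongr
      exact le_iSup₂_of_le j (by omega) le_rfl
  · refine le_iSup₂_of_le 0 (Nat.zero_le _) ?_
    simp [disc_zero]
  · simp only [stepHit, ENNReal.mul_iSup]
    refine iSup₂_le fun j hj => ?_
    rw [← hstep]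
    exact le_iSup₂_of_le (j + 1) (by omega) le_rfl

theorem measurable_indicator_X {G : Set (OnePoint M)} (hG : MeasurableSet G) (t : ℝ≥0) :
    Measurable fun ω => G.indicator (1 : OnePoint M → ℝ≥0∞) (Z.X t ω) :=
  (measurable_one.indicator hG).comp (Z.measurable_X t)

theorem measurable_stepHit {G : Set (OnePoint M)} (hG : MeasurableSet G) (δ : ℝ≥0) (k : ℕ)
    (s : ℝ≥0) : Measurable (Z.stepHit G δ k s) :=
  Measurable.iSup fun _ => Measurable.iSup fun _ => (Z.measurable_indicator_X hG _).const_mul _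

/-- The expectation of `stepHit` as a function of the starting point, defined by iteration. -/
def stepPot (G : Set (OnePoint M)) (δ : ℝ≥0) : ℕ → OnePoint M → ℝ≥0∞
  | 0 => G.indicator 1
  | k + 1 => G.indicator 1 + Gᶜ.indicator (fun y => disc δ * Z.sg δ (stepPot G δ k) y)

theorem measurable_stepPot {G : Set (OnePoint M)} (hG : MeasurableSet G) (δ : ℝ≥0) (k : ℕ) :
    Measurable (Z.stepPot G δ k) := by
  induction k with
  | zero => exact measurable_one.indicator hG
  | succ k ih =>
    have h1 : Measurable (G.indicator (1 : OnePoint M → ℝ≥0∞)) := measurable_one.indicator hG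
    exact h1.add (((Z.measurable_sg δ ih).const_mul _).indicator hG.compl)

/-- Split according to X_s ∈ G: there both integrands equal 1, elsewhere both are the discounted
next step. The general s and A ∈ ℱ_s are what the induction needs, as it passes to s + δ and A \
{X_s ∈ G}. -/
theorem setLIntegral_stepPot {G : Set (OnePoint M)} (hG : MeasurableSet G) (δ : ℝ≥0) (k : ℕ)
    (s : ℝ≥0) {A : Set Ω} (hA : MeasurableSet[Z.ℱ s] A) (x : OnePoint M) :
    ∫⁻ ω in A, Z.stepPot G δ k (Z.X s ω) ∂Z.P x = ∫⁻ ω in A, Z.stepHit G δ k s ω ∂Z.P x := by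
  induction k generalizing s A with
  | zero => simp only [stepHit_zero, stepPot]
  | succ k ih =>
    have hXG : MeasurableSet[Z.ℱ s] {ω | Z.X s ω ∈ G} := Z.adapted s hG
    have hXG' := Z.ℱ.le s _ hXG
    rw [← lintegral_inter_add_sdiff _ A hXG', ← lintegral_inter_add_sdiff _ A hXG']
    have hA1 := Z.ℱ.le s _ hA
    congr 1
    · refine setLIntegral_congr_fun (hA1.inter hXG') fun ω hω => ?_
      have hω2 : Z.X s ω ∈ G := hω.2
      simp only [stepPot, stepHit_succ, Pi.add_apply, indicator_of_mem hω2, Pi.one_apply]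
      rw [indicator_of_notMem (by simpa using hω2), add_zero, max_eq_left]
      refine mul_le_one' (disc_le_one _) (iSup₂_le fun j _ => disc_mul_indicator_le _ _ _)
    · have hAd : MeasurableSet[Z.ℱ s] (A \ {ω | Z.X s ω ∈ G}) := hA.diff hXG
      have h1 : ∫⁻ ω in A \ {ω | Z.X s ω ∈ G}, Z.stepPot G δ (k + 1) (Z.X s ω) ∂Z.P x =
          ∫⁻ ω in A \ {ω | Z.X s ω ∈ G}, disc δ * Z.sg δ (Z.stepPot G δ k) (Z.X s ω) ∂Z.P x := by
        refine setLIntegral_congr_fun (hA1.diff hXG') fun ω hω => ?_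
        have hω2 : Z.X s ω ∉ G := hω.2
        simp only [stepPot, Pi.add_apply, indicator_of_notMem hω2, zero_add]
        rw [indicator_of_mem (by simpa using hω2)]
      have h2 : ∫⁻ ω in A \ {ω | Z.X s ω ∈ G}, Z.stepHit G δ (k + 1) s ω ∂Z.P x =
          ∫⁻ ω in A \ {ω | Z.X s ω ∈ G}, disc δ * Z.stepHit G δ k (s + δ) ω ∂Z.P x := by
        refine setLIntegral_congr_fun (hA1.diff hXG') fun ω hω => ?_
        have hω2 : Z.X s ω ∉ G := hω.2
        simp only [stepHit_succ, indicator_of_notMem hω2]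
        exact max_eq_right zero_le
      rw [h1, h2, lintegral_const_mul' _ _ (disc_ne_top _), lintegral_const_mul' _ _ (disc_ne_top _),
        ← Z.markov s δ hAd (Z.measurable_stepPot hG δ k),
        ih (s + δ) (Z.ℱ.mono (le_add_of_nonneg_right zero_le) _ hAd)]

/-- `e^{-σ}`, where `σ` is the first dyadic time after which the process, started afresh at time
`s`, visits `G`. -/
def discHit (G : Set (OnePoint M)) (s : ℝ≥0) (ω : Ω) : ℝ≥0∞ :=
  ⨆ n : ℕ, ⨆ j : ℕ, disc (j / 2 ^ n) * G.indicator 1 (Z.X (s + j / 2 ^ n) ω)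

theorem discHit_eq_iSup (G : Set (OnePoint M)) (s : ℝ≥0) (ω : Ω) :
    Z.discHit G s ω = ⨆ n : ℕ, Z.stepHit G (1 / 2 ^ n) (n * 2 ^ n) s ω := by
  refine le_antisymm (iSup₂_le fun n j => ?_) (iSup_le fun n => iSup₂_le fun j _ => ?_)
  -- The level max n j has mesh fine enough to contain j / 2^n and horizon max n j ≥ j / 2^n.
  · refine le_iSup_of_le (max n j) (le_iSup₂_of_le (j * 2 ^ (max n j - n)) ?_ (le_of_eq ?_))
    · exact Nat.mul_le_mul (le_max_right _ _) (Nat.pow_le_pow_right (by norm_num) (Nat.sub_le _ _))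
    · have h : ((j * 2 ^ (max n j - n) : ℕ) : ℝ≥0) * (1 / 2 ^ (max n j)) = j / 2 ^ n := by
        obtain ⟨k, hk⟩ := Nat.exists_eq_add_of_le (le_max_left n j)
        rw [hk, Nat.add_sub_cancel_left]
        push_cast
        rw [pow_add]
        field_simp
      rw [h]
  · refine le_iSup₂_of_le n j (le_of_eq ?_)
    rw [mul_one_div]

theorem monotone_stepHit_dyadic (G : Set (OnePoint M)) (s : ℝ≥0) (ω : Ω) :
    Monotone fun n : ℕ => Z.stepHit G (1 / 2 ^ n) (n * 2 ^ n) s ω := by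
  refine monotone_nat_of_le_succ fun n => iSup₂_le fun j hj => ?_
  refine le_iSup₂_of_le (2 * j) ?_ (le_of_eq ?_)
  · rw [pow_succ]
    nlinarith [Nat.zero_le (2 ^ n)]
  · have h : ((2 * j : ℕ) : ℝ≥0) * (1 / 2 ^ (n + 1)) = j * (1 / 2 ^ n) := by
      push_cast
      rw [pow_succ]
      field_simp
    rw [h]

theorem measurable_discHit {G : Set (OnePoint M)} (hG : MeasurableSet G) (s : ℝ≥0) :
    Measurable (Z.discHit G s) :=
  Measurable.iSup fun _ => Measurable.iSup fun _ => (Z.measurable_indicator_X hG _).const_mul _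

/-- `E_y[e^{-σ_G}]`. -/
def hitPot (G : Set (OnePoint M)) (y : OnePoint M) : ℝ≥0∞ := ∫⁻ ω, Z.discHit G 0 ω ∂Z.P y

theorem hitPot_eq_iSup {G : Set (OnePoint M)} (hG : MeasurableSet G) (y : OnePoint M) :
    Z.hitPot G y = ⨆ n : ℕ, Z.stepPot G (1 / 2 ^ n) (n * 2 ^ n) y := by
  rw [hitPot, lintegral_congr (Z.discHit_eq_iSup G 0), lintegral_iSup
    (fun n => Z.measurable_stepHit hG _ _ _) fun n k h ω => Z.monotone_stepHit_dyadic G 0 ω h]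
  congr 1
  ext n
  have h := Z.setLIntegral_stepPot hG (1 / 2 ^ n) (n * 2 ^ n) 0 MeasurableSet.univ y
  rw [setLIntegral_univ, setLIntegral_univ] at h
  rw [← h]
  exact Z.sg_zero _ y

theorem measurable_hitPot {G : Set (OnePoint M)} (hG : MeasurableSet G) :
    Measurable (Z.hitPot G) := by
  rw [funext (Z.hitPot_eq_iSup hG)]
  exact Measurable.iSup fun n => Z.measurable_stepPot hG _ _

theorem monotone_stepPot_dyadic {G : Set (OnePoint M)} (hG : MeasurableSet G) :
    Monotone fun n : ℕ => Z.stepPot G (1 / 2 ^ n) (n * 2 ^ n) := by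
  intro n k h y
  have h1 := fun n : ℕ => Z.setLIntegral_stepPot hG (1 / 2 ^ n) (n * 2 ^ n) 0 MeasurableSet.univ y
  have h2 := fun n : ℕ => (Z.sg_zero (Z.stepPot G (1 / 2 ^ n) (n * 2 ^ n)) y).symm
  simp only [setLIntegral_univ] at h1
  change Z.stepPot G (1 / 2 ^ n) (n * 2 ^ n) y ≤ Z.stepPot G (1 / 2 ^ k) (k * 2 ^ k) y
  rw [h2 n, h2 k, sg, sg, h1, h1]
  exact lintegral_mono fun ω => Z.monotone_stepHit_dyadic G 0 ω h

/-- The Markov property for hitting potentials. -/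
theorem lintegral_hitPot {G : Set (OnePoint M)} (hG : MeasurableSet G) (s : ℝ≥0)
    (x : OnePoint M) : Z.sg s (Z.hitPot G) x = ∫⁻ ω, Z.discHit G s ω ∂Z.P x := by
  rw [sg, lintegral_congr (Z.discHit_eq_iSup G s),
    lintegral_congr fun ω => Z.hitPot_eq_iSup hG (Z.X s ω), lintegral_iSup
    (fun n => Z.measurable_stepHit hG _ _ _) fun n k h ω => Z.monotone_stepHit_dyadic G s ω h,
    lintegral_iSup (fun n => show Measurable fun ω => Z.stepPot G (1 / 2 ^ n) (n * 2 ^ n) (Z.X s ω)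
      from (Z.measurable_stepPot hG _ _).comp (Z.measurable_X s))
    fun n k h ω => Z.monotone_stepPot_dyadic hG h _]
  congr 1
  ext n
  simpa using Z.setLIntegral_stepPot hG (1 / 2 ^ n) (n * 2 ^ n) s MeasurableSet.univ x

theorem discHit_le_one (G : Set (OnePoint M)) (s : ℝ≥0) (ω : Ω) : Z.discHit G s ω ≤ 1 :=
  iSup₂_le fun _ _ => disc_mul_indicator_le _ _ _

theorem hitPot_le_one (G : Set (OnePoint M)) (y : OnePoint M) : Z.hitPot G y ≤ 1 :=
  (lintegral_mono fun ω => Z.discHit_le_one G 0 ω).trans (by simp)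

theorem discHit_mono {G G' : Set (OnePoint M)} (h : G ⊆ G') (s : ℝ≥0) (ω : Ω) :
    Z.discHit G s ω ≤ Z.discHit G' s ω :=
  iSup₂_mono fun _ _ => mul_le_mul_right
    (indicator_le_indicator_of_subset h (fun _ => zero_le_one) _) _

theorem hitPot_mono {G G' : Set (OnePoint M)} (h : G ⊆ G') (y : OnePoint M) :
    Z.hitPot G y ≤ Z.hitPot G' y :=
  lintegral_mono fun ω => Z.discHit_mono h 0 ω

theorem one_le_hitPot {G : Set (OnePoint M)} {y : OnePoint M} (hy : y ∈ G) :
    1 ≤ Z.hitPot G y := by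
  rw [hitPot]
  calc (1 : ℝ≥0∞) = ∫⁻ _, 1 ∂Z.P y := by simp
    _ ≤ _ := lintegral_mono_ae ?_
  filter_upwards [Z.start y] with ω hω
  refine le_iSup₂_of_le 0 0 ?_
  simp [disc_zero, hω, hy]

/-- The times t + j / 2^n need not be dyadic. As G is open and paths are right-continuous, a visit
there is followed by visits at dyadic times decreasing to it, and the discount is continuous. -/
theorem disc_mul_discHit_le {G : Set (OnePoint M)} (hG : IsOpen G) (t : ℝ≥0) (ω : Ω) :
    disc t * Z.discHit G t ω ≤ Z.discHit G 0 ω := by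
  simp only [discHit, ENNReal.mul_iSup]
  refine iSup₂_le fun n j => ?_
  by_cases hX : Z.X (t + j / 2 ^ n) ω ∈ G
  · rw [indicator_of_mem hX, Pi.one_apply, mul_one, ← disc_add]
    set u : ℝ≥0 := t + j / 2 ^ n
    have h1 := (continuous_disc.tendsto u).comp
      ((_root_.tendsto_dyadicAbove u).mono_right nhdsWithin_le_nhds)
    have h2 := (Z.tendsto_dyadicAbove u ω).eventually (hG.mem_nhds hX)
    refine le_of_tendsto h1 (h2.mono fun l hl => ?_)
    refine le_iSup₂_of_le l (⌊2 ^ l * u⌋₊ + 1) ?_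
    have h3 : ((⌊2 ^ l * u⌋₊ + 1 : ℕ) : ℝ≥0) / 2 ^ l = dyadicAbove l u := by
      push_cast
      rfl
    rw [h3, zero_add, indicator_of_mem hl, Pi.one_apply, mul_one, Function.comp_apply]
  · rw [indicator_of_notMem hX]
    simp

/-- The hitting potential of an open set is `1`-excessive. -/
theorem disc_mul_sg_hitPot_le {G : Set (OnePoint M)} (hG : IsOpen G) (t : ℝ≥0)
    (y : OnePoint M) : disc t * Z.sg t (Z.hitPot G) y ≤ Z.hitPot G y := by
  rw [Z.lintegral_hitPot hG.measurableSet, ← lintegral_const_mul' _ _ (disc_ne_top t)]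
  exact lintegral_mono fun ω => Z.disc_mul_discHit_le hG t ω

theorem discHit_union (G G' : Set (OnePoint M)) (s : ℝ≥0) (ω : Ω) :
    Z.discHit (G ∪ G') s ω ≤ max (Z.discHit G s ω) (Z.discHit G' s ω) := by
  refine iSup₂_le fun n j => ?_
  by_cases h : Z.X (s + j / 2 ^ n) ω ∈ G
  · refine le_max_of_le_left (le_iSup₂_of_le n j ?_)
    rw [indicator_of_mem h, indicator_of_mem (show _ ∈ G ∪ G' from Or.inl h)]
  · refine le_max_of_le_right (le_iSup₂_of_le n j ?_)
    by_cases h' : Z.X (s + j / 2 ^ n) ω ∈ G'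
    · rw [indicator_of_mem h', indicator_of_mem (show _ ∈ G ∪ G' from Or.inr h')]
    · rw [indicator_of_notMem (show _ ∉ G ∪ G' from fun h'' => Or.elim h'' h h')]
      simp

/-- Pathwise: the discount for U ∪ V is at most the maximum of the two, that for W at most their
minimum, and max + min is the sum. -/
theorem hitPot_union_add_le {U V W : Set (OnePoint M)} (hU : MeasurableSet U)
    (hV : MeasurableSet V) (hWU : W ⊆ U) (hWV : W ⊆ V) (y : OnePoint M) :
    Z.hitPot (U ∪ V) y + Z.hitPot W y ≤ Z.hitPot U y + Z.hitPot V y := by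
  simp only [hitPot]
  rw [← lintegral_add_left (Z.measurable_discHit (hU.union hV) 0),
    ← lintegral_add_left (Z.measurable_discHit hU 0)]
  refine lintegral_mono fun ω => ?_
  rw [← max_add_min (Z.discHit U 0 ω)]
  exact add_le_add (Z.discHit_union U V 0 ω)
    (le_min (Z.discHit_mono hWU 0 ω) (Z.discHit_mono hWV 0 ω))

theorem hitPot_iUnion {U : ℕ → Set (OnePoint M)} (hU : ∀ n, MeasurableSet (U n))
    (hmono : Monotone U) (y : OnePoint M) :
    Z.hitPot (⋃ n, U n) y = ⨆ n, Z.hitPot (U n) y := by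
  simp only [hitPot]
  rw [← lintegral_iSup (fun n => Z.measurable_discHit (hU n) 0)
    fun n k h ω => Z.discHit_mono (hmono h) 0 ω]
  refine lintegral_congr fun ω => le_antisymm (iSup₂_le fun n j => ?_)
    (iSup_le fun n => Z.discHit_mono (subset_iUnion U n) 0 ω)
  by_cases h : Z.X (0 + j / 2 ^ n) ω ∈ ⋃ n, U n
  · obtain ⟨k, hk⟩ := mem_iUnion.1 h
    refine le_iSup_of_le k (le_iSup₂_of_le n j ?_)
    rw [indicator_of_mem h, indicator_of_mem hk]
  · rw [indicator_of_notMem h]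
    simp

end HuntProcess

/-! ### Capacitability of analytic sets -/

/-- A finite, monotone, strongly subadditive set function on open sets that is continuous along
increasing sequences. -/
structure IsOpenCapacity {M : Type*} [TopologicalSpace M] (γ : Set M → ℝ≥0∞) : Prop where
  mono : ∀ U V, U ⊆ V → γ U ≤ γ V
  strong : ∀ U V W, IsOpen U → IsOpen V → IsOpen W → W ⊆ U → W ⊆ V →
    γ (U ∪ V) + γ W ≤ γ U + γ V
  iUnion_le : ∀ U : ℕ → Set M, (∀ n, IsOpen (U n)) → Monotone U → γ (⋃ n, U n) ≤ ⨆ n, γ (U n)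
  ne_top : γ univ ≠ ⊤

/-- The outer capacity `inf {γ(U) : U ⊇ A open}`. -/
def outerCap {M : Type*} [TopologicalSpace M] (γ : Set M → ℝ≥0∞) (A : Set M) : ℝ≥0∞ :=
  ⨅ (U : Set M) (_ : IsOpen U) (_ : A ⊆ U), γ U

namespace IsOpenCapacity

variable {M : Type*} [TopologicalSpace M] {γ : Set M → ℝ≥0∞}

theorem outerCap_le {A U : Set M} (hU : IsOpen U) (h : A ⊆ U) : outerCap γ A ≤ γ U :=
  iInf_le_of_le U (iInf_le_of_le hU (iInf_le_of_le h le_rfl))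

theorem outerCap_ne_top (hγ : IsOpenCapacity γ) (A : Set M) : outerCap γ A ≠ ⊤ :=
  ne_top_of_le_ne_top hγ.ne_top (outerCap_le isOpen_univ (subset_univ A))

theorem exists_isOpen_lt {A : Set M} {η : ℝ≥0∞} (h : outerCap γ A < η) :
    ∃ U, IsOpen U ∧ A ⊆ U ∧ γ U < η := by
  simp only [outerCap, iInf_lt_iff] at h
  obtain ⟨U, hU, hA, h⟩ := h
  exact ⟨U, hU, hA, h⟩

/-- Take open G_n ⊇ A_n with γ(G_n) below the outer capacity of A_n plus e_n. Strong subadditivity,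
applied with an intersection that still contains A_n, makes the errors for G_0 ∪ … ∪ G_n add up to
at most Σ e_k < ε. -/
theorem outerCap_iUnion_le (hγ : IsOpenCapacity γ) {A : ℕ → Set M} (hA : Monotone A) {η : ℝ≥0∞}
    (h : ∀ n, outerCap γ (A n) ≤ η) : outerCap γ (⋃ n, A n) ≤ η := by
  refine ENNReal.le_of_forall_pos_le_add fun ε hε _ => ?_
  obtain ⟨e, he, hsum⟩ := ENNReal.exists_pos_sum_of_countable (ε := ε) (by simpa using hε.ne') ℕ
  have hex : ∀ n, ∃ U, IsOpen U ∧ A n ⊆ U ∧ γ U < outerCap γ (A n) + e n := fun n =>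
    exists_isOpen_lt (ENNReal.lt_add_right (hγ.outerCap_ne_top _) (by simpa using (he n).ne'))
  choose G hGo hAG hG using hex
  have hopen : ∀ n, IsOpen (accumulate G n) := fun n =>
    isOpen_biUnion fun k _ => hGo k
  have hsub : ∀ n, A n ⊆ accumulate G n := fun n => (hAG n).trans subset_accumulate
  have hbound : ∀ n, γ (accumulate G n) ≤ outerCap γ (A n) + ∑ k ∈ Finset.range (n + 1), (e k : ℝ≥0∞) := by
    intro n
    induction n with
    | zero => simpa using (hG 0).le
    | succ n ih =>
      rw [accumulate_succ]
      have h1 := hγ.strong (accumulate G n) (G (n + 1)) (accumulate G n ∩ G (n + 1)) (hopen n)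
        (hGo _) ((hopen n).inter (hGo _)) inter_subset_left inter_subset_right
      have h2 : outerCap γ (A n) ≤ γ (accumulate G n ∩ G (n + 1)) :=
        outerCap_le ((hopen n).inter (hGo _))
          (subset_inter (hsub n) ((hA n.le_succ).trans (hAG (n + 1))))
      have h3 : γ (accumulate G n ∪ G (n + 1)) + outerCap γ (A n) ≤
          (outerCap γ (A (n + 1)) + ∑ k ∈ Finset.range (n + 1 + 1), (e k : ℝ≥0∞)) +
            outerCap γ (A n) := by
        refine (add_le_add le_rfl h2).trans (h1.trans ((add_le_add ih (hG (n + 1)).le).trans_eq ?_))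
        rw [Finset.sum_range_succ _ (n + 1)]
        ring
      exact (ENNReal.add_le_add_iff_right (hγ.outerCap_ne_top _)).1 h3
  have hU : outerCap γ (⋃ n, A n) ≤ ⨆ n, γ (accumulate G n) :=
    (outerCap_le (isOpen_iUnion hopen) (iUnion_mono hsub)).trans
      (hγ.iUnion_le _ hopen monotone_accumulate)
  refine hU.trans (iSup_le fun n => (hbound n).trans (add_le_add (h n) ?_))
  exact (ENNReal.sum_le_tsum _).trans hsum.le

/-- Choquet's capacitability theorem, for sets of capacity zero. -/
theorem outerCap_eq_zero_of_analyticSet (hγ : IsOpenCapacity γ) {N : Set M} (hN : AnalyticSet N)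
    (h : ∀ K ⊆ N, IsCompact K → outerCap γ K = 0) : outerCap γ N = 0 := by
  rw [AnalyticSet_def] at hN
  rcases hN with rfl | ⟨F, hF, rfl⟩
  · exact h ∅ le_rfl isCompact_empty
  by_contra hne
  obtain ⟨η, hη0, hη⟩ := exists_between (pos_iff_ne_zero.2 hne)
  -- The sets {x k ≤ n} increase to everything, so by continuity along increasing sequences one
  -- coordinate at a time can be bounded while the outer capacity stays above η.
  have hstep : ∀ (S : {S : Set (ℕ → ℕ) // η < outerCap γ (F '' S)}) (k : ℕ),
      ∃ n, η < outerCap γ (F '' (S.1 ∩ {x | x k ≤ n})) := by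
    intro S k
    by_contra! hle
    have h1 := hγ.outerCap_iUnion_le (A := fun n => F '' (S.1 ∩ {x | x k ≤ n}))
      (fun n n' hn => image_mono (inter_subset_inter_right _ fun x (hx : x k ≤ n) => hx.trans hn)) hle
    have h2 : ⋃ n, F '' (S.1 ∩ {x : ℕ → ℕ | x k ≤ n}) = F '' S.1 := by
      rw [← image_iUnion, ← inter_iUnion]
      congr 1
      rw [inter_eq_left]
      exact fun x _ => mem_iUnion.2 ⟨x k, le_refl (x k)⟩
    rw [h2] at h1
    exact absurd S.2 (not_lt.2 h1)
  choose bnd hbnd using hstep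
  let S : ℕ → {S : Set (ℕ → ℕ) // η < outerCap γ (F '' S)} := fun n =>
    Nat.rec ⟨univ, by rwa [image_univ]⟩
      (fun k T => ⟨T.1 ∩ {x | x k ≤ bnd T k}, hbnd T k⟩) n
  let b : ℕ → ℕ := fun k => bnd (S k) k
  have hS : ∀ n, (S n).1 = {x | ∀ k < n, x k ≤ b k} := by
    intro n
    induction n with
    | zero => simp [S]
    | succ n ih =>
      have h1 : (S (n + 1)).1 = (S n).1 ∩ {x | x n ≤ b n} := rfl
      rw [h1, ih]
      ext x
      simp only [mem_inter_iff, mem_ofPred_eq, Nat.lt_succ_iff_lt_or_eq]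
      constructor
      · rintro ⟨h1, h2⟩ k (hk | rfl)
        exacts [h1 k hk, h2]
      · exact fun h => ⟨fun k hk => h k (Or.inl hk), h n (Or.inr rfl)⟩
  let K : Set (ℕ → ℕ) := Set.pi univ fun k => Iic (b k)
  have hK : IsCompact K := isCompact_univ_pi fun k => (finite_Iic (b k)).isCompact
  have hK0 := h (F '' K) (image_subset_range _ _) (hK.image hF)
  obtain ⟨U, hU, hKU, hUη⟩ := exists_isOpen_lt (hK0.trans_lt hη0)
  -- Otherwise pick x_n ∈ S_n with F(x_n) ∉ U. Cut off at b, these lie in the compact box K and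
  -- agree with x_n in the first n coordinates, so a subsequence of (x_n) converges to a point of K,
  -- contradicting F(K) ⊆ U.
  have hex : ∃ n, F '' (S n).1 ⊆ U := by
    by_contra! hall
    simp only [not_subset] at hall
    choose y hy hyU using hall
    choose x hx hxy using hy
    obtain ⟨z, hz, ψ, hψ, hlim⟩ := hK.tendsto_subseq (x := fun n k => min (x n k) (b k))
      (fun n k _ => mem_Iic.2 (min_le_right _ _))
    have hlim' : Tendsto (fun n => x (ψ n)) atTop (𝓝 z) := by
      rw [tendsto_pi_nhds] at hlim ⊢
      intro k
      refine (hlim k).congr' ?_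
      filter_upwards [eventually_gt_atTop k] with n hn
      have h1 := hx (ψ n)
      rw [hS] at h1
      exact min_eq_left (h1 k (hn.trans_le (hψ.id_le n)))
    have h1 := (hF.tendsto z).comp hlim'
    obtain ⟨n, hn⟩ := (h1.eventually (hU.mem_nhds (hKU ⟨z, hz, rfl⟩))).exists
    exact hyU (ψ n) (hxy (ψ n) ▸ hn)
  obtain ⟨n, hn⟩ := hex
  exact absurd ((S n).2.trans_le (outerCap_le hU hn)) (not_lt.2 hUη.le)

end IsOpenCapacity

/-! ### Properly exceptional sets have hitting potential zero -/

namespace HuntProcess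

variable {M Ω : Type*} [MetricSpace M] [MeasurableSpace M] [BorelSpace M]
  [MeasurableSpace Ω] (Z : HuntProcess M Ω)

/-- The mean hitting potential of `U` with respect to the initial distribution `ν`. -/
def meanHitPot (ν : Measure M) (U : Set M) : ℝ≥0∞ :=
  ∫⁻ x, Z.hitPot (((↑) : M → OnePoint M) '' U) x ∂ν

theorem measurable_hitPot_coe {U : Set M} (hU : IsOpen U) :
    Measurable fun x : M => Z.hitPot (((↑) : M → OnePoint M) '' U) x :=
  (Z.measurable_hitPot (OnePoint.isOpenMap_coe _ hU).measurableSet).comp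
    OnePoint.continuous_coe.measurable

theorem isOpenCapacity_meanHitPot (ν : Measure M) [IsFiniteMeasure ν] :
    IsOpenCapacity (Z.meanHitPot ν) where
  mono U V h := lintegral_mono fun x => Z.hitPot_mono (image_mono h) _
  strong U V W hU hV hW hWU hWV := by
    simp only [meanHitPot]
    rw [← lintegral_add_left (Z.measurable_hitPot_coe (hU.union hV)),
      ← lintegral_add_left (Z.measurable_hitPot_coe hU), image_union]
    exact lintegral_mono fun x => Z.hitPot_union_add_le (OnePoint.isOpenMap_coe _ hU).measurableSet
      (OnePoint.isOpenMap_coe _ hV).measurableSet (image_mono hWU) (image_mono hWV) _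
  iUnion_le U hU hmono := by
    simp only [meanHitPot]
    rw [← lintegral_iSup (fun n => Z.measurable_hitPot_coe (hU n))
      fun n k h x => Z.hitPot_mono (image_mono (hmono h)) _, image_iUnion]
    exact lintegral_mono fun x => (Z.hitPot_iUnion
      (fun n => (OnePoint.isOpenMap_coe _ (hU n)).measurableSet)
      (fun n k h => image_mono (hmono h)) _).le
  ne_top := ne_top_of_le_ne_top (measure_ne_top ν univ)
    ((lintegral_mono fun x => Z.hitPot_le_one _ _).trans (by simp))

end HuntProcess

namespace HuntProcess

variable {M Ω : Type*} [MetricSpace M] [LocallyCompactSpace M] [MeasurableSpace Ω]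
  (Z : HuntProcess M Ω)

theorem exists_lt_of_disc_gt {η : ℝ≥0∞} (hη : 0 < η) : ∃ T : ℝ≥0, ∀ t, η < disc t → t ≤ T := by
  have h1 : Tendsto (fun t : ℝ => ENNReal.ofReal (Real.exp (-t))) atTop (𝓝 0) := by
    have := (ENNReal.continuous_ofReal.tendsto 0).comp Real.tendsto_exp_neg_atTop_nhds_zero
    simpa [Function.comp_def] using this
  obtain ⟨T, hT⟩ := eventually_atTop.1 (h1.eventually (gt_mem_nhds hη))
  refine ⟨T.toNNReal, fun t ht => ?_⟩
  by_contra! hlt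
  have h2 : T ≤ t := (Real.le_coe_toNNReal T).trans (NNReal.coe_le_coe.2 hlt.le)
  exact absurd ht (not_lt.2 (hT t h2).le)

/-- If a path visits every neighbourhood `thickening (1/(n+1)) K ∩ L` of a compact set `K` before a
fixed time, then the path or its left limit visits `K`. -/
theorem exists_mem_of_forall_lt_discHit {K L : Set M} (hK : IsCompact K) (hL : IsCompact L)
    {η : ℝ≥0∞} (hη : 0 < η) {ω : Ω}
    (h : ∀ n : ℕ, η < Z.discHit (((↑) : M → OnePoint M) ''
      (Metric.thickening (1 / (n + 1)) K ∩ interior L)) 0 ω) :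
    ∃ t, Z.X t ω ∈ ((↑) : M → OnePoint M) '' K ∨
      (0 < t ∧ ∃ l, Tendsto (fun s => Z.X s ω) (𝓝[<] t) (𝓝 l) ∧
        l ∈ ((↑) : M → OnePoint M) '' K) := by
  have hex : ∀ n : ℕ, ∃ t : ℝ≥0, η < disc t ∧ Z.X t ω ∈ ((↑) : M → OnePoint M) ''
      (Metric.thickening (1 / (n + 1)) K ∩ interior L) := by
    intro n
    have h1 := h n
    simp only [discHit, lt_iSup_iff] at h1
    obtain ⟨k, j, hkj⟩ := h1
    rw [zero_add] at hkj
    by_cases hX : Z.X (j / 2 ^ k) ω ∈ ((↑) : M → OnePoint M) ''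
      (Metric.thickening (1 / (n + 1)) K ∩ interior L)
    · rw [indicator_of_mem hX, Pi.one_apply, mul_one] at hkj
      exact ⟨_, hkj, hX⟩
    · rw [indicator_of_notMem hX, mul_zero] at hkj
      exact absurd hkj not_lt_zero
  choose t ht hXt using hex
  obtain ⟨T, hT⟩ := exists_lt_of_disc_gt hη
  -- The visiting times lie in [0, T]; along an ultrafilter they converge to some s, entirely from
  -- the left, at s, or from the right. Left limits or right-continuity then make the positions
  -- converge, and the limit lies in K.
  let V : Ultrafilter ℝ≥0 := (hyperfilter ℕ).map t
  obtain ⟨s, -, hs⟩ := (isCompact_Icc (a := (0 : ℝ≥0)) (b := T)).ultrafilter_le_nhds V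
    (le_principal_iff.2 (Filter.mem_map.2 (Filter.univ_mem' fun n => ⟨zero_le, hT _ (ht n)⟩)))
  have key : ∀ l, Tendsto (fun n => Z.X (t n) ω) (hyperfilter ℕ) (𝓝 l) →
      l ∈ ((↑) : M → OnePoint M) '' K := by
    intro l hl
    have hmem : ∀ k : ℕ, l ∈ ((↑) : M → OnePoint M) '' (Metric.cthickening (1 / (k + 1)) K ∩ L) := by
      intro k
      -- Intersecting with the compact L keeps the set closed in the one-point compactification, so
      -- the limit is not the cemetery.
      have hcl : IsClosed (((↑) : M → OnePoint M) '' (Metric.cthickening (1 / (k + 1)) K ∩ L)) :=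
        ((hL.inter_left Metric.isClosed_cthickening).image OnePoint.continuous_coe).isClosed
      refine hcl.mem_of_tendsto hl ?_
      have h2 : ∀ᶠ n in (hyperfilter ℕ : Filter ℕ), k ≤ n :=
        Filter.Tendsto.eventually_ge_atTop (by
          rw [← Nat.cofinite_eq_atTop]
          exact hyperfilter_le_cofinite) k
      filter_upwards [h2] with n hn
      refine image_mono (inter_subset_inter ?_ interior_subset) (hXt n)
      refine (Metric.thickening_mono ?_ K).trans (Metric.thickening_subset_cthickening _ K)
      gcongr
    obtain ⟨y, -, rfl⟩ := hmem 0
    refine ⟨y, ?_, rfl⟩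
    have hy : ∀ k : ℕ, y ∈ Metric.cthickening (1 / (k + 1)) K := by
      intro k
      obtain ⟨y', hy', heq⟩ := hmem k
      rw [← OnePoint.coe_injective heq]
      exact hy'.1
    rw [← hK.isClosed.closure_eq, Metric.mem_closure_iff_infEDist_zero]
    refine nonpos_iff_eq_zero.1 (ge_of_tendsto' (f := fun k : ℕ => ENNReal.ofReal (1 / (k + 1)))
      (x := atTop) ?_ fun k => hy k)
    have := (ENNReal.continuous_ofReal.tendsto 0).comp
      (tendsto_one_div_add_atTop_nhds_zero_nat (𝕜 := ℝ))
    simpa [Function.comp_def] using this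
  have hcases : Iio s ∈ V ∨ {s} ∈ V ∨ Ioi s ∈ V := by
    have h1 : Iio s ∪ ({s} ∪ Ioi s) ∈ V := by
      refine Filter.univ_mem' fun u => ?_
      simp only [mem_union, mem_Iio, mem_singleton_iff, mem_Ioi]
      exact lt_trichotomy u s
    rwa [Ultrafilter.union_mem_iff, Ultrafilter.union_mem_iff] at h1
  have htV : Tendsto t (hyperfilter ℕ) V := tendsto_map
  rcases hcases with h1 | h1 | h1
  · have h2 : (V : Filter ℝ≥0) ≤ 𝓝[<] s := le_inf hs (le_principal_iff.2 h1)
    have hs0 : 0 < s := by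
      obtain ⟨u, hu⟩ := V.nonempty_of_mem h1
      exact lt_of_le_of_lt zero_le hu
    obtain ⟨l, hl⟩ := Z.left_limits ω s hs0
    exact ⟨s, Or.inr ⟨hs0, l, hl, key l (hl.comp (htV.mono_right h2))⟩⟩
  · refine ⟨s, Or.inl (key _ ?_)⟩
    refine tendsto_nhds_of_eventually_eq ?_
    have h2 : ∀ᶠ n in (hyperfilter ℕ : Filter ℕ), t n = s := htV.eventually h1
    filter_upwards [h2] with n hn
    rw [hn]
  · have h2 : (V : Filter ℝ≥0) ≤ 𝓝[>] s := le_inf hs (le_principal_iff.2 h1)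
    exact ⟨s, Or.inl (key _ ((Z.right_continuous ω s).comp (htV.mono_right h2)))⟩

section

variable [MeasurableSpace M] [BorelSpace M] {Z}

theorem IsProperlyExceptional.tendsto_hitPot {m : Measure M} {N : Set M}
    (hN : Z.IsProperlyExceptional m N) {K L : Set M} (hKN : K ⊆ N) (hK : IsCompact K)
    (hL : IsCompact L) {x : M} (hx : x ∉ N) :
    Tendsto (fun n : ℕ => Z.hitPot (((↑) : M → OnePoint M) ''
      (Metric.thickening (1 / (n + 1)) K ∩ interior L)) x) atTop (𝓝 0) := by
  have hopen : ∀ n : ℕ, IsOpen (Metric.thickening (1 / ((n : ℝ) + 1)) K ∩ interior L) := fun n =>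
    Metric.isOpen_thickening.inter isOpen_interior
  have hlim : ∀ᵐ ω ∂Z.P x, Tendsto (fun n : ℕ => Z.discHit (((↑) : M → OnePoint M) ''
      (Metric.thickening (1 / (n + 1)) K ∩ interior L)) 0 ω) atTop (𝓝 0) := by
    filter_upwards [hN.2.2 x hx, Z.start x] with ω hω h0
    have hanti : Antitone fun n : ℕ => Z.discHit (((↑) : M → OnePoint M) ''
      (Metric.thickening (1 / (n + 1)) K ∩ interior L)) 0 ω := by
      intro n k hnk
      refine Z.discHit_mono (image_mono (inter_subset_inter_left _ (Metric.thickening_mono ?_ K))) 0 ω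
      gcongr
    have htend := tendsto_atTop_iInf hanti
    suffices hz : ⨅ n : ℕ, Z.discHit (((↑) : M → OnePoint M) ''
      (Metric.thickening (1 / (n + 1)) K ∩ interior L)) 0 ω = 0 by rwa [hz] at htend
    by_contra hne
    obtain ⟨η, hη0, hη⟩ := exists_between (pos_iff_ne_zero.2 hne)
    obtain ⟨t, ht⟩ := Z.exists_mem_of_forall_lt_discHit hK hL hη0
      fun n => hη.trans_le (iInf_le _ n)
    rcases ht with ht | ⟨ht0, l, hl, hlK⟩
    -- Proper exceptionality speaks of positive times only; time 0 is excluded by X_0 = x ∉ N.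
    · rcases eq_or_lt_of_le (zero_le (a := t)) with rfl | ht0
      · rw [h0] at ht
        obtain ⟨y, hy, hyx⟩ := ht
        exact hx (OnePoint.coe_injective hyx ▸ hKN hy)
      · exact (hω t ht0).1 (image_mono hKN ht)
    · exact (hω t ht0).2 l hl (image_mono hKN hlK)
  have := tendsto_lintegral_of_dominated_convergence (μ := Z.P x) (fun _ => 1)
    (fun n => Z.measurable_discHit (OnePoint.isOpenMap_coe _ (hopen n)).measurableSet 0)
    (fun n => .of_forall fun ω => Z.discHit_le_one _ 0 ω) (by simp) hlim
  simpa only [hitPot, lintegral_zero] using this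

/-- M need not be complete in its metric, but it is a countable union of compact metric, hence
Polish, pieces. -/
theorem _root_.MeasurableSet.analyticSet_of_locallyCompact [SecondCountableTopology M] {N : Set M}
    (hN : MeasurableSet N) : AnalyticSet N := by
  have h : N = ⋃ n, ((↑) : compactCovering M n → M) '' ((↑) ⁻¹' N) := by
    ext x
    simp only [mem_iUnion, Subtype.image_preimage_coe, mem_inter_iff]
    refine ⟨fun hx => ?_, fun ⟨_, h⟩ => h.2⟩
    have hx' : x ∈ ⋃ n, compactCovering M n := by
      rw [iUnion_compactCovering]
      trivial
    obtain ⟨n, hn⟩ := mem_iUnion.1 hx'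
    exact ⟨n, hn, hx⟩
  rw [h]
  refine AnalyticSet.iUnion fun n => ?_
  have : CompactSpace (compactCovering M n) :=
    isCompact_iff_compactSpace.1 (isCompact_compactCovering M n)
  exact (hN.preimage measurable_subtype_coe).analyticSet.image_of_continuous continuous_subtype_val

/-- A properly exceptional set is contained in open sets with arbitrarily small mean hitting
potential. -/
theorem IsProperlyExceptional.outerCap_meanHitPot_eq_zero [SecondCountableTopology M]
    {m : Measure M} {N : Set M} (hN : Z.IsProperlyExceptional m N) (ν : Measure M)
    [IsFiniteMeasure ν] (hν : ν ≪ m) : outerCap (Z.meanHitPot ν) N = 0 := by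
  refine (Z.isOpenCapacity_meanHitPot ν).outerCap_eq_zero_of_analyticSet
    hN.1.analyticSet_of_locallyCompact fun K hKN hK => ?_
  obtain ⟨L, hL, hKL⟩ := exists_compact_superset hK
  have hlim : Tendsto (fun n : ℕ => Z.meanHitPot ν
      (Metric.thickening (1 / (n + 1)) K ∩ interior L)) atTop (𝓝 0) := by
    have := tendsto_lintegral_of_dominated_convergence (μ := ν) (F := fun (n : ℕ) (x : M) =>
      Z.hitPot (((↑) : M → OnePoint M) '' (Metric.thickening (1 / (n + 1)) K ∩ interior L)) x)
      (f := fun _ => 0) (fun _ => 1)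
      (fun n => Z.measurable_hitPot_coe (Metric.isOpen_thickening.inter isOpen_interior))
      (fun n => .of_forall fun x => Z.hitPot_le_one _ x) (by simp)
      (by
        have h1 : ∀ᵐ x ∂ν, x ∉ N := hν.ae_le (measure_eq_zero_iff_ae_notMem.1 hN.2.1)
        exact h1.mono fun x hx => hN.tendsto_hitPot hKN hK hL hx)
    simpa [meanHitPot] using this
  refine nonpos_iff_eq_zero.1 (ge_of_tendsto' hlim fun n => ?_)
  exact IsOpenCapacity.outerCap_le (Metric.isOpen_thickening.inter isOpen_interior)
    (subset_inter (Metric.self_subset_thickening (by positivity) K) hKL)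

end

end HuntProcess

/-! ### The transition semigroup on functions on the state space -/

theorem OnePoint.measurable_elim_zero {M F : Type*} [TopologicalSpace M] [MeasurableSpace M]
    [BorelSpace M] [MeasurableSpace F] [Zero F] {f : M → F} (hf : Measurable f) :
    Measurable fun y : OnePoint M => y.elim 0 f := by
  have h := OnePoint.measurableEmbedding_coe.measurable_extend hf
    (measurable_const (a := (0 : F)) : Measurable fun _ : OnePoint M => (0 : F))
  convert h using 1
  ext y
  induction y using OnePoint.rec with
  | infty =>
    rw [OnePoint.elim_infty, Function.extend_apply' _ _ _ fun ⟨x, hx⟩ => OnePoint.coe_ne_infty x hx]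
  | coe x => rw [OnePoint.elim_some, OnePoint.coe_injective.extend_apply]

theorem OnePoint.measurable_elim_zero_prod {M S F : Type*} [TopologicalSpace M]
    [MeasurableSpace M] [BorelSpace M] [MeasurableSpace S] [MeasurableSpace F] [Zero F]
    {f : M × S → F} (hf : Measurable f) :
    Measurable fun z : OnePoint M × S => z.1.elim 0 fun x => f (x, z.2) := by
  have he : MeasurableEmbedding (Prod.map (fun x : M => (x : OnePoint M)) (id : S → S)) :=
    OnePoint.measurableEmbedding_coe.prodMap MeasurableEmbedding.id
  have h := he.measurable_extend hf
    (measurable_const (a := (0 : F)) : Measurable fun _ : OnePoint M × S => (0 : F))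
  convert h using 1
  ext ⟨y, s⟩
  induction y using OnePoint.rec with
  | infty =>
    rw [Function.extend_apply' _ _ _ fun ⟨z, hz⟩ =>
      OnePoint.coe_ne_infty z.1 (congrArg Prod.fst hz)]
    rfl
  | coe x => exact (he.injective.extend_apply _ _ (x, s)).symm

namespace HuntProcess

section

variable {M Ω : Type*} [TopologicalSpace M] [MeasurableSpace M] [BorelSpace M]
  [MeasurableSpace Ω] (Z : HuntProcess M Ω)

theorem ltransition_eq_sg (t : ℝ≥0) (f : M → ℝ≥0∞) (x : M) :
    Z.ltransition t f x = Z.sg t (fun y => y.elim 0 f) x := rfl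

theorem measurable_ltransition (t : ℝ≥0) {f : M → ℝ≥0∞} (hf : Measurable f) :
    Measurable (Z.ltransition t f) :=
  (Z.measurable_sg t (OnePoint.measurable_elim_zero hf)).comp OnePoint.continuous_coe.measurable

theorem ltransition_mono (t : ℝ≥0) {f g : M → ℝ≥0∞} (h : ∀ x, f x ≤ g x) (x : M) :
    Z.ltransition t f x ≤ Z.ltransition t g x := by
  refine lintegral_mono fun ω => ?_
  dsimp only
  induction Z.X t ω using OnePoint.rec with
  | infty => simp
  | coe y => simpa using h y

theorem ltransition_le_of_le (t : ℝ≥0) {f : M → ℝ≥0∞} {b : ℝ≥0∞} (h : ∀ x, f x ≤ b) (x : M) :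
    Z.ltransition t f x ≤ b := by
  refine (lintegral_mono (g := fun _ => b) fun ω => ?_).trans (by simp)
  dsimp only
  induction Z.X t ω using OnePoint.rec with
  | infty => simp
  | coe y => simpa using h y

theorem sg_infty (t : ℝ≥0) (f : M → ℝ≥0∞) :
    Z.sg t (fun y => y.elim 0 f) OnePoint.infty = 0 := by
  refine (lintegral_congr_ae ((Z.start OnePoint.infty).mono fun ω h => ?_)).trans lintegral_zero
  dsimp only
  rw [Z.trap ω 0 t zero_le h, OnePoint.elim_infty]

theorem sg_elim_eq (t : ℝ≥0) (f : M → ℝ≥0∞) (y : OnePoint M) :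
    y.elim 0 (Z.ltransition t f) = Z.sg t (fun y => y.elim 0 f) y := by
  induction y using OnePoint.rec with
  | infty => rw [OnePoint.elim_infty, sg_infty]
  | coe x => rw [OnePoint.elim_some, ltransition_eq_sg]

theorem ltransition_add (s t : ℝ≥0) {f : M → ℝ≥0∞} (hf : Measurable f) (x : M) :
    Z.ltransition (s + t) f x = Z.ltransition s (Z.ltransition t f) x := by
  rw [ltransition_eq_sg, ltransition_eq_sg, Z.sg_add s t (OnePoint.measurable_elim_zero hf)]
  simp only [sg_elim_eq]

theorem ltransition_zero (f : M → ℝ≥0∞) (x : M) : Z.ltransition 0 f x = f x := by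
  rw [ltransition_eq_sg, sg_zero, OnePoint.elim_some]

theorem IsSymmetric.lintegral_ltransition_le {Z : HuntProcess M Ω} {m : Measure M}
    (hZ : Z.IsSymmetric m) (t : ℝ≥0) {f : M → ℝ≥0∞} (hf : Measurable f) :
    ∫⁻ x, Z.ltransition t f x ∂m ≤ ∫⁻ x, f x ∂m := by
  have h := hZ t (fun _ => 1) f measurable_const hf
  simp only [one_mul] at h
  rw [h]
  refine lintegral_mono fun x => ?_
  calc Z.ltransition t (fun _ => 1) x * f x ≤ 1 * f x := by
        gcongr
        exact Z.ltransition_le_of_le t (fun _ => le_rfl) x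
    _ = f x := one_mul _

/-- Discounted resolvent `∫₀^∞ e^{-s} p_s f ds`. -/
def resolvent (f : M → ℝ≥0∞) (x : M) : ℝ≥0∞ :=
  ∫⁻ s in Ioi (0 : ℝ), disc s.toNNReal * Z.ltransition s.toNNReal f x

theorem measurable_ltransition_uncurry {f : M → ℝ≥0∞} (hf : Continuous f)
    (hc : Continuous fun y : OnePoint M => y.elim 0 f) {b : ℝ≥0∞} (hb : b ≠ ⊤)
    (hfb : ∀ x, f x ≤ b) :
    Measurable fun z : ℝ≥0 × M => Z.ltransition z.1 f z.2 := by
  refine measurable_of_tendsto_metrizable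
    (f := fun n z => Z.ltransition (dyadicAbove n z.1) f z.2) (fun n => ?_)
    (tendsto_pi_nhds.2 fun z => ?_)
  · have h1 : Measurable fun q : ℕ × M => Z.ltransition ((q.1 + 1) / 2 ^ n) f q.2 :=
      measurable_from_prod_countable_right fun k =>
        Z.measurable_ltransition (((k : ℕ) + 1) / 2 ^ n) hf.measurable
    have h2 : Measurable fun z : ℝ≥0 × M => (⌊2 ^ n * z.1⌋₊, z.2) :=
      (Nat.measurable_floor.comp (measurable_fst.const_mul _)).prodMk measurable_snd
    have h3 := h1.comp h2
    simpa only [dyadicAbove, Function.comp_def] using h3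
  · refine tendsto_lintegral_of_dominated_convergence (fun _ => b)
      (fun n => (OnePoint.measurable_elim_zero hf.measurable).comp (Z.measurable_X _))
      (fun n => .of_forall fun ω => ?_) (by simpa using hb) (.of_forall fun ω => ?_)
    · dsimp only
      induction Z.X (dyadicAbove n z.1) ω using OnePoint.rec with
      | infty => simp
      | coe y => simpa using hfb y
    · have h1 := hc.tendsto (Z.X z.1 ω)
      exact h1.comp (Z.tendsto_dyadicAbove z.1 ω)

theorem lintegral_disc : ∫⁻ s in Ioi (0 : ℝ), disc s.toNNReal = 1 := by
  have h1 : ∫⁻ s in Ioi (0 : ℝ), disc s.toNNReal =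
      ∫⁻ s in Ioi (0 : ℝ), ENNReal.ofReal (Real.exp (-s)) :=
    setLIntegral_congr_fun measurableSet_Ioi fun s hs => by
      simp only [disc, Real.coe_toNNReal _ (le_of_lt hs)]
  rw [h1, ← ofReal_integral_eq_lintegral_ofReal (exp_neg_integrableOn_Ioi 0 one_pos |>.congr_fun
    (fun s _ => by simp) measurableSet_Ioi) (.of_forall fun s => (Real.exp_pos _).le),
    integral_exp_neg_Ioi_zero, ENNReal.ofReal_one]

theorem measurable_disc : Measurable fun s : ℝ => disc s.toNNReal :=
  continuous_disc.measurable.comp measurable_real_toNNReal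

theorem resolvent_le {f : M → ℝ≥0∞} {b : ℝ≥0∞} (h : ∀ x, f x ≤ b) (x : M) :
    Z.resolvent f x ≤ b := by
  calc Z.resolvent f x ≤ ∫⁻ s in Ioi (0 : ℝ), disc s.toNNReal * b :=
        lintegral_mono fun s => by gcongr; exact Z.ltransition_le_of_le _ h x
    _ = b := by rw [lintegral_mul_const _ measurable_disc, lintegral_disc, one_mul]

variable {f : M → ℝ≥0∞} (hf : Measurable f)
  (hT : Measurable fun z : ℝ≥0 × M => Z.ltransition z.1 f z.2)

include hf hT

theorem measurable_resolvent : Measurable (Z.resolvent f) := by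
  have h : Measurable fun z : M × ℝ => disc z.2.toNNReal * Z.ltransition z.2.toNNReal f z.1 :=
    (measurable_disc.comp measurable_snd).mul
      (hT.comp ((measurable_real_toNNReal.comp measurable_snd).prodMk measurable_fst))
  exact h.lintegral_prod_right'

theorem lintegral_mul_resolvent {m : Measure M} [SFinite m] {w : M → ℝ≥0∞} (hw : Measurable w)
    (I : Set ℝ) :
    ∫⁻ x, w x * (∫⁻ s in I, disc s.toNNReal * Z.ltransition s.toNNReal f x) ∂m =
      ∫⁻ s in I, disc s.toNNReal * ∫⁻ x, w x * Z.ltransition s.toNNReal f x ∂m := by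
  have h : Measurable fun z : M × ℝ => disc z.2.toNNReal * Z.ltransition z.2.toNNReal f z.1 :=
    (measurable_disc.comp measurable_snd).mul
      (hT.comp ((measurable_real_toNNReal.comp measurable_snd).prodMk measurable_fst))
  have h1 : ∀ x, w x * ∫⁻ s in I, disc s.toNNReal * Z.ltransition s.toNNReal f x =
      ∫⁻ s in I, w x * (disc s.toNNReal * Z.ltransition s.toNNReal f x) := fun x =>
    (lintegral_const_mul _ (h.comp measurable_prodMk_left)).symm
  rw [lintegral_congr h1, lintegral_lintegral_swap]
  · refine lintegral_congr fun s => ?_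
    rw [← lintegral_const_mul' _ _ (disc_ne_top _)]
    refine lintegral_congr fun x => ?_
    ring
  · exact ((hw.comp measurable_fst).mul h).aemeasurable

/-- Split the time integral at t and shift the tail by the semigroup property. In particular the
resolvent is 1-excessive. -/
theorem resolvent_eq (t : ℝ≥0) (x : M) :
    Z.resolvent f x = (∫⁻ s in Ioc (0 : ℝ) t, disc s.toNNReal * Z.ltransition s.toNNReal f x) +
      disc t * Z.ltransition t (Z.resolvent f) x := by
  have hE : Measurable fun y : OnePoint M => y.elim 0 f := OnePoint.measurable_elim_zero hf
  rw [resolvent, ← Ioc_union_Ioi_eq_Ioi (NNReal.coe_nonneg t),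
    lintegral_union measurableSet_Ioi (Set.disjoint_left.2 fun s h1 h2 => not_lt.2 h1.2 h2)]
  congr 1
  have h1 : Measurable fun z : OnePoint M × ℝ =>
      disc z.2.toNNReal * z.1.elim 0 (Z.ltransition z.2.toNNReal f) :=
    (measurable_disc.comp measurable_snd).mul (OnePoint.measurable_elim_zero_prod
      (hT.comp ((measurable_real_toNNReal.comp measurable_snd).prodMk measurable_fst)))
  have h2 : ∀ y : OnePoint M, y.elim 0 (Z.resolvent f) =
      ∫⁻ s in Ioi (0 : ℝ), disc s.toNNReal * y.elim 0 (Z.ltransition s.toNNReal f) := by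
    intro y
    induction y using OnePoint.rec with
    | infty => simp
    | coe z => simp [resolvent]
  have h3 : ∀ s : ℝ≥0, ∫⁻ ω, (Z.X t ω).elim 0 (Z.ltransition s f) ∂Z.P x =
      Z.ltransition (t + s) f x := fun s => (Z.ltransition_add t s hf x).symm
  rw [ltransition, lintegral_congr fun ω => h2 (Z.X t ω), lintegral_lintegral_swap]
  swap
  · exact (h1.comp (((Z.measurable_X t).comp measurable_fst).prodMk measurable_snd)).aemeasurable
  rw [← lintegral_const_mul' _ _ (disc_ne_top t)]
  have h4 := setLIntegral_Ioi_comp_sub (fun s => disc t * ∫⁻ ω, disc s.toNNReal *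
    (Z.X t ω).elim 0 (Z.ltransition s.toNNReal f) ∂Z.P x) t
  rw [← h4]
  refine setLIntegral_congr_fun measurableSet_Ioi fun u hu => ?_
  have hu' : (t : ℝ) < u := hu
  rw [lintegral_const_mul' _ _ (disc_ne_top _), h3, ← mul_assoc, ← disc_add]
  have h5 : t + (u - t).toNNReal = u.toNNReal := by
    rw [← NNReal.coe_inj, NNReal.coe_add, Real.coe_toNNReal _ (by linarith),
      Real.coe_toNNReal _ (t.coe_nonneg.trans hu'.le)]
    ring
  rw [h5]

end

end HuntProcess

/-! ### Difference quotients of midpoint convex functions -/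

theorem mul_sub_le_sub_of_convex {x : ℕ → ℝ} (hx : ∀ i, 2 * x (i + 1) ≤ x i + x (i + 2)) (k : ℕ) :
    k * (x 1 - x 0) ≤ x k - x 0 := by
  have h : ∀ i, x 1 - x 0 ≤ x (i + 1) - x i := by
    intro i
    induction i with
    | zero => exact le_rfl
    | succ i ih => linarith [hx i]
  induction k with
  | zero => simp
  | succ k ih =>
    push_cast
    linarith [h k]

theorem mul_sub_le_of_midpoint {B : ℝ≥0 → ℝ} (hB : ∀ s t, 2 * B (s + t) ≤ B (2 * s) + B (2 * t))
    (a δ : ℝ≥0) (k : ℕ) : k * (B (a + δ) - B a) ≤ B (a + k * δ) - B a := by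
  have h := mul_sub_le_sub_of_convex (x := fun i => B (a + i * δ)) (fun i => ?_) k
  · simpa using h
  · have h1 := hB ((a + i * δ) / 2) ((a + (i + 2 : ℕ) * δ) / 2)
    rw [mul_div_cancel₀ _ two_ne_zero, mul_div_cancel₀ _ two_ne_zero] at h1
    refine le_trans (le_of_eq ?_) h1
    congr 2
    push_cast
    rw [← add_div, eq_div_iff two_ne_zero]
    ring

/-- A convex function on a half-line that increases somewhere grows at least linearly along an
arithmetic progression, so it is unbounded above. -/
theorem antitone_of_midpoint {B : ℝ≥0 → ℝ} (hB : ∀ s t, 2 * B (s + t) ≤ B (2 * s) + B (2 * t))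
    {C : ℝ} (hC : ∀ t, B t ≤ C) : Antitone B := by
  intro a b hab
  by_contra! h
  obtain ⟨k, hk⟩ := exists_nat_gt ((C - B a) / (B b - B a))
  have h1 := mul_sub_le_of_midpoint hB a (b - a) k
  rw [add_tsub_cancel_of_le hab] at h1
  rw [div_lt_iff₀ (by linarith)] at hk
  linarith [hC (a + k * (b - a))]

/-- The limit is the supremum of the quotients Q. For fixed t and small s, k = ⌊t/s⌋ + 1 steps of
length s cover t and overshoot by at most s, so Q(s) ≥ t/(t+s) · Q(t). No continuity of B is needed.
-/
theorem exists_tendsto_of_midpoint {B : ℝ≥0 → ℝ}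
    (hB : ∀ s t, 2 * B (s + t) ≤ B (2 * s) + B (2 * t)) {C : ℝ} (hC : ∀ t, B t ≤ C) {D : ℝ}
    (hD : ∀ t : ℝ≥0, B 0 - B t ≤ t * D) :
    ∃ l ≤ D, Tendsto (fun t : ℝ≥0 => (t : ℝ)⁻¹ * (B 0 - B t)) (𝓝[>] 0) (𝓝 l) := by
  have hanti := antitone_of_midpoint hB hC
  set Q : ℝ≥0 → ℝ := fun t => (t : ℝ)⁻¹ * (B 0 - B t) with hQ
  have hQD : ∀ t, 0 < t → Q t ≤ D := fun t ht => by
    have ht' : (0 : ℝ) < t := ht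
    rw [hQ]
    dsimp only
    rw [inv_mul_le_iff₀ ht']
    exact hD t
  have hbdd : BddAbove (Q '' Ioi 0) := ⟨D, by rintro _ ⟨t, ht, rfl⟩; exact hQD t ht⟩
  have hne : (Q '' Ioi 0).Nonempty := ⟨Q 1, 1, mem_Ioi.2 one_pos, rfl⟩
  refine ⟨sSup (Q '' Ioi 0), csSup_le hne (by rintro _ ⟨t, ht, rfl⟩; exact hQD t ht), ?_⟩
  refine tendsto_order.2 ⟨fun a ha => ?_, fun a ha => ?_⟩
  · obtain ⟨_, ⟨t, ht, rfl⟩, hat⟩ := exists_lt_of_lt_csSup hne ha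
    have ht' : (0 : ℝ) < t := ht
    have hlim : Tendsto (fun s : ℝ≥0 => ((t : ℝ) + s)⁻¹ * (B 0 - B t)) (𝓝[>] 0) (𝓝 (Q t)) := by
      have h1 : Tendsto (fun s : ℝ≥0 => (t : ℝ) + s) (𝓝[>] 0) (𝓝 ((t : ℝ) + (0 : ℝ≥0))) :=
        (tendsto_const_nhds.add NNReal.continuous_coe.continuousAt.tendsto).mono_left
          nhdsWithin_le_nhds
      rw [NNReal.coe_zero, add_zero] at h1
      exact (h1.inv₀ ht'.ne').mul_const _
    filter_upwards [hlim.eventually_const_lt hat, self_mem_nhdsWithin] with s hs hs0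
    have hs0' : (0 : ℝ) < s := hs0
    refine hs.trans_le ?_
    set k := ⌊t / s⌋₊ + 1 with hk
    have hks : t ≤ k * s := by
      have := (Nat.lt_floor_add_one (t / s)).le
      rw [div_le_iff₀ hs0] at this
      simpa [hk] using this
    have hks' : k * s ≤ t + s := by
      have := Nat.floor_le (zero_le (a := t / s))
      rw [le_div_iff₀ hs0] at this
      rw [hk]
      push_cast
      rw [add_mul, one_mul]
      gcongr
    have h1 := mul_sub_le_of_midpoint hB 0 s k
    rw [zero_add, zero_add] at h1
    have h2 := hanti hks
    have h3 : 0 ≤ B 0 - B s := sub_nonneg.2 (hanti zero_le)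
    have h4 : (k : ℝ) * s ≤ t + s := mod_cast hks'
    rw [hQ]
    dsimp only
    rw [inv_mul_le_iff₀ (by positivity), ← mul_assoc, ← div_eq_mul_inv]
    calc B 0 - B t ≤ k * (B 0 - B s) := by linarith
      _ ≤ (t + s) / s * (B 0 - B s) := by
        gcongr
        rwa [le_div_iff₀ hs0']
  · filter_upwards [self_mem_nhdsWithin] with s hs
    exact (le_csSup hbdd ⟨s, hs, rfl⟩).trans_lt ha

/-- The inequality (b - a)(d - c) ≥ 0 without subtraction. -/
theorem ENNReal.mul_add_mul_le {a b c d : ℝ≥0∞} (hab : a ≤ b) (hcd : c ≤ d) :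
    a * d + b * c ≤ a * c + b * d := by
  obtain ⟨e, rfl⟩ := exists_add_of_le hcd
  calc a * (c + e) + b * c = a * c + b * c + a * e := by ring
    _ ≤ a * c + b * c + b * e := by gcongr
    _ = a * c + b * (c + e) := by ring

/-! ### Energy of a truncated potential -/

namespace HuntProcess

variable {M Ω : Type*} [TopologicalSpace M] [MeasurableSpace M] [BorelSpace M]
  [MeasurableSpace Ω] {Z : HuntProcess M Ω} {m : Measure M}

/-- `w` is 1-excessive with respect to the transition semigroup. -/
def IsExcessive (Z : HuntProcess M Ω) (w : M → ℝ≥0∞) : Prop :=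
  ∀ (t : ℝ≥0) (x : M), disc t * Z.ltransition t w x ≤ w x

theorem IsExcessive.inf {u v : M → ℝ≥0∞} (hu : Z.IsExcessive u) (hv : Z.IsExcessive v) :
    Z.IsExcessive fun x => min (u x) (v x) := fun t x =>
  le_min ((mul_le_mul_right (Z.ltransition_mono t (fun _ => min_le_left _ _) x) _).trans (hu t x))
    ((mul_le_mul_right (Z.ltransition_mono t (fun _ => min_le_right _ _) x) _).trans (hv t x))

theorem isExcessive_hitPot {G : Set (OnePoint M)} (hG : IsOpen G) :
    Z.IsExcessive fun x : M => Z.hitPot G x := by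
  intro t x
  refine le_trans (mul_le_mul_right ?_ _) (Z.disc_mul_sg_hitPot_le hG t x)
  rw [ltransition_eq_sg]
  refine Z.sg_mono (fun y => ?_) x
  induction y using OnePoint.rec with
  | infty => simp
  | coe y => simp

theorem IsSymmetric.lintegral_mul_ltransition_add (hZ : Z.IsSymmetric m) (s t : ℝ≥0)
    {w : M → ℝ≥0∞} (hw : Measurable w) :
    ∫⁻ x, w x * Z.ltransition (s + t) w x ∂m =
      ∫⁻ x, Z.ltransition s w x * Z.ltransition t w x ∂m := by
  rw [← hZ s w _ hw (Z.measurable_ltransition t hw)]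
  simp only [Z.ltransition_add s t hw]

/-- By symmetry (w, p_{s+t} w) = (p_s w, p_t w), and 2ab ≤ a² + b². This is midpoint convexity of t
↦ (w, p_t w). -/
theorem IsSymmetric.two_mul_lintegral_le (hZ : Z.IsSymmetric m) (s t : ℝ≥0)
    {w : M → ℝ≥0∞} (hw : Measurable w) :
    2 * ∫⁻ x, w x * Z.ltransition (s + t) w x ∂m ≤
      (∫⁻ x, w x * Z.ltransition (2 * s) w x ∂m) + ∫⁻ x, w x * Z.ltransition (2 * t) w x ∂m := by
  have hs := Z.measurable_ltransition s hw
  have ht := Z.measurable_ltransition t hw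
  rw [two_mul s, two_mul t, hZ.lintegral_mul_ltransition_add s s hw,
    hZ.lintegral_mul_ltransition_add t t hw, hZ.lintegral_mul_ltransition_add s t hw,
    ← lintegral_add_left (by fun_prop), ← lintegral_const_mul _ (by fun_prop)]
  refine lintegral_mono fun x => ?_
  dsimp only
  generalize Z.ltransition s w x = a
  generalize Z.ltransition t w x = b
  rcases le_total a b with h | h
  · calc 2 * (a * b) = a * b + b * a := by ring
      _ ≤ a * a + b * b := ENNReal.mul_add_mul_le h h
  · calc 2 * (a * b) = b * a + a * b := by ring
      _ ≤ b * b + a * a := ENNReal.mul_add_mul_le h h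
      _ = a * a + b * b := add_comm _ _

section

variable {f : M → ℝ≥0∞} (hf : Measurable f)
  (hT : Measurable fun z : ℝ≥0 × M => Z.ltransition z.1 f z.2)

include hf hT

theorem isExcessive_resolvent : Z.IsExcessive (Z.resolvent f) := fun t x => by
  rw [Z.resolvent_eq hf hT t x]
  exact le_add_self

theorem IsSymmetric.lintegral_resolvent_le [SFinite m] (hZ : Z.IsSymmetric m) :
    ∫⁻ x, Z.resolvent f x ∂m ≤ ∫⁻ x, f x ∂m := by
  have h := Z.lintegral_mul_resolvent (m := m) hf hT (w := fun _ => 1) measurable_const (Ioi 0)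
  simp only [one_mul] at h
  calc ∫⁻ x, Z.resolvent f x ∂m = _ := h
    _ ≤ ∫⁻ s in Ioi (0 : ℝ), disc s.toNNReal * ∫⁻ x, f x ∂m :=
        lintegral_mono fun s => mul_le_mul_right (hZ.lintegral_ltransition_le _ hf) _
    _ = ∫⁻ x, f x ∂m := by
        rw [lintegral_mul_const _ measurable_disc, lintegral_disc, one_mul]

/-- With U the resolvent, w - e^{-t} p_t w ≥ 0 and w ≤ Uf give (w - e^{-t} p_t w, w) ≤ (w - e^{-t}
p_t w, Uf) = (w, Uf - e^{-t} p_t Uf). The last difference is the resolvent integral over (0, t], and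
moving p_s onto w bounds the pairing by t (w, f). -/
theorem IsSymmetric.lintegral_sq_le [SFinite m] (hZ : Z.IsSymmetric m) {b : ℝ≥0∞} (hb : b ≠ ⊤)
    (hfb : ∀ x, f x ≤ b) (hfm : ∫⁻ x, f x ∂m ≠ ⊤) {w : M → ℝ≥0∞} (hw : Measurable w)
    (hexc : Z.IsExcessive w) (hwf : ∀ x, w x ≤ Z.resolvent f x) (t : ℝ≥0) :
    ∫⁻ x, w x * w x ∂m ≤
      disc t * (∫⁻ x, w x * Z.ltransition t w x ∂m) + t * ∫⁻ x, w x * f x ∂m := by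
  have hh := Z.measurable_resolvent hf hT
  have hTw := Z.measurable_ltransition t hw
  have hTh := Z.measurable_ltransition t hh
  -- This common term is cancelled at the end, hence must be finite.
  have hfin : disc t * ∫⁻ x, w x * Z.ltransition t (Z.resolvent f) x ∂m ≠ ⊤ := by
    refine ENNReal.mul_ne_top (disc_ne_top t) (ne_top_of_le_ne_top (b := (∫⁻ x, f x ∂m) * b)
      (ENNReal.mul_ne_top hfm hb) ?_)
    calc ∫⁻ x, w x * Z.ltransition t (Z.resolvent f) x ∂m
        ≤ ∫⁻ x, Z.resolvent f x * b ∂m := lintegral_mono fun x =>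
          mul_le_mul' (hwf x) (Z.ltransition_le_of_le t (Z.resolvent_le hfb) x)
      _ = (∫⁻ x, Z.resolvent f x ∂m) * b := lintegral_mul_const _ hh
      _ ≤ _ := by
        exact mul_le_mul_left (hZ.lintegral_resolvent_le hf hT) _
  have hshort : ∫⁻ x, w x *
      (∫⁻ s in Ioc (0 : ℝ) t, disc s.toNNReal * Z.ltransition s.toNNReal f x) ∂m ≤
      t * ∫⁻ x, w x * f x ∂m := by
    rw [Z.lintegral_mul_resolvent hf hT hw]
    calc _ ≤ ∫⁻ s in Ioc (0 : ℝ) t, ∫⁻ x, w x * f x ∂m := by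
          refine lintegral_mono fun s => ?_
          dsimp only
          rw [hZ _ _ _ hw hf, ← lintegral_const_mul' _ _ (disc_ne_top _)]
          refine lintegral_mono fun x => ?_
          dsimp only
          rw [← mul_assoc]
          gcongr
          exact hexc _ _
      _ = t * ∫⁻ x, w x * f x ∂m := by
          rw [setLIntegral_const, Real.volume_Ioc, sub_zero, ENNReal.ofReal_coe_nnreal, mul_comm]
  have hpt : ∀ x, w x * w x + disc t * Z.ltransition t w x * Z.resolvent f x ≤
      w x * (∫⁻ s in Ioc (0 : ℝ) t, disc s.toNNReal * Z.ltransition s.toNNReal f x) +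
      w x * (disc t * Z.ltransition t (Z.resolvent f) x) + disc t * Z.ltransition t w x * w x := by
    intro x
    rw [← mul_add, ← Z.resolvent_eq hf hT t x, add_comm, add_comm (w x * Z.resolvent f x)]
    have := ENNReal.mul_add_mul_le (hexc t x) (hwf x)
    exact this
  have hint := lintegral_mono (μ := m) hpt
  rw [lintegral_add_left (by fun_prop), lintegral_add_right _ (by fun_prop),
    lintegral_add_right _ (by fun_prop)] at hint
  have e1 : ∫⁻ x, disc t * Z.ltransition t w x * Z.resolvent f x ∂m =
      disc t * ∫⁻ x, w x * Z.ltransition t (Z.resolvent f) x ∂m := by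
    rw [hZ t _ _ hw hh, ← lintegral_const_mul' _ _ (disc_ne_top t)]
    simp only [mul_assoc]
  have e2 : ∫⁻ x, w x * (disc t * Z.ltransition t (Z.resolvent f) x) ∂m =
      disc t * ∫⁻ x, w x * Z.ltransition t (Z.resolvent f) x ∂m := by
    rw [← lintegral_const_mul' _ _ (disc_ne_top t)]
    simp only [mul_left_comm]
  have e3 : ∫⁻ x, disc t * Z.ltransition t w x * w x ∂m =
      disc t * ∫⁻ x, w x * Z.ltransition t w x ∂m := by
    rw [← lintegral_const_mul' _ _ (disc_ne_top t)]
    simp only [mul_assoc, mul_comm (w _)]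
  rw [e1, e2, e3] at hint
  refine (ENNReal.add_le_add_iff_right hfin).1 (hint.trans ?_)
  calc _ ≤ t * (∫⁻ x, w x * f x ∂m) +
        disc t * (∫⁻ x, w x * Z.ltransition t (Z.resolvent f) x ∂m) +
        disc t * ∫⁻ x, w x * Z.ltransition t w x ∂m := by gcongr
    _ = _ := by ring

end

end HuntProcess

/-! ### Truncated potentials belong to the form domain -/

namespace HuntProcess

variable {M Ω : Type*} [TopologicalSpace M] [MeasurableSpace M] [BorelSpace M]
  [MeasurableSpace Ω] {Z : HuntProcess M Ω} {m : Measure M}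

/-- By symmetry p_t 1_S has integral at most m(S) = 0, so from almost every starting point X_t
avoids the null set where u and v differ. -/
theorem IsSymmetric.transition_congr_ae (hZ : Z.IsSymmetric m) (t : ℝ≥0) {u v : M → ℝ}
    (huv : u =ᵐ[m] v) : ∀ᵐ x ∂m, Z.transition t u x = Z.transition t v x := by
  set S := toMeasurable m {x | u x ≠ v x}
  have hS : MeasurableSet S := measurableSet_toMeasurable _ _
  have hS0 : m S = 0 := by rw [measure_toMeasurable]; exact huv
  have hi : Measurable (S.indicator fun _ : M => (1 : ℝ≥0∞)) := measurable_const.indicator hS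
  have h0 : ∫⁻ x, Z.ltransition t (S.indicator fun _ => 1) x ∂m = 0 := by
    refine le_antisymm ((hZ.lintegral_ltransition_le t hi).trans ?_) zero_le
    rw [lintegral_indicator_const hS, one_mul, hS0]
  rw [lintegral_eq_zero_iff (Z.measurable_ltransition t hi)] at h0
  filter_upwards [h0] with x hx
  have h1 := (lintegral_eq_zero_iff
    ((OnePoint.measurable_elim_zero hi).comp (Z.measurable_X t))).1 hx
  refine integral_congr_ae ?_
  filter_upwards [h1] with ω hω
  dsimp only [Pi.zero_apply, Function.comp_apply] at hω ⊢
  revert hω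
  induction Z.X t ω using OnePoint.rec with
  | infty => simp
  | coe y =>
    intro hω
    rw [OnePoint.elim_some] at hω
    by_contra hne
    have hy : y ∈ S := subset_toMeasurable _ _ hne
    simp [hy] at hω

theorem transition_toReal (t : ℝ≥0) {w : M → ℝ≥0∞} (hw : Measurable w) (hw1 : ∀ x, w x ≤ 1)
    (x : M) : Z.transition t (fun y => (w y).toReal) x = (Z.ltransition t w x).toReal := by
  have hm : Measurable fun ω => (Z.X t ω).elim 0 w :=
    (OnePoint.measurable_elim_zero hw).comp (Z.measurable_X t)
  rw [ltransition, ← integral_toReal hm.aemeasurable (.of_forall fun ω => ?_)]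
  · refine integral_congr_ae (.of_forall fun ω => ?_)
    dsimp only [Function.comp_apply]
    induction Z.X t ω using OnePoint.rec with
    | infty => simp
    | coe y => simp
  · induction Z.X t ω using OnePoint.rec with
    | infty => simp
    | coe y => simpa using (hw1 y).trans_lt ENNReal.one_lt_top

/-- With D = (w, f) and B(t) = (w, p_t w), B is midpoint convex, bounded, and B(0) - B(t) ≤ t D. So
the quotients defining the form converge to some l ≤ D. -/
theorem IsGeneratedBy.exists_energyOne_le [SFinite m] {E : DirichletForm m}
    (hZ : Z.IsGeneratedBy E) {f : M → ℝ≥0∞} (hf : Measurable f)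
    (hT : Measurable fun z : ℝ≥0 × M => Z.ltransition z.1 f z.2) {b : ℝ≥0∞} (hb : b ≠ ⊤)
    (hfb : ∀ x, f x ≤ b) (hfm : ∫⁻ x, f x ∂m ≠ ⊤) {w : M → ℝ≥0∞} (hw : Measurable w)
    (hw1 : ∀ x, w x ≤ 1) (hexc : Z.IsExcessive w) (hwf : ∀ x, w x ≤ Z.resolvent f x) :
    ∃ u : E.dom, (∀ᵐ x ∂m, (u : Lp ℝ 2 m) x = (w x).toReal) ∧
      E.energyOne u ≤ 3 * (∫⁻ x, w x * f x ∂m).toReal := by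
  obtain ⟨hsym, hform, hdom⟩ := hZ
  have hwm : ∫⁻ x, w x ∂m ≠ ⊤ :=
    ne_top_of_le_ne_top hfm ((lintegral_mono hwf).trans (hsym.lintegral_resolvent_le hf hT))
  have hTw := fun t => Z.measurable_ltransition t hw
  have hT1 := fun t => Z.ltransition_le_of_le t hw1
  have hle : ∀ t, ∫⁻ x, w x * Z.ltransition t w x ∂m ≤ ∫⁻ x, w x ∂m := fun t =>
    lintegral_mono fun x => (mul_le_mul_right (hT1 t x) _).trans_eq (mul_one _)
  have hfin : ∀ t, ∫⁻ x, w x * Z.ltransition t w x ∂m ≠ ⊤ := fun t => ne_top_of_le_ne_top hwm (hle t)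
  have hDfin : ∫⁻ x, w x * f x ∂m ≠ ⊤ :=
    ne_top_of_le_ne_top hfm (lintegral_mono fun x =>
      (mul_le_mul_left (hw1 x) _).trans_eq (one_mul _))
  set B : ℝ≥0 → ℝ := fun t => (∫⁻ x, w x * Z.ltransition t w x ∂m).toReal with hB
  set D := (∫⁻ x, w x * f x ∂m).toReal with hD
  have hD0 : 0 ≤ D := ENNReal.toReal_nonneg
  have hB0 : ∀ t, 0 ≤ B t := fun t => ENNReal.toReal_nonneg
  have hBD : ∀ t : ℝ≥0, B 0 ≤ Real.exp (-t) * B t + t * D := by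
    intro t
    have h := hsym.lintegral_sq_le hf hT hb hfb hfm hw hexc hwf t
    have h1 := ENNReal.toReal_mono (ENNReal.add_ne_top.2 ⟨ENNReal.mul_ne_top (disc_ne_top t) (hfin t),
      ENNReal.mul_ne_top ENNReal.coe_ne_top hDfin⟩) h
    rw [ENNReal.toReal_add (ENNReal.mul_ne_top (disc_ne_top t) (hfin t))
      (ENNReal.mul_ne_top ENNReal.coe_ne_top hDfin), ENNReal.toReal_mul, ENNReal.toReal_mul, disc,
      ENNReal.toReal_ofReal (Real.exp_pos _).le, ENNReal.coe_toReal] at h1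
    simpa only [hB, Z.ltransition_zero] using h1
  have hmid : ∀ s t, 2 * B (s + t) ≤ B (2 * s) + B (2 * t) := by
    intro s t
    have h1 := ENNReal.toReal_mono (ENNReal.add_ne_top.2 ⟨hfin _, hfin _⟩)
      (hsym.two_mul_lintegral_le s t hw)
    rw [ENNReal.toReal_add (hfin _) (hfin _), ENNReal.toReal_mul] at h1
    simpa only [hB, ENNReal.toReal_ofNat] using h1
  have hC : ∀ t, B t ≤ (∫⁻ x, w x ∂m).toReal := fun t => ENNReal.toReal_mono hwm (hle t)
  obtain ⟨l, hl, hlim⟩ := exists_tendsto_of_midpoint hmid hC (D := D) fun t => by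
    have h1 : Real.exp (-t) * B t ≤ 1 * B t :=
      mul_le_mul_of_nonneg_right (Real.exp_le_one_iff.2 (neg_nonpos.2 t.coe_nonneg)) (hB0 t)
    linarith [hBD t]
  have hanti := antitone_of_midpoint hmid hC
  have hprod : ∀ t, Measurable fun x => w x * Z.ltransition t w x := fun t => hw.mul (hTw t)
  have hint : ∀ t, Integrable (fun x => (w x).toReal * (Z.ltransition t w x).toReal) m := fun t => by
    simpa only [ENNReal.toReal_mul] using
      integrable_toReal_of_lintegral_ne_top (hprod t).aemeasurable (hfin t)
  have hBint : ∀ t, ∫ x, (w x).toReal * (Z.ltransition t w x).toReal ∂m = B t := fun t => by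
    rw [hB]
    dsimp only
    rw [← integral_toReal (hprod t).aemeasurable (.of_forall fun x => ENNReal.mul_lt_top
      ((hw1 x).trans_lt ENNReal.one_lt_top) ((hT1 t x).trans_lt ENNReal.one_lt_top))]
    simp only [ENNReal.toReal_mul]
  have hmem : MemLp (fun x => (w x).toReal) 2 m := by
    rw [memLp_two_iff_integrable_sq hw.ennreal_toReal.aestronglyMeasurable]
    simpa only [Z.ltransition_zero, sq] using hint 0
  set u : Lp ℝ 2 m := hmem.toLp _ with hu
  have huw : ∀ᵐ x ∂m, u x = (w x).toReal := hmem.coeFn_toLp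
  have hquot : ∀ t : ℝ≥0, ∫ x, (u x - Z.transition t u x) * u x ∂m = B 0 - B t := by
    intro t
    rw [← hBint 0, ← hBint t, ← integral_sub (hint 0) (hint t)]
    refine integral_congr_ae ?_
    filter_upwards [huw, hsym.transition_congr_ae t huw] with x h1 h2
    rw [h1, h2, Z.transition_toReal t hw hw1, Z.ltransition_zero]
    ring
  have hlim' : Tendsto (fun t : ℝ≥0 => (t : ℝ)⁻¹ * ∫ x, (u x - Z.transition t u x) * u x ∂m)
      (𝓝[>] 0) (𝓝 l) := by simpa only [hquot] using hlim
  have hud : u ∈ E.dom := hdom u ⟨l, hlim'⟩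
  refine ⟨⟨u, hud⟩, huw, ?_⟩
  have hE : E.form ⟨u, hud⟩ ⟨u, hud⟩ = l := tendsto_nhds_unique (hform ⟨u, hud⟩) hlim'
  have hn : ‖u‖ ^ 2 = B 0 := by
    rw [← real_inner_self_eq_norm_sq, L2.inner_def, ← hBint 0]
    refine integral_congr_ae ?_
    filter_upwards [huw] with x h1
    rw [h1, Z.ltransition_zero, real_inner_self_eq_norm_sq, Real.norm_eq_abs, sq_abs, sq]
  rw [DirichletForm.energyOne, hE]
  dsimp only
  rw [hn]
  -- At t = 1: B(0) ≤ e⁻¹ B(1) + D ≤ B(0)/2 + D. With the energy at most D, the total is 3D.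
  have h2 : B 0 ≤ 2 * D := by
    have h3 := hBD 1
    have h4 := hanti (zero_le (a := (1 : ℝ≥0)))
    have h5 : Real.exp (-(1 : ℝ≥0)) ≤ 1 / 2 := by
      rw [NNReal.coe_one, Real.exp_neg, one_div]
      have := Real.add_one_le_exp (1 : ℝ)
      exact inv_anti₀ two_pos (by linarith)
    have h6 : Real.exp (-(1 : ℝ≥0)) * B 1 ≤ 1 / 2 * B 0 :=
      mul_le_mul h5 h4 (hB0 1) (by norm_num)
    rw [NNReal.coe_one, one_mul] at h3
    rw [NNReal.coe_one] at h6
    linarith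
  linarith

end HuntProcess

/-! ### Sets of capacity zero are local -/

namespace DirichletForm

variable {M : Type*} [MeasurableSpace M] {m : Measure M} (E : DirichletForm m)

theorem energyOne_nonneg (u : E.dom) : 0 ≤ E.energyOne u :=
  add_nonneg (E.nonneg u) (sq_nonneg _)

theorem sq_norm_le_energyOne (u : E.dom) : ‖(u : Lp ℝ 2 m)‖ ^ 2 ≤ E.energyOne u :=
  le_add_of_nonneg_left (E.nonneg u)

theorem energyOne_zero : E.energyOne 0 = 0 := by simp [energyOne]

theorem energyOne_neg (u : E.dom) : E.energyOne (-u) = E.energyOne u := by simp [energyOne]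

theorem energyOne_add_le (u v : E.dom) :
    E.energyOne (u + v) ≤ 2 * E.energyOne u + 2 * E.energyOne v := by
  have h1 := E.nonneg (u - v)
  have h2 := parallelogram_law_with_norm ℝ (u : Lp ℝ 2 m) v
  have h3 := sq_nonneg ‖(u : Lp ℝ 2 m) - v‖
  simp only [energyOne, map_add, map_sub, LinearMap.add_apply, LinearMap.sub_apply,
    Submodule.coe_add] at h1 ⊢
  nlinarith

/-- Each addition doubles the bound, which the ratio 1/4 absorbs: in units of δ 4^(-k), splitting
off the first term gives 2 · 4/4 + 2 = 4. -/
theorem energyOne_sum_le {u : ℕ → E.dom} {δ : ℝ} (hu : ∀ j, E.energyOne (u j) ≤ δ * (1 / 4) ^ j)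
    (n k : ℕ) : E.energyOne (∑ j ∈ Finset.range n, u (k + j)) ≤ 4 * (δ * (1 / 4) ^ k) := by
  have hδ : ∀ k : ℕ, 0 ≤ δ * (1 / 4) ^ k := fun k => (E.energyOne_nonneg _).trans (hu k)
  induction n generalizing k with
  | zero => simpa [energyOne_zero] using hδ k
  | succ n ih =>
    rw [Finset.sum_range_succ']
    have h1 := ih (k + 1)
    have h2 : (fun j => u (k + (j + 1))) = fun j => u (k + 1 + j) := by
      funext j
      congr 1
      ring
    simp only [h2, add_zero]
    refine (E.energyOne_add_le _ _).trans ?_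
    rw [pow_succ] at h1
    linarith [hu k]

theorem exists_tendsto_sum {u : ℕ → E.dom} {δ : ℝ} (hδ : 0 < δ)
    (hu : ∀ j, E.energyOne (u j) ≤ δ * (1 / 4) ^ j) :
    ∃ v : E.dom, E.energyOne v ≤ 10 * δ ∧
      Tendsto (fun n => ∑ j ∈ Finset.range n, (u j : Lp ℝ 2 m)) atTop (𝓝 (v : Lp ℝ 2 m)) := by
  have hdiff : ∀ i j, i ≤ j → E.energyOne
      (∑ l ∈ Finset.range j, u l - ∑ l ∈ Finset.range i, u l) ≤ 4 * (δ * (1 / 4) ^ i) := by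
    intro i j hij
    obtain ⟨n, rfl⟩ := exists_add_of_le hij
    rw [Finset.sum_range_add, add_sub_cancel_left]
    exact E.energyOne_sum_le hu n i
  have hpow : Tendsto (fun i : ℕ => 4 * (δ * (1 / 4 : ℝ) ^ i)) atTop (𝓝 0) := by
    have := ((tendsto_pow_atTop_nhds_zero_of_lt_one (r := (1 / 4 : ℝ)) (by norm_num)
      (by norm_num)).const_mul δ).const_mul 4
    simpa using this
  obtain ⟨v, hv⟩ := E.closed (fun n => ∑ l ∈ Finset.range n, u l) fun ε hε => by
    obtain ⟨n₀, hn₀⟩ := eventually_atTop.1 (hpow.eventually_lt_const hε)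
    refine ⟨n₀, fun i hi j hj => ?_⟩
    rcases le_total i j with h | h
    · have h1 := (hdiff i j h).trans_lt (hn₀ i hi)
      rw [← E.energyOne_neg, neg_sub] at h1
      simpa only [energyOne, Submodule.coe_sub] using h1
    · simpa only [energyOne, Submodule.coe_sub] using (hdiff j i h).trans_lt (hn₀ j hj)
  have hv' : Tendsto (fun n => E.energyOne (∑ l ∈ Finset.range n, u l - v)) atTop (𝓝 0) := by
    simpa only [energyOne, Submodule.coe_sub] using hv
  -- The bound 10 δ is 2 · 4δ for a partial sum plus 2 · δ for a remainder of energy at most δ.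
  refine ⟨v, ?_, ?_⟩
  · obtain ⟨n, hn⟩ := (hv'.eventually_le_const hδ).exists
    have h1 := E.energyOne_add_le (∑ l ∈ Finset.range n, u l)
      (-(∑ l ∈ Finset.range n, u l - v))
    rw [E.energyOne_neg, neg_sub, add_sub_cancel] at h1
    have h2 := hdiff 0 n (Nat.zero_le n)
    simp only [Finset.range_zero, Finset.sum_empty, sub_zero, pow_zero, mul_one] at h2
    linarith
  · rw [tendsto_iff_norm_sub_tendsto_zero]
    have h1 := hv'.sqrt
    rw [Real.sqrt_zero] at h1
    refine squeeze_zero (fun n => norm_nonneg _) (fun n => ?_) h1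
    refine Real.le_sqrt_of_sq_le ((le_of_eq ?_).trans (E.sq_norm_le_energyOne _))
    simp

/-- Countably many of the U cover M. Choosing the j-th function with energy at most δ 4^(-j), the
sum dominates each of the nonnegative terms, so it is at least 1 a.e. on the open set ⋃ (G_j ∩ U_j)
⊇ N. -/
theorem cap_eq_zero_of_locally [TopologicalSpace M] [SecondCountableTopology M] {N : Set M}
    (h : ∀ x : M, ∃ U : Set M, IsOpen U ∧ x ∈ U ∧ ∀ ε > 0, ∃ G : Set M, IsOpen G ∧ N ⊆ G ∧
      ∃ u : E.dom, 0 ≤ (u : Lp ℝ 2 m) ∧ E.energyOne u ≤ ε ∧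
        ∀ᵐ x ∂m, x ∈ G ∩ U → 1 ≤ (u : Lp ℝ 2 m) x) : E.cap N = 0 := by
  rcases isEmpty_or_nonempty M with hM | hM
  · refine le_antisymm ?_ zero_le
    refine (iInf₂_le ∅ isOpen_empty).trans ((iInf_le _ fun x _ => hM.elim x).trans ?_)
    refine (iInf₂_le 0 (.of_forall fun x => hM.elim x)).trans ?_
    simp [energyOne_zero]
  choose U hU hxU hsmall using h
  obtain ⟨s, hs, hsU⟩ := TopologicalSpace.countable_cover_nhds fun x => (hU x).mem_nhds (hxU x)
  have hne : s.Nonempty := by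
    by_contra hne
    rw [not_nonempty_iff_eq_empty.1 hne] at hsU
    exact empty_ne_univ (by simpa using hsU)
  obtain ⟨x, rfl⟩ := hs.exists_eq_range hne
  rw [biUnion_range] at hsU
  have key : ∀ δ > 0, E.cap N ≤ ENNReal.ofReal (10 * δ) := by
    intro δ hδ
    choose G hG hNG u hu0 hue hu1 using fun j : ℕ =>
      hsmall (x j) (δ * (1 / 4) ^ j) (by positivity)
    obtain ⟨v, hv, hlim⟩ := E.exists_tendsto_sum hδ hue
    have huv : ∀ j, (u j : Lp ℝ 2 m) ≤ v := fun j => by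
      refine ge_of_tendsto hlim (eventually_atTop.2 ⟨j + 1, fun n hn => ?_⟩)
      exact Finset.single_le_sum (f := fun l => (u l : Lp ℝ 2 m)) (fun l _ => hu0 l)
        (Finset.mem_range.2 hn)
    refine (iInf₂_le (⋃ j, G j ∩ U (x j)) (isOpen_iUnion fun j => (hG j).inter (hU _))).trans
      ((iInf_le _ fun y hy => ?_).trans ((iInf₂_le v ?_).trans (ENNReal.ofReal_le_ofReal hv)))
    · obtain ⟨j, hj⟩ := mem_iUnion.1 (hsU.symm.subset (mem_univ y))
      exact mem_iUnion.2 ⟨j, hNG j hy, hj⟩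
    · have h1 : ∀ᵐ y ∂m, ∀ j, y ∈ G j ∩ U (x j) → 1 ≤ (u j : Lp ℝ 2 m) y := ae_all_iff.2 hu1
      have h2 : ∀ᵐ y ∂m, ∀ j, (u j : Lp ℝ 2 m) y ≤ (v : Lp ℝ 2 m) y :=
        ae_all_iff.2 fun j => (Lp.coeFn_le _ _).2 (huv j)
      filter_upwards [h1, h2] with y hy1 hy2 hy
      obtain ⟨j, hj⟩ := mem_iUnion.1 hy
      exact (hy1 j hj).trans (hy2 j)
  refine le_antisymm (le_of_forall_gt_imp_ge_of_dense fun ε hε => ?_) zero_le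
  have h1 := ENNReal.lt_iff_exists_real_btwn.1 hε
  obtain ⟨r, -, hr0, hr⟩ := h1
  have hr0' : 0 < r := ENNReal.ofReal_pos.1 hr0
  refine (key (r / 10) (by positivity)).trans ?_
  rw [mul_div_cancel₀ _ (by norm_num)]
  exact hr.le

end DirichletForm

/-! ### Properly exceptional sets have capacity zero -/

namespace HuntProcess

variable {M Ω : Type*} [MetricSpace M] [LocallyCompactSpace M] [MeasurableSpace M] [BorelSpace M]
  [MeasurableSpace Ω] {m : Measure M} [IsLocallyFiniteMeasure m] [m.IsOpenPosMeasure]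
  {Z : HuntProcess M Ω} {N : Set M} {p : ℝ≥0 → M → M → ℝ≥0} {φ : ℝ → ℝ} {d₁ d₂ d₃ d₄ : ℝ}

theorem mul_transProb_le_ltransition (t : ℝ≥0) {f : M → ℝ≥0∞} {A : Set M}
    (hA : MeasurableSet A) {a : ℝ≥0∞} (h : ∀ x ∈ A, a ≤ f x) (x : M) :
    a * Z.transProb t x A ≤ Z.ltransition t f x := by
  have hm : MeasurableSet {ω | Z.X t ω ∈ ((↑) : M → OnePoint M) '' A} :=
    Z.ℱ.le t _ (Z.measurableSet_mem t hA)
  rw [transProb, ← lintegral_indicator_const hm]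
  refine lintegral_mono fun ω => indicator_le (s := {ω | Z.X t ω ∈ ((↑) : M → OnePoint M) '' A})
    (f := fun _ => a) (g := fun ω => (Z.X t ω).elim 0 f) (fun ω hω => ?_) ω
  obtain ⟨y, hy, hyω⟩ := hω
  rw [← hyω, OnePoint.elim_some]
  exact h y hy

/-- Locally, some bounded integrable function with continuous extension has a resolvent that is
bounded below. -/
theorem IsHeatKernel.exists_one_le_resolvent (hp : Z.IsHeatKernel m N p) (hN : MeasurableSet N)
    (hN0 : m N = 0) (hV : VolumeGrowth m d₁ d₂) (hφ : IsScaleFunction φ d₃ d₄)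
    (hest : HeatKernelEstimate m N p φ) (x₀ : M) :
    ∃ f : M → ℝ≥0∞, ∃ b : ℝ≥0∞, ∃ ρ > 0, Continuous f ∧
      (Continuous fun y : OnePoint M => y.elim 0 f) ∧ b ≠ ⊤ ∧ (∀ x, f x ≤ b) ∧
      ∫⁻ x, f x ∂m ≠ ⊤ ∧ ∀ x ∈ Metric.ball x₀ ρ, x ∉ N → 1 ≤ Z.resolvent f x := by
  obtain ⟨c, hc, hlow⟩ := hp.exists_le_transProb_ball_of_lt hN hN0 hV hφ hest
  obtain ⟨r, hr, hK⟩ := Metric.exists_isCompact_closedBall x₀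
  have hφr : 0 < φ (r / 4) := hφ.pos (by positivity)
  -- Normalised to give resolvent at least 1 on B(x₀, r/4): height r/2 of the tent, probability c of
  -- staying within r/4, discount and length of the time window.
  set κ : ℝ := r / 2 * (c * (Real.exp (-φ (r / 4)) * (φ (r / 4) / 2))) with hκ
  have hκ0 : 0 < κ := by positivity
  set F : M → ℝ := fun x => κ⁻¹ * max 0 (r - dist x x₀) with hF
  have hFc : Continuous F := by fun_prop
  have hF0 : ∀ x, x ∉ Metric.closedBall x₀ r → F x = 0 := fun x hx => by
    have : r < dist x x₀ := not_le.1 hx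
    rw [hF]
    dsimp only
    rw [max_eq_left (by linarith), mul_zero]
  have hFs : HasCompactSupport F := HasCompactSupport.intro hK hF0
  have hFb : ∀ x, F x ≤ κ⁻¹ * r := fun x => by
    rw [hF]
    dsimp only
    gcongr
    exact max_le hr.le (by linarith [dist_nonneg (x := x) (y := x₀)])
  refine ⟨fun x => ENNReal.ofReal (F x), ENNReal.ofReal (κ⁻¹ * r), r / 4, by positivity,
    ENNReal.continuous_ofReal.comp hFc, ?_, ENNReal.ofReal_ne_top,
    fun x => ENNReal.ofReal_le_ofReal (hFb x), ?_, fun x hx hxN => ?_⟩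
  · have h1 := ENNReal.continuous_ofReal.comp (OnePoint.continuous_elim_zero hFc hFs)
    refine h1.congr fun y => ?_
    induction y using OnePoint.rec with
    | infty => simp
    | coe y => simp
  · have h1 : ∀ x, ENNReal.ofReal (F x) ≤
        (Metric.closedBall x₀ r).indicator (fun _ => ENNReal.ofReal (κ⁻¹ * r)) x := fun x => by
      by_cases hx : x ∈ Metric.closedBall x₀ r
      · rw [indicator_of_mem hx]
        exact ENNReal.ofReal_le_ofReal (hFb x)
      · rw [hF0 x hx]
        simp
    refine ne_top_of_le_ne_top ?_ (lintegral_mono h1)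
    rw [lintegral_indicator_const Metric.isClosed_closedBall.measurableSet]
    exact ENNReal.mul_ne_top ENNReal.ofReal_ne_top hK.measure_ne_top
  · have hball : ∀ y ∈ Metric.ball x (r / 4),
        ENNReal.ofReal (κ⁻¹ * (r / 2)) ≤ ENNReal.ofReal (F y) := fun y hy => by
      refine ENNReal.ofReal_le_ofReal ?_
      rw [hF]
      dsimp only
      gcongr
      refine le_max_of_le_right ?_
      have h1 := dist_triangle y x x₀
      rw [Metric.mem_ball] at hx hy
      linarith
    calc (1 : ℝ≥0∞) = ENNReal.ofReal (Real.exp (-φ (r / 4))) *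
          (ENNReal.ofReal (κ⁻¹ * (r / 2)) * ENNReal.ofReal c) * ENNReal.ofReal (φ (r / 4) / 2) := by
          rw [← ENNReal.ofReal_mul (by positivity), ← ENNReal.ofReal_mul (by positivity),
            ← ENNReal.ofReal_mul (by positivity), ← ENNReal.ofReal_one]
          congr 1
          rw [hκ]
          field_simp
      _ = ∫⁻ s in Ioo (φ (r / 4) / 2) (φ (r / 4)), ENNReal.ofReal (Real.exp (-φ (r / 4))) *
          (ENNReal.ofReal (κ⁻¹ * (r / 2)) * ENNReal.ofReal c) := by
          rw [setLIntegral_const, Real.volume_Ioo, sub_half]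
      _ ≤ ∫⁻ s in Ioo (φ (r / 4) / 2) (φ (r / 4)), disc s.toNNReal *
          Z.ltransition s.toNNReal (fun x => ENNReal.ofReal (F x)) x := by
          refine setLIntegral_mono' measurableSet_Ioo fun s hs => ?_
          have hs0 : (s.toNNReal : ℝ) = s := Real.coe_toNNReal _ (by linarith [hs.1])
          refine mul_le_mul' ?_ ?_
          · rw [disc, hs0]
            exact ENNReal.ofReal_le_ofReal (Real.exp_le_exp.2 (by linarith [hs.2]))
          · refine le_trans ?_ (mul_transProb_le_ltransition _ Metric.isOpen_ball.measurableSet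
              hball x)
            gcongr
            exact hlow _ x hxN _ (by positivity) (by rw [hs0]; exact hs.1) (by rw [hs0]; exact hs.2)
      _ ≤ Z.resolvent (fun x => ENNReal.ofReal (F x)) x :=
          lintegral_mono_set fun s hs => (half_pos hφr).trans hs.1

/-- For an open G ⊇ N, the minimum of its hitting potential and Uf is 1 at almost every point of G
near x₀, and has energy at most three times the mean hitting potential of G under f·m. The latter
can be made arbitrarily small. -/
theorem IsHeatKernel.cap_eq_zero [SecondCountableTopology M] {E : DirichletForm m}
    (hZ : Z.IsGeneratedBy E) (hp : Z.IsHeatKernel m N p) (hN : Z.IsProperlyExceptional m N)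
    (hV : VolumeGrowth m d₁ d₂) (hφ : IsScaleFunction φ d₃ d₄)
    (hest : HeatKernelEstimate m N p φ) : E.cap N = 0 := by
  refine E.cap_eq_zero_of_locally fun x₀ => ?_
  obtain ⟨f, b, ρ, hρ, hf, hfc, hb, hfb, hfm, hres⟩ :=
    hp.exists_one_le_resolvent hN.1 hN.2.1 hV hφ hest x₀
  have hT := Z.measurable_ltransition_uncurry hf hfc hb hfb
  refine ⟨Metric.ball x₀ ρ, Metric.isOpen_ball, Metric.mem_ball_self hρ, fun ε hε => ?_⟩
  have : IsFiniteMeasure (m.withDensity f) := isFiniteMeasure_withDensity hfm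
  have hcap := hN.outerCap_meanHitPot_eq_zero (m.withDensity f) (withDensity_absolutelyContinuous m f)
  obtain ⟨G, hG, hNG, hGε⟩ := IsOpenCapacity.exists_isOpen_lt (hcap.trans_lt
    (ENNReal.ofReal_pos.2 (show 0 < ε / 3 by positivity)))
  have hq := Z.measurable_hitPot_coe hG
  obtain ⟨u, huw, hue⟩ := hZ.exists_energyOne_le hf.measurable hT hb hfb hfm
    (w := fun x => min (Z.hitPot (((↑) : M → OnePoint M) '' G) x) (Z.resolvent f x))
    (hq.min (Z.measurable_resolvent hf.measurable hT))
    (fun x => (min_le_left _ _).trans (Z.hitPot_le_one _ _))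
    ((isExcessive_hitPot (OnePoint.isOpenMap_coe _ hG)).inf (isExcessive_resolvent hf.measurable hT))
    (fun x => min_le_right _ _)
  refine ⟨G, hG, hNG, u, ?_, hue.trans ?_, ?_⟩
  · rw [← Lp.coeFn_nonneg]
    filter_upwards [huw] with x hx
    rw [hx]
    exact ENNReal.toReal_nonneg
  · have h1 : ∫⁻ x, min (Z.hitPot (((↑) : M → OnePoint M) '' G) x) (Z.resolvent f x) * f x ∂m ≤
        ENNReal.ofReal (ε / 3) := by
      refine le_trans ?_ hGε.le
      rw [meanHitPot, lintegral_withDensity_eq_lintegral_mul _ hf.measurable hq]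
      refine lintegral_mono fun x => ?_
      rw [Pi.mul_apply, mul_comm]
      exact mul_le_mul_right (min_le_left _ _) _
    have h2 := ENNReal.toReal_mono ENNReal.ofReal_ne_top h1
    rw [ENNReal.toReal_ofReal (by positivity)] at h2
    linarith
  · filter_upwards [huw, measure_eq_zero_iff_ae_notMem.1 hN.2.1] with x hx hxN hxG
    have h1 : min (Z.hitPot (((↑) : M → OnePoint M) '' G) x) (Z.resolvent f x) = 1 :=
      le_antisymm ((min_le_left _ _).trans (Z.hitPot_le_one _ _))
        (le_min (Z.one_le_hitPot (mem_image_of_mem _ hxG.1)) (hres x hxG.2 hxN))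
    rw [hx, h1, ENNReal.toReal_one]

end HuntProcess

end

/-! ### The two-sided tail estimate off the exceptional set -/

theorem theorem2p4 {M Ω : Type*} [MetricSpace M] [LocallyCompactSpace M]
    [TopologicalSpace.SeparableSpace M] [MeasurableSpace M] [BorelSpace M] [MeasurableSpace Ω]
    (m : Measure M) [IsLocallyFiniteMeasure m] [m.IsOpenPosMeasure]
    (E : DirichletForm m) (hreg : E.IsRegular) (hjump : E.IsPureJump)
    (Z : HuntProcess M Ω) (hZ : Z.IsGeneratedBy E)
    (d₁ d₂ d₃ d₄ : ℝ) (hV : VolumeGrowth m d₁ d₂)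
    (N : Set M) (hN : Z.IsProperlyExceptional m N)
    (p : ℝ≥0 → M → M → ℝ≥0) (hp : Z.IsHeatKernel m N p)
    (φ : ℝ → ℝ) (hφ : IsScaleFunction φ d₃ d₄) (hest : HeatKernelEstimate m N p φ)
    (hd : d₄ < d₁)
    (g : ℝ → ℝ) (hg_pos : ∀ t, 0 < t → 0 < g t) (hg_anti : AntitoneOn g (Ioi 0))
    (hg_lim : Tendsto g atTop (𝓝 0)) :
    E.QuasiEverywhere fun x =>
      tailIntegral m φ g x 1 < ⊤ → RegularRatio g →
        AsympComparable (fun t => Z.bottomCrossing (rateFun φ g) t x)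
          (tailIntegral m φ g x) := by
  have := UniformSpace.secondCountable_of_separable M
  refine ⟨N, hp.cap_eq_zero hZ hN hV hφ hest, fun x hx hfin hg => ?_⟩
  obtain ⟨c, T, K, hr⟩ := hφ.exists_isRegularRate hg_pos hg_anti hg_lim hg
  obtain ⟨C₂, hC₂, hup⟩ := hp.exists_bottomCrossing_le hN.1 hN.2.1 hV hφ hest hr hg_pos
  obtain ⟨C₁, hC₁, hlow⟩ :=
    hp.exists_le_bottomCrossing hN.1 hN.2.1 hV hφ hest hd hr hg_pos hg_anti
  -- For t ≥ 1 the factor 1 + I(t) is at most 1 + I(1) < ∞, so the lower constant 1/A depends on x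
  -- but not on t.
  set A : ℝ≥0∞ := ENNReal.ofReal C₁ * (1 + tailIntegral m φ g x 1) with hA
  have hA0 : A ≠ 0 := mul_ne_zero (ENNReal.ofReal_pos.2 hC₁).ne' (by simp)
  have hA1 : A ≠ ⊤ := ENNReal.mul_ne_top ENNReal.ofReal_ne_top
    (ENNReal.add_ne_top.2 ⟨ENNReal.one_ne_top, hfin.ne⟩)
  have hAinv : A⁻¹ ≠ ⊤ := ENNReal.inv_ne_top.2 hA0
  refine ⟨max T 1, A⁻¹.toNNReal, C₂, by positivity,
    ENNReal.toNNReal_pos (ENNReal.inv_ne_zero.2 hA1) hAinv, hC₂, fun t ht => ⟨?_, ?_⟩⟩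
  · have hI : tailIntegral m φ g x t ≤ tailIntegral m φ g x 1 :=
      tailIntegral_anti m φ g x ((le_max_right _ _).trans ht)
    rw [ENNReal.coe_toNNReal hAinv, ENNReal.inv_mul_le_iff hA0 hA1]
    refine (hlow x hx t ((le_max_left _ _).trans ht) (hI.trans_lt hfin).ne).trans ?_
    rw [hA]
    gcongr
  · exact hup x hx t ((le_max_left _ _).trans ht)
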